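/- **Notation.** Let $d\ge 1$. A law is a Borel probability measure on $\mathbb R^d$; $\mathcal S_d$ is the space of symmetric real $d\times d$ matrices, $\mathcal P_d\subset\mathcal S_d$ the set of positive definite ones, $\|\cdot\|$ the operator norm, and for $0<\delta<1$, $\mathcal W_{\delta,d}=\{A\in\mathcal P_d:\max(\|A\|,\|A^{-1}\|)<1/\delta\}$. For $a>0$, $\mathcal U_{d,a}$ (resp. $\mathcal V_{d,a}$) is the set of laws $Q$ with $Q(H)<1-(d-q)/a$ for every linear (resp. nonempty affine) subspace $H$ of dimension $q\le d-1$. For $\nu>0$ let $\rho_{\nu,d}(s)=\frac{\nu+d}{2}\log\frac{\nu+s}{\nu}$. For $Q\in\mathcal U_{d,\nu+d}$, $A_\nu(Q)\in\mathcal P_d$ is the unique critical point, and the absolute minimum point, on $\mathcal P_d$ of $$A\mapsto \tfrac12\log\det A+\int \rho_{\nu,d}(y'A^{-1}y)-\rho_{\nu,d}(y'y)\,dQ(y).$$ For $\nu>1$ and $P\in\mathcal V_{d,\nu+d}$, $(\mu_\nu,\Sigma_\nu)(P)$ is the unique minimizer over $(\mu,\Sigma)\in\mathbb R^d\times\mathcal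 P_d$ of $$\int \tfrac12\log\det\Sigma+\rho_{\nu,d}((y-\mu)'\Sigma^{-1}(y-\mu))-\rho_{\nu,d}(y'y)\,dP(y).$$ For $r\ge1$ and $0<\delta<1$ let $\mathcal G^{(2)}_{\delta,r,d}$ be the set of functions $x\mapsto g(x)/\prod_{s=1}^v(1+x'C_sx)$ on $\mathbb R^d$, where $1\le v\le r$, $g$ is a monic monomial of degree $2v$, all $C_s\in\mathcal W_{\delta,d}$, and the $C_s$ take at most two different values. Let $Y^2_{\delta,r,d}$ be the space of all $f=\sum_{s\ge1}\lambda_sg_s$ with $g_s\in\mathcal G^{(2)}_{\delta,r,d}$ and $\sum_s|\lambda_s|<\infty$, with norm $\|f\|^{*}=\inf\sum_s|\lambda_s|$ over all such representations, and let $\mathbb R\oplus Y^2_{\delta,r,d}$ be the space of functions $c+g$, $c\in\mathbb R$, $g\in Y^2_{\delta,r,d}$, with norm $|c|+\|g\|^{*}$. With $\delta'=\delta\min(\nu,1/\nu)$ (which is $\delta/\nu$ if $\nu\ge1$), let $X_{\delta,r,\nu,d}$ be the dual Banach space of $\mathbb R\oplus Y^2_{\delta',r,d}$. A law $Q$ defines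 $\phi_Q\in X_{\delta,r,\nu,d}$ by $\phi_Q(f)=\int f\,dQ$. For $A\in\mathcal W_{\delta,d}$ put $$G_{(\nu)}(y,A)=-\frac A2+\frac{(\nu+d)\,yy'}{2(\nu+y'A^{-1}y)},$$ whose entries, as functions of $y$, lie in $\mathbb R\oplus Y^2_{\delta',r,d}$, and let $F(\phi,A)\in\mathcal S_d$ be obtained by applying $\phi\in X_{\delta,r,\nu,d}$ to each entry of $G_{(\nu)}(\cdot,A)$. A functional $T$ on a set $D$ of laws is called $C^k$ on $D$ for the norm of a space $X$ in which the laws are represented by elements $\phi_Q\in X$ if every $Q\in D$ has an open neighborhood $O$ of $\phi_Q$ in $X$ and a Fréchet $C^k$ map $S$ on $O$ such that every law $Q'$ with $\phi_{Q'}\in O$ satisfies $Q'\in D$ and $T(Q')=S(\phi_{Q'})$. **Theorem.** Let $d\ge1$, $k\ge1$ and $0<\nu<\infty$. For every $Q\in\mathcal U_{d,\nu+d}$ there is $\delta\in(0,1)$ such that $A_\nu(Q)\in\mathcal W_{\delta,d}$ and, for $X=X_{\delta,k+2,\nu,d}$: (a) $F$ is Fréchet $C^k$ from $X\times\mathcal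 W_{\delta,d}$ into $\mathcal S_d$; (b) for every $Q'\in\mathcal U_{d,\nu+d}$ with $A_\nu(Q')\in\mathcal W_{\delta,d}$ (in particular $Q'=Q$), the map $C\mapsto F(\phi_{Q'},C^{-1})$ is differentiable at $C=A_\nu(Q')^{-1}$ and its derivative, a linear map from $\mathcal S_d$ to $\mathcal S_d$, is invertible; (c) the functional $A_\nu$ is $C^k$ on $\{Q'\in\mathcal U_{d,\nu+d}:A_\nu(Q')\in\mathcal W_{\delta,d}\}$ for the norm of $X$. (d) If $\nu>1$, then for every $P\in\mathcal V_{d,\nu+d}$ there is $\delta\in(0,1)$ such that, representing each law $P'$ on $\mathbb R^d$ by $\phi_{\tilde P'}\in X_{\delta,k+2,\nu-1,d+1}$, where $\tilde P'$ is the image of $P'$ under $y\mapsto(y',1)'\in\mathbb R^{d+1}$, we have $A_{\nu-1}(\tilde P)\in\mathcal W_{\delta,d+1}$, $(\mu_\nu,\Sigma_\nu)(P)$ exists, and the functional $(\mu_\nu,\Sigma_\nu)$ is $C^k$ on $\{P'\in\mathcal V_{d,\nu+d}:A_{\nu-1}(\tilde P')\in\mathcal W_{\delta,d+1}\}$ for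 the norm of $X_{\delta,k+2,\nu-1,d+1}$. -/

import Mathlib

open MeasureTheory Set
open scoped Matrix Matrix.Norms.L2Operator

noncomputable section

namespace TFunctional

/-- The sample space `ℝ^d`, with its Euclidean norm and Borel structure. -/
abbrev E (d : ℕ) : Type := EuclideanSpace ℝ (Fin d)

/-- A law: a Borel probability measure on `ℝ^d`. -/
abbrev Law (d : ℕ) : Type := ProbabilityMeasure (E d)

/-! ### Symmetric and positive definite matrices

`‖·‖` on matrices is the operator norm for the Euclidean norm on `ℝ^d`. -/

/-- The real vector space of symmetric `d × d` matrices. -/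
def symMat (d : ℕ) : Submodule ℝ (Matrix (Fin d) (Fin d) ℝ) where
  carrier := {A | A.IsSymm}
  add_mem' := fun ha hb => ha.add hb
  zero_mem' := Matrix.isSymm_zero
  smul_mem' := fun c _ ha => ha.smul c

/-- `𝒮_d`, normed by the operator norm. -/
abbrev Sym (d : ℕ) : Type := ↥(symMat d)

/-- `𝒫_d`, the positive definite matrices, as a subset of `𝒮_d`. -/
def PD (d : ℕ) : Set (Sym d) := {A | (A : Matrix (Fin d) (Fin d) ℝ).PosDef}

/-- `𝒲_{δ,d} = {A ∈ 𝒫_d : max(‖A‖, ‖A⁻¹‖) < 1/δ}`. -/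
def W (δ : ℝ) (d : ℕ) : Set (Sym d) :=
  {A | A ∈ PD d ∧
    max ‖(A : Matrix (Fin d) (Fin d) ℝ)‖ ‖(A : Matrix (Fin d) (Fin d) ℝ)⁻¹‖ < 1 / δ}

/-- The inverse of a symmetric matrix, as a symmetric matrix. -/
def symInv {d : ℕ} (A : Sym d) : Sym d :=
  ⟨(A : Matrix (Fin d) (Fin d) ℝ)⁻¹, by
    have h : (A : Matrix (Fin d) (Fin d) ℝ).IsSymm := A.2
    change ((A : Matrix (Fin d) (Fin d) ℝ)⁻¹)ᵀ = _
    rw [Matrix.transpose_nonsing_inv, h.eq]⟩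

/-- The quadratic form `x'Cx`. -/
def qf {d : ℕ} (C : Sym d) (x : E d) : ℝ :=
  x.ofLp ⬝ᵥ ((C : Matrix (Fin d) (Fin d) ℝ) *ᵥ x.ofLp)

/-! ### The `t` scatter and location-scatter functionals -/

/-- `𝒰_{d,a}`: laws `Q` with `Q(H) < 1 - (d-q)/a` for every linear subspace `H` of dimension
`q ≤ d - 1`. -/
def U (d : ℕ) (a : ℝ) : Set (Law d) :=
  {Q | ∀ H : Submodule ℝ (E d), Module.finrank ℝ H < d →
    (Q : Measure (E d)).real (H : Set (E d)) < 1 - ((d : ℝ) - Module.finrank ℝ H) / a}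

/-- `𝒱_{d,a}`: laws `P` with `P(J) < 1 - (d-q)/a` for every (nonempty) affine subspace `J` of
dimension `q ≤ d - 1`. -/
def V (d : ℕ) (a : ℝ) : Set (Law d) :=
  {P | ∀ J : AffineSubspace ℝ (E d), (J : Set (E d)).Nonempty →
    Module.finrank ℝ J.direction < d →
    (P : Measure (E d)).real (J : Set (E d)) < 1 - ((d : ℝ) - Module.finrank ℝ J.direction) / a}

/-- `ρ_{ν,d}(s) = ((ν+d)/2) log((ν+s)/ν)`. -/
def rho (ν : ℝ) (d : ℕ) (s : ℝ) : ℝ := (ν + d) / 2 * Real.log ((ν + s) / ν)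

/-- `Qh(A) = (1/2) log det A + ∫ ρ_{ν,d}(y'A⁻¹y) - ρ_{ν,d}(y'y) dQ(y)`, the pure scatter
criterion. -/
def scatterCrit {d : ℕ} (ν : ℝ) (Q : Law d) (A : Sym d) : ℝ :=
  1 / 2 * Real.log (A : Matrix (Fin d) (Fin d) ℝ).det +
    ∫ y, (rho ν d (qf (symInv A) y) - rho ν d (y.ofLp ⬝ᵥ y.ofLp)) ∂(Q : Measure (E d))

/-- `A` is the unique critical point of `Qh` on `𝒫_d`, and `Qh` has its absolute minimum there. -/
def IsTScatter {d : ℕ} (ν : ℝ) (Q : Law d) (A : Sym d) : Prop :=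
  A ∈ PD d ∧ HasFDerivAt (scatterCrit ν Q) (0 : Sym d →L[ℝ] ℝ) A ∧
    (∀ B ∈ PD d, HasFDerivAt (scatterCrit ν Q) (0 : Sym d →L[ℝ] ℝ) B → B = A) ∧
    ∀ B ∈ PD d, scatterCrit ν Q A ≤ scatterCrit ν Q B

open Classical in
/-- The scatter functional `A_ν(Q)` (by convention `0`, which is not in `𝒫_d` for `d ≥ 1`, if there
is none). -/
def tScatter {d : ℕ} (ν : ℝ) (Q : Law d) : Sym d :=
  if h : ∃ A, IsTScatter ν Q A then h.choose else 0

/-- `Ph(μ,Σ) = ∫ ρ(y,(μ,Σ)) - ρ(y,(0,I)) dP(y)`, where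
`ρ(y,(μ,Σ)) = (1/2) log det Σ + ρ_{ν,d}((y-μ)'Σ⁻¹(y-μ))`. -/
def locScatCrit {d : ℕ} (ν : ℝ) (P : Law d) (θ : E d × Sym d) : ℝ :=
  ∫ y, (1 / 2 * Real.log (θ.2 : Matrix (Fin d) (Fin d) ℝ).det +
    rho ν d (qf (symInv θ.2) (y - θ.1)) - rho ν d (y.ofLp ⬝ᵥ y.ofLp)) ∂(P : Measure (E d))

/-- `θ = (μ,Σ)` is the M-functional of `P`: the unique minimizer of `Ph` over `ℝ^d × 𝒫_d`. -/
def IsTLocScat {d : ℕ} (ν : ℝ) (P : Law d) (θ : E d × Sym d) : Prop :=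
  θ.2 ∈ PD d ∧ ∀ η : E d × Sym d, η.2 ∈ PD d → η ≠ θ → locScatCrit ν P θ < locScatCrit ν P η

open Classical in
/-- The `t_ν` location-scatter functional `(μ_ν,Σ_ν)(P)` (by convention `(0,0)` if there is
none). -/
def tLocScat {d : ℕ} (ν : ℝ) (P : Law d) : E d × Sym d :=
  if h : ∃ θ, IsTLocScat ν P θ then h.choose else 0

/-- `T₁(y) = (y',1)'`, from `ℝ^d` into `ℝ^(d+1)`. -/
def T1 {d : ℕ} (y : E d) : E (d + 1) :=
  WithLp.toLp 2 (Fin.snoc (α := fun _ => ℝ) y.ofLp 1)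

theorem measurable_T1 {d : ℕ} : Measurable (T1 (d := d)) := by
  apply Measurable.comp (WithLp.measurable_toLp 2 _)
  refine measurable_pi_lambda _ fun i => ?_
  refine Fin.lastCases ?_ (fun j => ?_) i
  · simp
  · simp only [Fin.snoc_castSucc]
    fun_prop

/-- The law `P ∘ T₁⁻¹` on `ℝ^(d+1)`. -/
def liftLaw {d : ℕ} (P : Law d) : Law (d + 1) := P.map (f := T1) measurable_T1.aemeasurable

/-! ### Spaces of rational functions -/

/-- `ℱ^{(j)}_{δ,r,d}`: functions `g(x) / ∏_{s=1}^r (1 + x'C_s x)` with `g` a monic monomial of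
degree `2r` and `C_s ∈ 𝒲_{δ,d}` taking at most `j` different values. -/
def F0 (δ : ℝ) (j r d : ℕ) : Set (E d → ℝ) :=
  {f | ∃ (n : Fin d → ℕ) (C : Fin r → Sym d), ∑ i, n i = 2 * r ∧ (∀ s, C s ∈ W δ d) ∧
    (range C).ncard ≤ j ∧ ∀ x : E d, f x = (∏ i, x i ^ n i) / ∏ s, (1 + qf (C s) x)}

/-- `𝒢^{(j)}_{δ,r,d} = ⋃_{v=1}^r ℱ^{(j)}_{δ,v,d}`. -/
def G0 (δ : ℝ) (j r d : ℕ) : Set (E d → ℝ) :=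
  {f | ∃ v, 1 ≤ v ∧ v ≤ r ∧ f ∈ F0 δ j v d}

/-- `f ≡ ∑ₛ λₛ gₛ` with `∑ₛ |λₛ| < ∞` and `gₛ ∈ 𝒢^{(j)}_{δ,r,d}`. Nothing is asked of `gₛ` where
`λₛ = 0`, so that finite sums are included. -/
def IsRep (δ : ℝ) (j r d : ℕ) (f : E d → ℝ) (lam : ℕ → ℝ) (g : ℕ → E d → ℝ) : Prop :=
  Summable (fun s => |lam s|) ∧ (∀ s, lam s ≠ 0 → g s ∈ G0 δ j r d) ∧
    ∀ x, HasSum (fun s => lam s * g s x) (f x)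

/-- `‖f‖^{*,j}_{δ,r,d}`, the infimum of `∑ₛ |λₛ|` over all representations of `f`
(used for functions which have one). -/
def starNorm (δ : ℝ) (j r d : ℕ) (f : E d → ℝ) : ℝ :=
  sInf {t | ∃ lam g, IsRep δ j r d f lam g ∧ t = ∑' s, |lam s|}

theorem IsRep.zero (δ : ℝ) (j r d : ℕ) : IsRep δ j r d 0 0 0 :=
  ⟨by simp, by simp, fun x => by simp⟩

theorem IsRep.smul {δ : ℝ} {j r d : ℕ} {f : E d → ℝ} {lam : ℕ → ℝ} {g : ℕ → E d → ℝ}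
    (c : ℝ) (h : IsRep δ j r d f lam g) : IsRep δ j r d (c • f) (fun s => c * lam s) g := by
  refine ⟨?_, fun s hs => h.2.1 s (right_ne_zero_of_mul hs), fun x => ?_⟩
  · simpa [abs_mul] using h.1.mul_left |c|
  · simpa [mul_assoc] using (h.2.2 x).mul_left c

theorem IsRep.add {δ : ℝ} {j r d : ℕ} {f f' : E d → ℝ} {lam lam' : ℕ → ℝ}
    {g g' : ℕ → E d → ℝ} (h : IsRep δ j r d f lam g) (h' : IsRep δ j r d f' lam' g') :
    ∃ lam'' g'', IsRep δ j r d (f + f') lam'' g'' ∧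
      ∑' s, |lam'' s| = ∑' s, |lam s| + ∑' s, |lam' s| := by
  let e := Equiv.natSumNatEquivNat
  have key : HasSum (fun s => |Sum.elim lam lam' (e.symm s)|)
      (∑' s, |lam s| + ∑' s, |lam' s|) := by
    refine (e.symm.hasSum_iff (f := fun i => |Sum.elim lam lam' i|)).2 ?_
    exact HasSum.sum (f := fun i => |Sum.elim lam lam' i|) h.1.hasSum h'.1.hasSum
  refine ⟨fun s => Sum.elim lam lam' (e.symm s), fun s => Sum.elim g g' (e.symm s),
    ⟨key.summable, fun s hs => ?_, fun x => ?_⟩, key.tsum_eq⟩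
  · rcases hh : e.symm s with a | a
    · simp only [hh, Sum.elim_inl] at hs ⊢
      exact h.2.1 a hs
    · simp only [hh, Sum.elim_inr] at hs ⊢
      exact h'.2.1 a hs
  · refine (e.symm.hasSum_iff (f := fun i => Sum.elim lam lam' i * Sum.elim g g' i x)).2 ?_
    exact HasSum.sum (f := fun i => Sum.elim lam lam' i * Sum.elim g g' i x) (h.2.2 x) (h'.2.2 x)

/-- `Y^j_{δ,r,d}` as a vector space of functions on `ℝ^d`. -/
def Yfun (δ : ℝ) (j r d : ℕ) : Submodule ℝ (E d → ℝ) where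
  carrier := {f | ∃ lam g, IsRep δ j r d f lam g}
  add_mem' := by
    rintro f f' ⟨lam, g, h⟩ ⟨lam', g', h'⟩
    obtain ⟨l, k, hlk, -⟩ := h.add h'
    exact ⟨l, k, hlk⟩
  zero_mem' := ⟨0, 0, IsRep.zero δ j r d⟩
  smul_mem' := by
    rintro c f ⟨lam, g, h⟩
    exact ⟨_, _, h.smul c⟩

theorem qf_nonneg {d : ℕ} {C : Sym d} (hC : C ∈ PD d) (x : E d) : 0 ≤ qf C x := by
  have h := (show (C : Matrix (Fin d) (Fin d) ℝ).PosDef from hC).posSemidef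
  simpa [qf] using h.dotProduct_mulVec_nonneg x.ofLp

theorem continuous_qf {d : ℕ} (C : Sym d) : Continuous (qf C) := by
  unfold qf
  fun_prop

theorem qf_le_norm {d : ℕ} (C : Sym d) (x : E d) :
    qf C x ≤ ‖(C : Matrix (Fin d) (Fin d) ℝ)‖ * ‖x‖ ^ 2 := by
  have h1 := Matrix.inner_toEuclideanCLM (C : Matrix (Fin d) (Fin d) ℝ) x x
  have h2 := real_inner_le_norm x (Matrix.toEuclideanCLM (𝕜 := ℝ) (C : Matrix (Fin d) (Fin d) ℝ) x)
  have h3 := (Matrix.toEuclideanCLM (𝕜 := ℝ) (C : Matrix (Fin d) (Fin d) ℝ)).le_opNorm x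
  rw [Matrix.l2_opNorm_toEuclideanCLM] at h3
  rw [h1] at h2
  calc qf C x ≤ ‖x‖ * ‖Matrix.toEuclideanCLM (𝕜 := ℝ) (C : Matrix (Fin d) (Fin d) ℝ) x‖ := h2
    _ ≤ ‖x‖ * (‖(C : Matrix (Fin d) (Fin d) ℝ)‖ * ‖x‖) := by gcongr
    _ = _ := by ring

theorem pos_of_mem_W {δ : ℝ} {d : ℕ} {C : Sym d} (hC : C ∈ W δ d) : 0 < δ := by
  have h := hC.2
  have h1 : 0 ≤ max ‖(C : Matrix (Fin d) (Fin d) ℝ)‖ ‖(C : Matrix (Fin d) (Fin d) ℝ)⁻¹‖ :=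
    le_max_of_le_left (norm_nonneg _)
  exact one_div_pos.1 (h1.trans_lt h)

theorem mul_sq_le_qf {δ : ℝ} {d : ℕ} {C : Sym d} (hC : C ∈ W δ d) (x : E d) :
    δ * ‖x‖ ^ 2 ≤ qf C x := by
  have hδ := pos_of_mem_W hC
  have hpd : (C : Matrix (Fin d) (Fin d) ℝ).PosDef := hC.1
  have hu : IsUnit (C : Matrix (Fin d) (Fin d) ℝ).det := hpd.det_pos.ne'.isUnit
  have hs : (C : Matrix (Fin d) (Fin d) ℝ).IsSymm := C.2
  have hinv : ‖(C : Matrix (Fin d) (Fin d) ℝ)⁻¹‖ ≤ 1 / δ := (le_max_right _ _).trans hC.2.le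
  have h1 : qf (symInv C) x ≤ 1 / δ * ‖x‖ ^ 2 :=
    (qf_le_norm (symInv C) x).trans (by gcongr; exact hinv)
  have hx : x.ofLp ⬝ᵥ x.ofLp = ‖x‖ ^ 2 := by
    rw [EuclideanSpace.norm_sq_eq]
    simp [dotProduct, sq]
  have h2 := qf_nonneg hC.1
    (WithLp.toLp 2 (x.ofLp - δ • ((C : Matrix (Fin d) (Fin d) ℝ)⁻¹ *ᵥ x.ofLp)))
  have h3 : qf C (WithLp.toLp 2 (x.ofLp - δ • ((C : Matrix (Fin d) (Fin d) ℝ)⁻¹ *ᵥ x.ofLp)))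
      = qf C x - 2 * δ * ‖x‖ ^ 2 + δ ^ 2 * qf (symInv C) x := by
    have e1 : (C : Matrix (Fin d) (Fin d) ℝ) *ᵥ ((C : Matrix (Fin d) (Fin d) ℝ)⁻¹ *ᵥ x.ofLp)
        = x.ofLp := by
      rw [Matrix.mulVec_mulVec, Matrix.mul_nonsing_inv _ hu, Matrix.one_mulVec]
    have e2 : ((C : Matrix (Fin d) (Fin d) ℝ)⁻¹ *ᵥ x.ofLp) ⬝ᵥ
        ((C : Matrix (Fin d) (Fin d) ℝ) *ᵥ x.ofLp) = x.ofLp ⬝ᵥ x.ofLp := by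
      rw [Matrix.dotProduct_mulVec, ← Matrix.mulVec_transpose, hs.eq, e1]
    simp only [qf, symInv, Matrix.mulVec_sub, Matrix.mulVec_smul, sub_dotProduct,
      dotProduct_sub, smul_dotProduct, dotProduct_smul, e1, e2, smul_eq_mul, ← hx]
    rw [dotProduct_comm ((C : Matrix (Fin d) (Fin d) ℝ)⁻¹ *ᵥ x.ofLp) x.ofLp]
    ring
  rw [h3] at h2
  have h4 : δ ^ 2 * qf (symInv C) x ≤ δ * ‖x‖ ^ 2 := by
    calc δ ^ 2 * qf (symInv C) x ≤ δ ^ 2 * (1 / δ * ‖x‖ ^ 2) := by gcongr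
      _ = δ * ‖x‖ ^ 2 := by field_simp
  linarith

theorem G0_continuous {δ : ℝ} {j r d : ℕ} {g : E d → ℝ} (hg : g ∈ G0 δ j r d) :
    Continuous g := by
  obtain ⟨v, -, -, n, C, -, hC, -, hf⟩ := hg
  rw [funext hf]
  refine Continuous.div (by fun_prop)
    (continuous_finsetProd _ fun s _ => continuous_const.add (continuous_qf _)) fun x => ?_
  exact Finset.prod_ne_zero_iff.2 fun s _ => by
    have := qf_nonneg (hC s).1 x
    positivity

/-- A uniform bound for the functions in `𝒢^{(j)}_{δ,r,d}`. -/
def bd (δ : ℝ) (r : ℕ) : ℝ := max 1 ((1 / δ) ^ r)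

theorem G0_bound {δ : ℝ} {j r d : ℕ} {g : E d → ℝ} (hg : g ∈ G0 δ j r d) (x : E d) :
    |g x| ≤ bd δ r := by
  obtain ⟨v, hv, hvr, n, C, hn, hC, -, hf⟩ := hg
  have hδ : 0 < δ := pos_of_mem_W (hC ⟨0, hv⟩)
  have hnum : |∏ i, x i ^ n i| ≤ (‖x‖ ^ 2) ^ v := by
    rw [Finset.abs_prod, ← pow_mul, ← hn, ← Finset.prod_pow_eq_pow_sum]
    refine Finset.prod_le_prod (fun i _ => abs_nonneg _) fun i _ => ?_
    rw [abs_pow]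
    exact pow_le_pow_left₀ (abs_nonneg _) (PiLp.norm_apply_le x i) _
  have hone : ∀ s, δ * ‖x‖ ^ 2 ≤ 1 + qf (C s) x := fun s => by
    linarith [mul_sq_le_qf (hC s) x]
  have hpos : ∀ s, 0 < 1 + qf (C s) x := fun s => by
    have := qf_nonneg (hC s).1 x
    positivity
  have hden : (δ * ‖x‖ ^ 2) ^ v ≤ ∏ s, (1 + qf (C s) x) := by
    calc (δ * ‖x‖ ^ 2) ^ v = ∏ _s : Fin v, (δ * ‖x‖ ^ 2) := by simp
      _ ≤ _ := Finset.prod_le_prod (fun i _ => by positivity) fun s _ => hone s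
  have hP : 0 < ∏ s, (1 + qf (C s) x) := Finset.prod_pos fun s _ => hpos s
  have h1 : |g x| ≤ (1 / δ) ^ v := by
    rw [hf, abs_div, abs_of_pos hP, div_le_iff₀ hP]
    calc |∏ i, x i ^ n i| ≤ (‖x‖ ^ 2) ^ v := hnum
      _ = (1 / δ) ^ v * (δ * ‖x‖ ^ 2) ^ v := by
        rw [← mul_pow]
        congr 1
        field_simp
      _ ≤ _ := by gcongr
  refine h1.trans ?_
  rcases le_total 1 (1 / δ) with h | h
  · exact (pow_le_pow_right₀ h hvr).trans (le_max_right _ _)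
  · exact (pow_le_one₀ (by positivity) h).trans (le_max_left _ _)

theorem bd_pos (δ : ℝ) (r : ℕ) : 0 < bd δ r := lt_max_of_lt_left one_pos

theorem IsRep.term_le {δ : ℝ} {j r d : ℕ} {f : E d → ℝ} {lam : ℕ → ℝ} {g : ℕ → E d → ℝ}
    (h : IsRep δ j r d f lam g) (s : ℕ) (x : E d) :
    ‖lam s * g s x‖ ≤ |lam s| * bd δ r := by
  rw [Real.norm_eq_abs, abs_mul]
  by_cases hs : lam s = 0
  · simp [hs]
  · exact mul_le_mul_of_nonneg_left (G0_bound (h.2.1 s hs) x) (abs_nonneg _)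

theorem IsRep.abs_le {δ : ℝ} {j r d : ℕ} {f : E d → ℝ} {lam : ℕ → ℝ} {g : ℕ → E d → ℝ}
    (h : IsRep δ j r d f lam g) (x : E d) : |f x| ≤ (∑' s, |lam s|) * bd δ r := by
  rw [← (h.2.2 x).tsum_eq, ← Real.norm_eq_abs]
  exact tsum_of_norm_bounded (h.1.hasSum.mul_right _) fun s => h.term_le s x

theorem Yfun_continuous {δ : ℝ} {j r d : ℕ} {f : E d → ℝ} (hf : f ∈ Yfun δ j r d) :
    Continuous f := by
  obtain ⟨lam, g, h⟩ := hf
  have : f = fun x => ∑' s, lam s * g s x := funext fun x => (h.2.2 x).tsum_eq.symm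
  rw [this]
  refine continuous_tsum (fun s => ?_) (h.1.mul_right (bd δ r)) h.term_le
  by_cases hs : lam s = 0
  · simpa [hs] using continuous_const
  · exact continuous_const.mul (G0_continuous (h.2.1 s hs))

theorem starNorm_le {δ : ℝ} {j r d : ℕ} {f : E d → ℝ} {lam : ℕ → ℝ} {g : ℕ → E d → ℝ}
    (h : IsRep δ j r d f lam g) : starNorm δ j r d f ≤ ∑' s, |lam s| :=
  csInf_le ⟨0, by rintro t ⟨lam, g, -, rfl⟩; exact tsum_nonneg fun _ => abs_nonneg _⟩
    ⟨lam, g, h, rfl⟩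

theorem starNorm_nonneg (δ : ℝ) (j r d : ℕ) (f : E d → ℝ) : 0 ≤ starNorm δ j r d f :=
  Real.sInf_nonneg (by rintro t ⟨lam, g, -, rfl⟩; exact tsum_nonneg fun _ => abs_nonneg _)

theorem exists_rep_lt {δ : ℝ} {j r d : ℕ} {f : E d → ℝ} (hf : f ∈ Yfun δ j r d) {ε : ℝ}
    (hε : 0 < ε) : ∃ lam g, IsRep δ j r d f lam g ∧ ∑' s, |lam s| < starNorm δ j r d f + ε := by
  obtain ⟨lam, g, h⟩ := hf
  obtain ⟨t, ⟨l, k, hlk, rfl⟩, ht⟩ :=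
    Real.lt_sInf_add_pos (s := {t | ∃ lam g, IsRep δ j r d f lam g ∧ t = ∑' s, |lam s|})
      ⟨_, lam, g, h, rfl⟩ hε
  exact ⟨l, k, hlk, ht⟩

theorem abs_le_starNorm {δ : ℝ} {j r d : ℕ} {f : E d → ℝ} (hf : f ∈ Yfun δ j r d) (x : E d) :
    |f x| ≤ starNorm δ j r d f * bd δ r := by
  refine le_of_forall_pos_le_add fun ε hε => ?_
  obtain ⟨lam, g, h, hlt⟩ := exists_rep_lt hf (div_pos hε (bd_pos δ r))
  refine (h.abs_le x).trans ?_
  have := mul_le_mul_of_nonneg_right hlt.le (bd_pos δ r).le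
  rwa [add_mul, div_mul_cancel₀ _ (bd_pos δ r).ne'] at this

theorem starNorm_smul_le {δ : ℝ} {j r d : ℕ} {f : E d → ℝ} (hf : f ∈ Yfun δ j r d) (c : ℝ) :
    starNorm δ j r d (c • f) ≤ |c| * starNorm δ j r d f := by
  refine le_of_forall_pos_le_add fun ε hε => ?_
  have hc : 0 < |c| + 1 := by positivity
  obtain ⟨lam, g, h, hlt⟩ := exists_rep_lt hf (div_pos hε hc)
  refine (starNorm_le (h.smul c)).trans ?_
  simp only [abs_mul, tsum_mul_left]
  have h1 := mul_le_mul_of_nonneg_left hlt.le (abs_nonneg c)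
  have h2 : |c| * (ε / (|c| + 1)) ≤ ε := by
    rw [mul_div_assoc', div_le_iff₀ hc]
    nlinarith
  linarith

theorem starNorm_add_le {δ : ℝ} {j r d : ℕ} {f f' : E d → ℝ} (hf : f ∈ Yfun δ j r d)
    (hf' : f' ∈ Yfun δ j r d) :
    starNorm δ j r d (f + f') ≤ starNorm δ j r d f + starNorm δ j r d f' := by
  refine le_of_forall_pos_le_add fun ε hε => ?_
  obtain ⟨lam, g, h, hlt⟩ := exists_rep_lt hf (half_pos hε)
  obtain ⟨lam', g', h', hlt'⟩ := exists_rep_lt hf' (half_pos hε)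
  obtain ⟨l, k, hlk, hsum⟩ := h.add h'
  have := starNorm_le hlk
  linarith

/-- `Y^j_{δ,r,d}` as a normed space, with norm `‖·‖^{*,j}_{δ,r,d}`. -/
def Y (δ : ℝ) (j r d : ℕ) : Type := ↥(Yfun δ j r d)

instance (δ : ℝ) (j r d : ℕ) : AddCommGroup (Y δ j r d) :=
  inferInstanceAs (AddCommGroup ↥(Yfun δ j r d))

instance (δ : ℝ) (j r d : ℕ) : Module ℝ (Y δ j r d) :=
  inferInstanceAs (Module ℝ ↥(Yfun δ j r d))

/-- The function underlying an element of `Y^j_{δ,r,d}`. -/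
def Y.toFun {δ : ℝ} {j r d : ℕ} (f : Y δ j r d) : E d → ℝ := f.1

/-- The norm `‖·‖^{*,j}_{δ,r,d}` on `Y^j_{δ,r,d}`. -/
def Y.addGroupNorm (δ : ℝ) (j r d : ℕ) : AddGroupNorm (Y δ j r d) where
  toFun f := starNorm δ j r d f.toFun
  map_zero' := le_antisymm
    ((starNorm_le (IsRep.zero δ j r d)).trans (by simp)) (starNorm_nonneg _ _ _ _ _)
  add_le' f f' := starNorm_add_le f.2 f'.2
  neg' f := by
    have key : ∀ g : E d → ℝ, g ∈ Yfun δ j r d →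
        starNorm δ j r d (-g) ≤ starNorm δ j r d g := fun g hg => by
      simpa using starNorm_smul_le hg (-1)
    refine le_antisymm (key _ f.2) ?_
    have := key _ (Submodule.neg_mem _ f.2)
    rwa [neg_neg] at this
  eq_zero_of_map_eq_zero' f hf := by
    refine Subtype.ext (funext fun x => ?_)
    have h := abs_le_starNorm f.2 x
    have hf' : starNorm δ j r d f.1 = 0 := hf
    rw [hf', zero_mul] at h
    exact abs_nonpos_iff.1 h

instance (δ : ℝ) (j r d : ℕ) : NormedAddCommGroup (Y δ j r d) :=
  AddGroupNorm.toNormedAddCommGroup (Y.addGroupNorm δ j r d)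

instance (δ : ℝ) (j r d : ℕ) : NormedSpace ℝ (Y δ j r d) where
  norm_smul_le c f := starNorm_smul_le f.2 c

/-- `ℝ ⊕ Y^j_{δ,r,d}` with norm `|c| + ‖g‖^{*,j}_{δ,r,d}`; the pair `(c, g)` stands for the function
`c + g`. The pair is determined by that function, because `g(0) = 0`. -/
abbrev RY (δ : ℝ) (j r d : ℕ) : Type := WithLp 1 (ℝ × Y δ j r d)

/-- The scale parameter of the rational functions `P(x)/(ν + x'Cx)^r`, `C ∈ 𝒲_{δ,d}`: one has
`C/ν ∈ 𝒲_{δ',d}` for `δ' = δ min(ν, 1/ν)`, which is `δ/ν` if `ν ≥ 1`. -/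
def scale (δ ν : ℝ) : ℝ := δ * min ν ν⁻¹

/-- `X_{δ,r,ν}` (over `ℝ^d`): the dual Banach space of `ℝ ⊕ Y²_{δ',r,d}`, with the dual norm. -/
abbrev X (δ : ℝ) (r : ℕ) (ν : ℝ) (d : ℕ) : Type := StrongDual ℝ (RY (scale δ ν) 2 r d)

theorem integrable_Y {δ : ℝ} {j r d : ℕ} (Q : Law d) (f : Y δ j r d) :
    Integrable f.toFun (Q : Measure (E d)) :=
  Integrable.of_bound (Yfun_continuous f.2).aestronglyMeasurable _
    (Filter.Eventually.of_forall fun x => abs_le_starNorm f.2 x)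

/-- `φ_Q`, the continuous linear functional `f ↦ ∫ f dQ`, here `(c, g) ↦ c + ∫ g dQ`. -/
def phi (δ : ℝ) (r : ℕ) (ν : ℝ) {d : ℕ} (Q : Law d) : X δ r ν d :=
  LinearMap.mkContinuous
    { toFun := fun p => p.fst + ∫ x, p.snd.toFun x ∂(Q : Measure (E d))
      map_add' := fun p q => by
        have h : ∫ x, (p + q).snd.toFun x ∂(Q : Measure (E d)) =
            ∫ x, p.snd.toFun x ∂(Q : Measure (E d)) + ∫ x, q.snd.toFun x ∂(Q : Measure (E d)) :=
          integral_add (integrable_Y Q p.snd) (integrable_Y Q q.snd)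
        rw [h, WithLp.add_fst]
        ring
      map_smul' := fun c p => by
        have h : ∫ x, (c • p).snd.toFun x ∂(Q : Measure (E d)) =
            c * ∫ x, p.snd.toFun x ∂(Q : Measure (E d)) :=
          integral_const_mul c p.snd.toFun
        rw [h, WithLp.smul_fst]
        simp [mul_add] }
    (bd (scale δ ν) r) fun p => by
      have h1 : ‖∫ x, p.snd.toFun x ∂(Q : Measure (E d))‖ ≤ ‖p.snd‖ * bd (scale δ ν) r := by
        refine (norm_integral_le_of_norm_le_const (C := ‖p.snd‖ * bd (scale δ ν) r)
          (Filter.Eventually.of_forall fun x => abs_le_starNorm p.snd.2 x)).trans ?_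
        simp
      have h2 : (1 : ℝ) ≤ bd (scale δ ν) r := le_max_left _ _
      have h3 : ‖p.fst‖ ≤ bd (scale δ ν) r * ‖p.fst‖ := le_mul_of_one_le_left (norm_nonneg _) h2
      rw [WithLp.prod_norm_eq_of_L1]
      refine (norm_add_le _ _).trans ?_
      linarith

/-! ### The map `F` -/

/-- `G_{(ν)}(y,A) = -A/2 + (ν+d) yy' / (2(ν + y'A⁻¹y))`. -/
def G {d : ℕ} (ν : ℝ) (y : E d) (A : Sym d) : Matrix (Fin d) (Fin d) ℝ :=
  -(1 / 2 : ℝ) • (A : Matrix (Fin d) (Fin d) ℝ) +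
    ((ν + d) / (2 * (ν + qf (symInv A) y))) • Matrix.vecMulVec y.ofLp y.ofLp

/-- The value of `φ` at a real function `f` on `ℝ^d` which lies in `ℝ ⊕ Y`: it is `φ(c, g)` for the
`(c, g)` with `f ≡ c + g` (and `0` if `f` is not in `ℝ ⊕ Y`). -/
def dualApply {δ : ℝ} {j r d : ℕ} (φ : StrongDual ℝ (RY δ j r d)) (f : E d → ℝ) : ℝ :=
  open Classical in
  if h : ∃ p : RY δ j r d, ∀ x, f x = p.fst + p.snd.toFun x then φ h.choose else 0

/-- `F(φ,A) = φ^*(G_{(ν)}(·,A)) ∈ 𝒮_d`, that is, `φ` applied to each entry. -/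
def F {d : ℕ} (ν δ : ℝ) (r : ℕ) (φ : X δ r ν d) (A : Sym d) : Sym d :=
  ⟨Matrix.of fun i j => dualApply φ fun y => G ν y A i j, by
    change Matrix.transpose _ = _
    ext i j
    have hA : (A : Matrix (Fin d) (Fin d) ℝ) j i = (A : Matrix (Fin d) (Fin d) ℝ) i j :=
      (show (A : Matrix (Fin d) (Fin d) ℝ).IsSymm from A.2).apply i j
    simp [G, Matrix.vecMulVec_apply, hA, mul_comm]⟩

/-- Elements of `Y` vanish at `0`. -/
theorem Y.toFun_zero {δ : ℝ} {j r d : ℕ} (f : Y δ j r d) : f.toFun 0 = 0 := by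
  obtain ⟨lam, g, h⟩ := f.2
  refine (h.2.2 0).unique ?_
  have : (fun s => lam s * g s 0) = fun _ => 0 := by
    funext s
    by_cases hs : lam s = 0
    · simp [hs]
    · obtain ⟨v, hv, -, n, C, hn, -, -, hf⟩ := h.2.1 s hs
      have : ∃ i, n i ≠ 0 := by
        by_contra! hc
        simp [hc] at hn
        omega
      obtain ⟨i, hi⟩ := this
      rw [hf, Finset.prod_eq_zero (Finset.mem_univ i) (by simp [hi])]
      simp
  rw [this]
  exact hasSum_zero

/-- The pair `(c, g)` is determined by the function `c + g`. -/
theorem dualApply_eq {δ : ℝ} {j r d : ℕ} (φ : StrongDual ℝ (RY δ j r d)) {f : E d → ℝ}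
    (p : RY δ j r d) (hp : ∀ x, f x = p.fst + p.snd.toFun x) : dualApply φ f = φ p := by
  have h : ∃ p : RY δ j r d, ∀ x, f x = p.fst + p.snd.toFun x := ⟨p, hp⟩
  have hq := h.choose_spec
  rw [dualApply, dif_pos h]
  congr 1
  set q := h.choose
  have h0 : q.fst = p.fst := by
    have := (hq 0).symm.trans (hp 0)
    simpa [Y.toFun_zero] using this
  have h1 : q.snd = p.snd := Subtype.ext <| funext fun x => by
    have := (hq x).symm.trans (hp x)
    rw [h0] at this
    exact add_left_cancel this
  exact (WithLp.ext_iff _).2 (Prod.ext h0 h1)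

theorem smul_symInv_mem_W {d : ℕ} {ν δ : ℝ} (hν : 0 < ν) {A : Sym d} (hA : A ∈ W δ d) :
    ν⁻¹ • symInv A ∈ W (scale δ ν) d := by
  have hδ := pos_of_mem_W hA
  have hpd : (A : Matrix (Fin d) (Fin d) ℝ).PosDef := hA.1
  have hu : IsUnit (A : Matrix (Fin d) (Fin d) ℝ).det := hpd.det_pos.ne'.isUnit
  have hcoe : ((ν⁻¹ • symInv A : Sym d) : Matrix (Fin d) (Fin d) ℝ) =
      ν⁻¹ • (A : Matrix (Fin d) (Fin d) ℝ)⁻¹ := rfl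
  have hm : 0 < min ν ν⁻¹ := lt_min hν (inv_pos.2 hν)
  have hinv : (ν⁻¹ • (A : Matrix (Fin d) (Fin d) ℝ)⁻¹)⁻¹ =
      ν • (A : Matrix (Fin d) (Fin d) ℝ) := by
    refine Matrix.inv_eq_right_inv ?_
    rw [Matrix.smul_mul, Matrix.mul_smul, smul_smul, inv_mul_cancel₀ hν.ne', one_smul,
      Matrix.nonsing_inv_mul _ hu]
  have h1 : ‖(A : Matrix (Fin d) (Fin d) ℝ)‖ < 1 / δ := (le_max_left _ _).trans_lt hA.2
  have h2 : ‖(A : Matrix (Fin d) (Fin d) ℝ)⁻¹‖ < 1 / δ := (le_max_right _ _).trans_lt hA.2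
  have e : 1 / scale δ ν = (min ν ν⁻¹)⁻¹ * (1 / δ) := by
    rw [scale, one_div, mul_inv, one_div, mul_comm]
  have b1 : ν⁻¹ ≤ (min ν ν⁻¹)⁻¹ := inv_anti₀ hm (min_le_left _ _)
  have b2 : ν ≤ (min ν ν⁻¹)⁻¹ := by
    have := inv_anti₀ hm (min_le_right ν ν⁻¹)
    rwa [inv_inv] at this
  have hδ' : 0 < 1 / δ := one_div_pos.2 hδ
  have hν' : 0 < ν⁻¹ := inv_pos.2 hν
  refine ⟨?_, ?_⟩
  · change Matrix.PosDef _
    rw [hcoe]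
    exact hpd.inv.smul hν'
  · rw [hcoe, hinv, norm_smul, norm_smul, Real.norm_of_nonneg hν.le, Real.norm_of_nonneg hν'.le, e]
    refine max_lt ?_ ?_
    · exact (mul_lt_mul_of_pos_left h2 hν').trans_le (mul_le_mul_of_nonneg_right b1 hδ'.le)
    · exact (mul_lt_mul_of_pos_left h1 hν).trans_le (mul_le_mul_of_nonneg_right b2 hδ'.le)

/-- For `A ∈ 𝒲_{δ,d}` the entries of `G_{(ν)}(·,A)` do lie in `ℝ ⊕ Y²_{δ',r,d}`. -/
theorem G_mem {d : ℕ} {ν δ : ℝ} (hν : 0 < ν) {r : ℕ} (hr : 1 ≤ r) {A : Sym d} (hA : A ∈ W δ d)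
    (i j : Fin d) : ∃ p : RY (scale δ ν) 2 r d, ∀ y, G ν y A i j = p.fst + p.snd.toFun y := by
  have hC := smul_symInv_mem_W hν hA
  let g : E d → ℝ := fun y => y i * y j / (1 + qf (ν⁻¹ • symInv A) y)
  have hg : g ∈ G0 (scale δ ν) 2 r d := by
    refine ⟨1, le_rfl, hr, fun l => (if l = i then 1 else 0) + (if l = j then 1 else 0),
      fun _ => ν⁻¹ • symInv A, ?_, fun _ => hC, ?_, fun y => ?_⟩
    · simp [Finset.sum_add_distrib]
    · rw [range_const, ncard_singleton]
      norm_num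
    · have h1 : ∏ l, y l ^ ((if l = i then 1 else 0) + (if l = j then 1 else 0)) = y i * y j := by
        simp only [pow_add, Finset.prod_mul_distrib, pow_ite, pow_one,
          pow_zero, Finset.prod_ite_eq', Finset.mem_univ, if_true]
      simp [g, h1]
  let c : ℝ := (ν + d) / (2 * ν)
  have hrep : IsRep (scale δ ν) 2 r d (c • g) (Pi.single 0 c) (fun _ => g) := by
    refine ⟨?_, fun _ _ => hg, fun x => ?_⟩
    · exact summable_of_ne_finset_zero (s := {0}) fun s hs => by
        simp [Pi.single_eq_of_ne (Finset.notMem_singleton.1 hs)]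
    · have := hasSum_single (f := fun s => (Pi.single 0 c : ℕ → ℝ) s * g x) 0 fun s hs => by
        simp [Pi.single_eq_of_ne hs]
      simpa using this
  let p : Y (scale δ ν) 2 r d := ⟨c • g, _, _, hrep⟩
  refine ⟨WithLp.toLp 1 (-(1 / 2 : ℝ) * (A : Matrix (Fin d) (Fin d) ℝ) i j, p), fun y => ?_⟩
  have hp : p.toFun y = c * g y := rfl
  have hq : qf (ν⁻¹ • symInv A) y = ν⁻¹ * qf (symInv A) y := by
    simp [qf, Matrix.smul_mulVec, dotProduct_smul]
  have hpos : 0 ≤ qf (ν⁻¹ • symInv A) y := qf_nonneg hC.1 y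
  have hpos' : 0 ≤ qf (symInv A) y := by
    rw [hq] at hpos
    exact nonneg_of_mul_nonneg_right hpos (inv_pos.2 hν)
  change G ν y A i j = -(1 / 2 : ℝ) * (A : Matrix (Fin d) (Fin d) ℝ) i j + p.toFun y
  simp only [G, Matrix.add_apply, Matrix.smul_apply, Matrix.vecMulVec_apply, smul_eq_mul, hp, g, c,
    hq]
  congr 1
  have h1 : ν + qf (symInv A) y ≠ 0 := by positivity
  have h2 : 1 + ν⁻¹ * qf (symInv A) y ≠ 0 := by positivity
  field_simp

/-! ### Differentiability of functionals of laws -/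

/-- A functional `T`, defined on a set `D` of laws which are embedded in a normed space `X` by `ι`,
is `C^k` for the norm of `X`: around each point of `D` the set `D` is relatively open among all
laws, and `T` is there the restriction of a `C^k` function on an open subset of `X`. -/
def IsCk {d : ℕ} {X Z : Type} [NormedAddCommGroup X] [NormedSpace ℝ X] [NormedAddCommGroup Z]
    [NormedSpace ℝ Z] (k : ℕ) (ι : Law d → X) (D : Set (Law d)) (T : Law d → Z) : Prop :=
  ∀ Q ∈ D, ∃ O : Set X, IsOpen O ∧ ι Q ∈ O ∧ ∃ S : X → Z, ContDiffOn ℝ k S O ∧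
    ∀ Q' : Law d, ι Q' ∈ O → Q' ∈ D ∧ S (ι Q') = T Q'

end TFunctional

end

open TFunctional

noncomputable section

namespace TFunctional

variable {d : ℕ}

/-! ### Quadratic forms of symmetric matrices -/

/-! Everything is read off from the scatter equation `A = (ν+d) ∫ yy'/(ν + y'A⁻¹y) dQ(y)`, that is,
from the fixed points of `scatterMap`; on laws, `F(φ_Q, A)` is half of `scatterMap ν Q A - A`
(`F_phi`).

Existence (`exists_fixedPoint`). The map is monotone for the Loewner order, and a large multiple of
the identity is mapped below itself, so the iterates decrease to a positive semidefinite limit. Were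
its range `H` proper, of dimension `q`, the trace identities would give `(ν+d)(1 - Q(H)) ≤ d - q` in
the limit, which membership in `𝒰` forbids. Conversely, a positive definite fixed point forces `Q ∈
𝒰` (`mem_U_of_fixedPoint`).

Minimality and criticality. After simultaneous diagonalization of `A` and `B`, Jensen's inequality
for the logarithm shows that a fixed point is the strict minimum of the criterion
(`scatterCrit_lt_of_fixedPoint`). The bound `log t ≤ t - 1` gives a smooth majorant of the
increments of the criterion, tangent at `A`; comparison with it identifies the critical points with
the fixed points, and no integral has to be differentiated.

Smoothness. The map `C ↦ y^n/(1 + y'Cy)^v` into `Y` is differentiable because differences of such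
functions telescope into the same kind of functions with one more factor in the denominator
(`ratY_sub`). Each derivative raises `v` by one and continuity costs one more, so `r = k + 2` gives
`C^k` starting from `v = 1`. As `φ` enters linearly, `F` is `C^k`.

Invertibility and conclusion. At a solution, the derivative of `C ↦ F(φ_Q, C⁻¹)` has a positive
definite trace form, by Cauchy–Schwarz and the nondegeneracy of `Q` (`symPair_fderiv_pos`). The
implicit function theorem then yields a `C^k` branch of zeros; for a nearby law its value is a fixed
point, hence the law is in `𝒰` and the value is the functional.

Location and scatter reduce to pure scatter in dimension `d + 1` with `ν - 1`: the matrix with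
blocks `Σ + μμ'`, `μ`, `μ'`, `1` carries one criterion to the other, and the scatter matrix of a
lifted law automatically has last entry `1`. -/

theorem Sym.apply_comm (A : Sym d) (i j : Fin d) :
    (A : Matrix (Fin d) (Fin d) ℝ) i j = (A : Matrix (Fin d) (Fin d) ℝ) j i :=
  (show (A : Matrix (Fin d) (Fin d) ℝ).IsSymm from A.2).apply j i

theorem Sym.dotProduct_mulVec_comm (A : Sym d) (x y : Fin d → ℝ) :
    x ⬝ᵥ ((A : Matrix (Fin d) (Fin d) ℝ) *ᵥ y) = y ⬝ᵥ ((A : Matrix (Fin d) (Fin d) ℝ) *ᵥ x) := by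
  have hs : (A : Matrix (Fin d) (Fin d) ℝ)ᵀ = A := A.2
  rw [Matrix.dotProduct_mulVec, ← Matrix.mulVec_transpose, hs, dotProduct_comm]

theorem coe_symInv (A : Sym d) :
    (symInv A : Matrix (Fin d) (Fin d) ℝ) = (A : Matrix (Fin d) (Fin d) ℝ)⁻¹ := rfl

theorem isUnit_det_of_mem_PD {A : Sym d} (hA : A ∈ PD d) :
    IsUnit (A : Matrix (Fin d) (Fin d) ℝ).det :=
  (show (A : Matrix (Fin d) (Fin d) ℝ).PosDef from hA).det_pos.ne'.isUnit

theorem symInv_mem_PD {A : Sym d} (hA : A ∈ PD d) : symInv A ∈ PD d :=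
  (show (A : Matrix (Fin d) (Fin d) ℝ).PosDef from hA).inv

theorem symInv_symInv {A : Sym d} (hA : A ∈ PD d) : symInv (symInv A) = A :=
  Subtype.ext (Matrix.nonsing_inv_nonsing_inv _ (isUnit_det_of_mem_PD hA))

theorem qf_eq_sum (A : Sym d) (x : E d) :
    qf A x = ∑ i, ∑ j, (A : Matrix (Fin d) (Fin d) ℝ) i j * (x i * x j) := by
  simp only [qf, dotProduct, Matrix.mulVec, Finset.mul_sum]
  exact Finset.sum_congr rfl fun i _ => Finset.sum_congr rfl fun j _ => by ring

theorem qf_add (A B : Sym d) (x : E d) : qf (A + B) x = qf A x + qf B x := by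
  simp [qf, Matrix.add_mulVec, dotProduct_add]

theorem qf_sub (A B : Sym d) (x : E d) : qf (A - B) x = qf A x - qf B x := by
  simp [qf, Matrix.sub_mulVec, dotProduct_sub]

theorem qf_smul (c : ℝ) (A : Sym d) (x : E d) : qf (c • A) x = c * qf A x := by
  simp [qf, Matrix.smul_mulVec, dotProduct_smul]

theorem qf_vec_smul (c : ℝ) (A : Sym d) (x : E d) : qf A (c • x) = c ^ 2 * qf A x := by
  simp [qf, Matrix.mulVec_smul, dotProduct_smul]
  ring

theorem dotProduct_self_eq_norm_sq (x : E d) : x.ofLp ⬝ᵥ x.ofLp = ‖x‖ ^ 2 := by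
  rw [EuclideanSpace.norm_sq_eq]
  simp [dotProduct, sq]

theorem inner_eq_dotProduct (x y : E d) : inner ℝ x y = x.ofLp ⬝ᵥ y.ofLp := by
  simp [PiLp.inner_apply, dotProduct, mul_comm]

theorem qf_pos {A : Sym d} (hA : A ∈ PD d) {x : E d} (hx : x ≠ 0) : 0 < qf A x := by
  have h := (show (A : Matrix (Fin d) (Fin d) ℝ).PosDef from hA)
  have hx' : x.ofLp ≠ 0 := fun h => hx (by ext i; simp [h])
  simpa [qf] using h.dotProduct_mulVec_pos hx'

theorem mem_PD_of_qf_pos {A : Sym d} (h : ∀ x : E d, x ≠ 0 → 0 < qf A x) : A ∈ PD d := by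
  refine Matrix.PosDef.of_dotProduct_mulVec_pos A.2 fun x hx => ?_
  have := h (WithLp.toLp 2 x) (fun h0 => hx (by simpa using congrArg WithLp.ofLp h0))
  simpa [qf] using this

/-- The polarization identity for the entries. -/
theorem Sym.apply_eq_polarization (A : Sym d) (i j : Fin d) :
    (A : Matrix (Fin d) (Fin d) ℝ) i j =
      (qf A (EuclideanSpace.single i 1 + EuclideanSpace.single j 1) -
        qf A (EuclideanSpace.single i 1) - qf A (EuclideanSpace.single j 1)) / 2 := by
  have h := A.apply_comm i j
  simp [qf, Matrix.mulVec_add, dotProduct_add, add_dotProduct]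
  linarith

theorem Sym.ext_qf {A B : Sym d} (h : ∀ x, qf A x = qf B x) : A = B := by
  refine Subtype.ext ?_
  ext i j
  rw [A.apply_eq_polarization, B.apply_eq_polarization, h, h, h]

theorem qf_symInv_mulVec {A : Sym d} (hA : A ∈ PD d) (x : E d) :
    qf (symInv A) (WithLp.toLp 2 ((A : Matrix (Fin d) (Fin d) ℝ) *ᵥ x.ofLp)) = qf A x := by
  simp only [qf, coe_symInv, Matrix.mulVec_mulVec,
    Matrix.nonsing_inv_mul _ (isUnit_det_of_mem_PD hA), Matrix.one_mulVec]
  rw [dotProduct_comm]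

/-- The variational lower bound for the form of the inverse matrix. -/
theorem qf_symInv_ge {A : Sym d} (hA : A ∈ PD d) (x y : E d) :
    2 * (x.ofLp ⬝ᵥ y.ofLp) - qf A x ≤ qf (symInv A) y := by
  set z := (A : Matrix (Fin d) (Fin d) ℝ)⁻¹ *ᵥ y.ofLp with hz
  have h := qf_nonneg hA (WithLp.toLp 2 (x.ofLp - z))
  have e1 : (A : Matrix (Fin d) (Fin d) ℝ) *ᵥ z = y.ofLp := by
    rw [hz, Matrix.mulVec_mulVec, Matrix.mul_nonsing_inv _ (isUnit_det_of_mem_PD hA),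
      Matrix.one_mulVec]
  have e2 : z ⬝ᵥ ((A : Matrix (Fin d) (Fin d) ℝ) *ᵥ x.ofLp) = x.ofLp ⬝ᵥ y.ofLp := by
    rw [Sym.dotProduct_mulVec_comm, e1]
  simp only [qf, Matrix.mulVec_sub, sub_dotProduct, dotProduct_sub, e1, e2] at h
  have e3 : qf (symInv A) y = z ⬝ᵥ y.ofLp := by
    rw [qf, coe_symInv, dotProduct_comm]
  rw [e3, qf]
  linarith

/-- The point `x = B⁻¹y` gives equality in `2x'y - x'Bx ≤ y'B⁻¹y`; testing the bound for `A` at the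
same point proves that inversion reverses the order. -/
theorem qf_symInv_anti {A B : Sym d} (hA : A ∈ PD d) (hB : B ∈ PD d)
    (h : ∀ x, qf A x ≤ qf B x) (y : E d) : qf (symInv B) y ≤ qf (symInv A) y := by
  set x : E d := WithLp.toLp 2 ((B : Matrix (Fin d) (Fin d) ℝ)⁻¹ *ᵥ y.ofLp) with hx
  have e1 : (B : Matrix (Fin d) (Fin d) ℝ) *ᵥ x.ofLp = y.ofLp := by
    rw [hx, Matrix.mulVec_mulVec, Matrix.mul_nonsing_inv _ (isUnit_det_of_mem_PD hB),
      Matrix.one_mulVec]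
  have e2 : qf B x = x.ofLp ⬝ᵥ y.ofLp := by rw [qf, e1]
  have e3 : qf (symInv B) y = x.ofLp ⬝ᵥ y.ofLp := by
    rw [qf, coe_symInv, dotProduct_comm]
  have := qf_symInv_ge hA x y
  have := h x
  linarith

/-- The Cauchy--Schwarz inequality between a form and the inverse form. -/
theorem sq_dotProduct_le {A : Sym d} (hA : A ∈ PD d) (x y : E d) :
    (x.ofLp ⬝ᵥ y.ofLp) ^ 2 ≤ qf A x * qf (symInv A) y := by
  rcases eq_or_ne x 0 with rfl | hx
  · simp [qf]
  have hp := qf_pos hA hx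
  -- This multiple of `x` maximizes the left side of the variational bound.
  have h := qf_symInv_ge hA ((x.ofLp ⬝ᵥ y.ofLp / qf A x) • x) y
  rw [qf_vec_smul] at h
  simp only [WithLp.ofLp_smul, smul_dotProduct, smul_eq_mul] at h
  have e : 2 * (x.ofLp ⬝ᵥ y.ofLp / qf A x * (x.ofLp ⬝ᵥ y.ofLp)) -
      (x.ofLp ⬝ᵥ y.ofLp / qf A x) ^ 2 * qf A x = (x.ofLp ⬝ᵥ y.ofLp) ^ 2 / qf A x := by
    field_simp
    ring
  rw [e, div_le_iff₀ hp] at h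
  linarith

theorem exists_mem_W {A : Sym d} (hA : A ∈ PD d) : ∃ δ : ℝ, 0 < δ ∧ δ < 1 ∧ A ∈ W δ d := by
  set m := max ‖(A : Matrix (Fin d) (Fin d) ℝ)‖ ‖(A : Matrix (Fin d) (Fin d) ℝ)⁻¹‖
  have hm : 0 ≤ m := le_max_of_le_left (norm_nonneg _)
  refine ⟨1 / (m + 2), by positivity, ?_, hA, ?_⟩
  · rw [div_lt_one (by positivity)]
    linarith
  · rw [one_div_one_div]
    linarith

theorem exists_pos_mul_sq_le_qf {A : Sym d} (hA : A ∈ PD d) :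
    ∃ c : ℝ, 0 < c ∧ ∀ x : E d, c * ‖x‖ ^ 2 ≤ qf A x := by
  obtain ⟨δ, h0, -, h⟩ := exists_mem_W hA
  exact ⟨δ, h0, mul_sq_le_qf h⟩

/-- A lower bound `c‖x‖²` for the form survives every perturbation of norm less than `c`. -/
theorem isOpen_PD : IsOpen (PD d) := by
  rw [Metric.isOpen_iff]
  intro A hA
  obtain ⟨c, hc, h⟩ := exists_pos_mul_sq_le_qf hA
  refine ⟨c, hc, fun B hB => mem_PD_of_qf_pos fun x hx => ?_⟩
  have h1 := qf_le_norm (A - B) x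
  rw [qf_sub] at h1
  have h2 : ‖((A - B : Sym d) : Matrix (Fin d) (Fin d) ℝ)‖ < c := by
    rw [Metric.mem_ball, dist_comm, dist_eq_norm] at hB
    exact hB
  have hx : 0 < ‖x‖ ^ 2 := by positivity
  have := h x
  nlinarith

/-- The entry `A ↦ A i j` as a continuous linear form on `𝒮_d`. -/
def entryL (i j : Fin d) : Sym d →L[ℝ] ℝ :=
  LinearMap.toContinuousLinearMap
    { toFun := fun A => (A : Matrix (Fin d) (Fin d) ℝ) i j
      map_add' := fun _ _ => rfl
      map_smul' := fun _ _ => rfl }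

@[simp]
theorem entryL_apply (i j : Fin d) (A : Sym d) :
    entryL i j A = (A : Matrix (Fin d) (Fin d) ℝ) i j := rfl

/-- The symmetrization of the matrix unit `(i, j)`. -/
def symUnit (i j : Fin d) : Sym d :=
  ⟨(1 / 2 : ℝ) • (Matrix.single i j 1 + Matrix.single j i 1), by
    change Matrix.transpose _ = _
    simp [Matrix.transpose_add, add_comm]⟩

/-- Smoothness of maps into `𝒮_d` thereby reduces to that of the entries. -/
theorem Sym.eq_sum_symUnit (A : Sym d) :
    A = ∑ i, ∑ j, (A : Matrix (Fin d) (Fin d) ℝ) i j • symUnit i j := by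
  refine Subtype.ext ?_
  have h : (A : Matrix (Fin d) (Fin d) ℝ)ᵀ = A := A.2
  have h1 := Matrix.matrix_eq_sum_single (A : Matrix (Fin d) (Fin d) ℝ)
  have h2 : (A : Matrix (Fin d) (Fin d) ℝ) =
      ∑ i, ∑ j, Matrix.single j i ((A : Matrix (Fin d) (Fin d) ℝ) i j) := by
    conv_lhs => rw [← h, h1]
    simp [Matrix.transpose_sum]
  have h3 : (A : Matrix (Fin d) (Fin d) ℝ) = (1 / 2 : ℝ) • (A + A : Matrix (Fin d) (Fin d) ℝ) := by
    rw [← two_smul ℝ (A : Matrix (Fin d) (Fin d) ℝ), smul_smul]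
    norm_num
  refine h3.trans ((congrArg ((1 / 2 : ℝ) • ·) (congrArg₂ (· + ·) h1 h2)).trans ?_)
  simp only [symUnit, ← Finset.sum_add_distrib, Finset.smul_sum, Submodule.coe_sum,
    Submodule.coe_smul]
  refine Finset.sum_congr rfl fun i _ => Finset.sum_congr rfl fun j _ => ?_
  simp [Matrix.smul_single, smul_add, mul_comm]

section Entries

variable {Z : Type*} [NormedAddCommGroup Z] [NormedSpace ℝ Z]

theorem contDiffWithinAt_sym {n : WithTop ℕ∞} {f : Z → Sym d} {s : Set Z} {z : Z}
    (h : ∀ i j, ContDiffWithinAt ℝ n (fun z => (f z : Matrix (Fin d) (Fin d) ℝ) i j) s z) :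
    ContDiffWithinAt ℝ n f s z := by
  rw [show f = fun z => ∑ i, ∑ j, (f z : Matrix (Fin d) (Fin d) ℝ) i j • symUnit i j from
    funext fun z => (f z).eq_sum_symUnit]
  exact ContDiffWithinAt.sum fun i _ => ContDiffWithinAt.sum fun j _ =>
    (h i j).smul contDiffWithinAt_const

end Entries

/-! ### Inversion as a smooth map, and openness of `𝒲` -/

theorem hasFDerivAt_inv {A : Sym d} (hA : A ∈ PD d) :
    HasFDerivAt (fun B : Sym d => (B : Matrix (Fin d) (Fin d) ℝ)⁻¹)
      ((-(ContinuousLinearMap.mulLeftRight ℝ (Matrix (Fin d) (Fin d) ℝ)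
        (A : Matrix (Fin d) (Fin d) ℝ)⁻¹ (A : Matrix (Fin d) (Fin d) ℝ)⁻¹)).comp
        (symMat d).subtypeL) A := by
  obtain ⟨u, hu⟩ := (Matrix.isUnit_iff_isUnit_det _).2 (isUnit_det_of_mem_PD hA)
  have : (fun B : Sym d => (B : Matrix (Fin d) (Fin d) ℝ)⁻¹) =
      Ring.inverse ∘ (symMat d).subtypeL := by
    funext B
    simp [Matrix.nonsing_inv_eq_ringInverse]
  have h := hasFDerivAt_ringInverse (𝕜 := ℝ) u
  have hi : (↑u⁻¹ : Matrix (Fin d) (Fin d) ℝ) = (A : Matrix (Fin d) (Fin d) ℝ)⁻¹ := by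
    rw [← hu, Matrix.coe_units_inv]
  rw [hu, hi] at h
  rw [this]
  exact HasFDerivAt.comp A h (symMat d).subtypeL.hasFDerivAt

theorem contDiffAt_symInv {A : Sym d} (hA : A ∈ PD d) {n : WithTop ℕ∞} :
    ContDiffAt ℝ n (symInv (d := d)) A := by
  obtain ⟨u, hu⟩ := (Matrix.isUnit_iff_isUnit_det _).2 (isUnit_det_of_mem_PD hA)
  have h1 : ContDiffAt ℝ n (fun B : Sym d => (B : Matrix (Fin d) (Fin d) ℝ)⁻¹) A := by
    have : (fun B : Sym d => (B : Matrix (Fin d) (Fin d) ℝ)⁻¹) =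
        Ring.inverse ∘ (symMat d).subtypeL := by
      funext B
      simp [Matrix.nonsing_inv_eq_ringInverse]
    rw [this]
    refine ContDiffAt.comp A ?_ (symMat d).subtypeL.contDiff.contDiffAt
    have := contDiffAt_ringInverse ℝ (n := n) u
    rw [hu] at this
    exact this
  refine contDiffWithinAt_sym fun i j => ?_
  let l : Matrix (Fin d) (Fin d) ℝ →L[ℝ] ℝ :=
    LinearMap.toContinuousLinearMap (Matrix.entryLinearMap ℝ ℝ i j)
  exact l.contDiff.contDiffAt.comp A h1

theorem isOpen_W (δ : ℝ) : IsOpen (W δ d) := by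
  rw [isOpen_iff_mem_nhds]
  intro A hA
  have h1 : ContinuousAt (fun B : Sym d =>
      max ‖(B : Matrix (Fin d) (Fin d) ℝ)‖ ‖(B : Matrix (Fin d) (Fin d) ℝ)⁻¹‖) A := by
    have := (hasFDerivAt_inv hA.1).continuousAt
    have h2 : ContinuousAt (fun B : Sym d => (B : Matrix (Fin d) (Fin d) ℝ)) A :=
      continuous_subtype_val.continuousAt
    exact h2.norm.max this.norm
  filter_upwards [isOpen_PD.mem_nhds hA.1, h1.eventually_lt_const hA.2] with B h1 h2
  exact ⟨h1, h2⟩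

open scoped MatrixOrder in
/-- Two positive definite matrices are diagonalized by one congruence. -/
theorem exists_simultaneous_diag {A B : Sym d} (hA : A ∈ PD d) (hB : B ∈ PD d) :
    ∃ (S : Matrix (Fin d) (Fin d) ℝ) (l : Fin d → ℝ), IsUnit S.det ∧ (∀ i, 0 < l i) ∧
      (A : Matrix (Fin d) (Fin d) ℝ) = S * Sᵀ ∧
      (B : Matrix (Fin d) (Fin d) ℝ) = S * Matrix.diagonal l * Sᵀ := by
  have hA' : (A : Matrix (Fin d) (Fin d) ℝ).PosDef := hA
  have hB' : (B : Matrix (Fin d) (Fin d) ℝ).PosDef := hB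
  obtain ⟨T, hT, hAT⟩ : ∃ T : Matrix (Fin d) (Fin d) ℝ, IsUnit T.det ∧
      (A : Matrix (Fin d) (Fin d) ℝ) = T * Tᵀ := by
    obtain ⟨T, hT⟩ := CStarAlgebra.nonneg_iff_eq_star_mul_self.mp hA'.posSemidef.nonneg
    rw [Matrix.star_eq_conjTranspose, Matrix.conjTranspose_eq_transpose_of_trivial] at hT
    refine ⟨Tᵀ, ?_, by simpa using hT⟩
    have := isUnit_det_of_mem_PD hA
    rw [hT, Matrix.det_mul] at this
    exact isUnit_of_mul_isUnit_left this
  have hTi : IsUnit (T⁻¹).det := Matrix.isUnit_nonsing_inv_det _ hT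
  -- With `A = TT'`, an orthogonal `O` diagonalizing `T⁻¹B(T⁻¹)'` leaves `A = (TO)(TO)'` unchanged,
  -- so `S = TO` serves for both matrices.
  have hC : (T⁻¹ * (B : Matrix (Fin d) (Fin d) ℝ) * (T⁻¹)ᵀ).PosDef := by
    have := hB'.mul_mul_conjTranspose_same (B := T⁻¹) ?_
    · simpa [Matrix.conjTranspose_eq_transpose_of_trivial] using this
    · exact Matrix.vecMul_injective_of_isUnit ((Matrix.isUnit_iff_isUnit_det _).2 hTi)
  set O : Matrix (Fin d) (Fin d) ℝ := (hC.1.eigenvectorUnitary : Matrix (Fin d) (Fin d) ℝ)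
  have hOO : O * Oᵀ = 1 := by
    have := Unitary.coe_mul_star_self hC.1.eigenvectorUnitary
    simpa [Matrix.star_eq_conjTranspose, Matrix.conjTranspose_eq_transpose_of_trivial] using this
  have hsp : T⁻¹ * (B : Matrix (Fin d) (Fin d) ℝ) * (T⁻¹)ᵀ =
      O * Matrix.diagonal hC.1.eigenvalues * Oᵀ := by
    have := hC.1.spectral_theorem
    rw [Unitary.conjStarAlgAut_apply] at this
    simpa [Matrix.star_eq_conjTranspose, Matrix.conjTranspose_eq_transpose_of_trivial,
      Function.comp_def] using this
  refine ⟨T * O, hC.1.eigenvalues, ?_, hC.eigenvalues_pos, ?_, ?_⟩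
  · rw [Matrix.det_mul]
    refine hT.mul ?_
    have : IsUnit (O * Oᵀ).det := by rw [hOO]; simp
    rw [Matrix.det_mul] at this
    exact isUnit_of_mul_isUnit_left this
  · rw [Matrix.transpose_mul, ← Matrix.mul_assoc, Matrix.mul_assoc T, hOO, Matrix.mul_one, hAT]
  · have e : T * (T⁻¹ * (B : Matrix (Fin d) (Fin d) ℝ) * (T⁻¹)ᵀ) * Tᵀ = B := by
      rw [Matrix.transpose_nonsing_inv, ← Matrix.mul_assoc, ← Matrix.mul_assoc,
        Matrix.mul_nonsing_inv _ hT, Matrix.one_mul, Matrix.mul_assoc,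
        Matrix.nonsing_inv_mul _ (by simpa using hT), Matrix.mul_one]
    refine (e.symm.trans (congrArg (fun M => T * M * Tᵀ) hsp)).trans ?_
    simp only [Matrix.transpose_mul]
    simp only [Matrix.mul_assoc]

/-! ### The fixed point map of the scatter equation -/

/-- The trace pairing on `𝒮_d`. -/
def symPair (M A : Sym d) : ℝ :=
  ∑ i, ∑ j, (M : Matrix (Fin d) (Fin d) ℝ) i j * (A : Matrix (Fin d) (Fin d) ℝ) i j

theorem symPair_eq_trace (M A : Sym d) :
    symPair M A = Matrix.trace ((M : Matrix (Fin d) (Fin d) ℝ) * (A : Matrix (Fin d) (Fin d) ℝ)) := by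
  simp only [symPair, Matrix.trace, Matrix.diag, Matrix.mul_apply]
  exact Finset.sum_congr rfl fun i _ => Finset.sum_congr rfl fun j _ => by rw [A.apply_comm]

/-- The rank one matrix `vv'`. -/
def symOuter (v : E d) : Sym d :=
  ⟨Matrix.vecMulVec v.ofLp v.ofLp, by
    change Matrix.transpose _ = _
    rw [Matrix.transpose_vecMulVec]⟩

theorem qf_symOuter (v y : E d) : qf (symOuter v) y = (v.ofLp ⬝ᵥ y.ofLp) ^ 2 := by
  simp [qf, symOuter, Matrix.vecMulVec_mulVec, sq, dotProduct_comm]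

theorem symPair_symOuter (v : E d) (A : Sym d) : symPair (symOuter v) A = qf A v := by
  rw [qf_eq_sum]
  simp only [symPair, symOuter, Matrix.vecMulVec_apply]
  exact Finset.sum_congr rfl fun i _ => Finset.sum_congr rfl fun j _ => by ring

theorem symPair_symInv_self {A : Sym d} (hA : A ∈ PD d) : symPair (symInv A) A = d := by
  rw [symPair_eq_trace, coe_symInv, Matrix.nonsing_inv_mul _ (isUnit_det_of_mem_PD hA)]
  simp

theorem qf_symUnit (i j : Fin d) (y : E d) : qf (symUnit i j) y = y i * y j := by
  have h : ∀ i j : Fin d, y.ofLp ⬝ᵥ (Matrix.single i j (1 : ℝ) *ᵥ y.ofLp) = y i * y j := by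
    intro i j
    rw [Matrix.single_mulVec_eq]
    simp [mul_comm]
  change y.ofLp ⬝ᵥ (((1 / 2 : ℝ) • (Matrix.single i j 1 + Matrix.single j i 1)) *ᵥ y.ofLp) = _
  rw [Matrix.smul_mulVec, Matrix.add_mulVec, dotProduct_smul, dotProduct_add, h, h, smul_eq_mul]
  ring

theorem abs_qf_le (M : Sym d) (y : E d) :
    |qf M y| ≤ ‖(M : Matrix (Fin d) (Fin d) ℝ)‖ * ‖y‖ ^ 2 := by
  refine abs_le.2 ⟨?_, qf_le_norm M y⟩
  have h := qf_le_norm (-M) y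
  have e : qf (-M) y = - qf M y := by rw [← neg_one_smul ℝ M, qf_smul, neg_one_mul]
  rw [e] at h
  simp at h
  linarith

theorem add_qf_symInv_pos {ν : ℝ} (hν : 0 < ν) {A : Sym d} (hA : A ∈ PD d) (y : E d) :
    0 < ν + qf (symInv A) y := by
  have := qf_nonneg (symInv_mem_PD hA) y
  positivity

/-- The denominator dominates a multiple of `‖y‖²`, so the integrand is bounded and no moments of
`Q` are needed. -/
theorem integrable_qf_div {ν : ℝ} (hν : 0 < ν) (Q : Law d) {A : Sym d} (hA : A ∈ PD d) (M : Sym d) :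
    Integrable (fun y => qf M y / (ν + qf (symInv A) y)) (Q : Measure (E d)) := by
  obtain ⟨c, hc, h⟩ := exists_pos_mul_sq_le_qf (symInv_mem_PD hA)
  refine Integrable.of_bound (C := ‖(M : Matrix (Fin d) (Fin d) ℝ)‖ / c) ?_
    (Filter.Eventually.of_forall fun y => ?_)
  · exact (Continuous.div (continuous_qf M) (continuous_const.add (continuous_qf _))
      fun y => (add_qf_symInv_pos hν hA y).ne').aestronglyMeasurable
  · have hp := add_qf_symInv_pos hν hA y
    rw [Real.norm_eq_abs, abs_div, abs_of_pos hp, div_le_div_iff₀ hp hc]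
    have h1 := mul_le_mul_of_nonneg_right (abs_qf_le M y) hc.le
    have h2 := mul_le_mul_of_nonneg_left (h y) (norm_nonneg (M : Matrix (Fin d) (Fin d) ℝ))
    have h3 := mul_nonneg (norm_nonneg (M : Matrix (Fin d) (Fin d) ℝ)) hν.le
    linarith

theorem integrable_mul_div {ν : ℝ} (hν : 0 < ν) (Q : Law d) {A : Sym d} (hA : A ∈ PD d)
    (i j : Fin d) :
    Integrable (fun y : E d => y i * y j / (ν + qf (symInv A) y)) (Q : Measure (E d)) := by
  simpa only [qf_symUnit] using integrable_qf_div hν Q hA (symUnit i j)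

/-- `A ↦ (ν+d) ∫ yy' / (ν + y'A⁻¹y) dQ(y)`. -/
def scatterMap (ν : ℝ) (Q : Law d) (A : Sym d) : Sym d :=
  ⟨Matrix.of fun i j => (ν + d) * ∫ y, y i * y j / (ν + qf (symInv A) y) ∂(Q : Measure (E d)), by
    change Matrix.transpose _ = _
    ext i j
    simp [mul_comm]⟩

theorem scatterMap_apply (ν : ℝ) (Q : Law d) (A : Sym d) (i j : Fin d) :
    (scatterMap ν Q A : Matrix (Fin d) (Fin d) ℝ) i j =
      (ν + d) * ∫ y, y i * y j / (ν + qf (symInv A) y) ∂(Q : Measure (E d)) := rfl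

/-- All information about the matrix integral is extracted through such scalar integrals: `M = vv'`
gives its quadratic form and `M = A⁻¹` its trace identity. -/
theorem symPair_scatterMap {ν : ℝ} (hν : 0 < ν) (Q : Law d) {A : Sym d} (hA : A ∈ PD d)
    (M : Sym d) : symPair M (scatterMap ν Q A) =
      (ν + d) * ∫ y, qf M y / (ν + qf (symInv A) y) ∂(Q : Measure (E d)) := by
  have h : ∀ y, qf M y / (ν + qf (symInv A) y) = ∑ i, ∑ j,
      (M : Matrix (Fin d) (Fin d) ℝ) i j * (y i * y j / (ν + qf (symInv A) y)) := fun y => by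
    rw [qf_eq_sum]
    simp only [Finset.sum_div, mul_div_assoc]
  have hi : ∀ i j, Integrable (fun y : E d => (M : Matrix (Fin d) (Fin d) ℝ) i j *
      (y i * y j / (ν + qf (symInv A) y))) (Q : Measure (E d)) := fun i j =>
    (integrable_mul_div hν Q hA i j).const_mul _
  rw [integral_congr_ae (Filter.Eventually.of_forall h),
    integral_finsetSum _ fun i _ => integrable_finsetSum _ fun j _ => hi i j]
  simp only [symPair, scatterMap_apply, Finset.mul_sum]
  refine Finset.sum_congr rfl fun i _ => ?_
  rw [integral_finsetSum _ fun j _ => hi i j, Finset.mul_sum]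
  refine Finset.sum_congr rfl fun j _ => ?_
  rw [integral_const_mul]
  ring

theorem qf_scatterMap {ν : ℝ} (hν : 0 < ν) (Q : Law d) {A : Sym d} (hA : A ∈ PD d)
    (v : E d) : qf (scatterMap ν Q A) v =
      (ν + d) * ∫ y, (v.ofLp ⬝ᵥ y.ofLp) ^ 2 / (ν + qf (symInv A) y) ∂(Q : Measure (E d)) := by
  rw [← symPair_symOuter, symPair_scatterMap hν Q hA]
  simp only [qf_symOuter]

theorem integrable_sq_div {ν : ℝ} (hν : 0 < ν) (Q : Law d) {A : Sym d} (hA : A ∈ PD d)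
    (v : E d) :
    Integrable (fun y : E d => (v.ofLp ⬝ᵥ y.ofLp) ^ 2 / (ν + qf (symInv A) y))
      (Q : Measure (E d)) := by
  simpa only [qf_symOuter] using integrable_qf_div hν Q hA (symOuter v)

/-- Inversion reverses the order, and so does taking the reciprocal of the denominator; the two
reversals cancel. -/
theorem qf_scatterMap_mono {ν : ℝ} (hν : 0 < ν) (Q : Law d) {A B : Sym d} (hA : A ∈ PD d)
    (hB : B ∈ PD d) (h : ∀ x, qf A x ≤ qf B x) (x : E d) :
    qf (scatterMap ν Q A) x ≤ qf (scatterMap ν Q B) x := by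
  rw [qf_scatterMap hν Q hA, qf_scatterMap hν Q hB]
  refine mul_le_mul_of_nonneg_left (integral_mono (integrable_sq_div hν Q hA x)
    (integrable_sq_div hν Q hB x) fun y => ?_) (by positivity)
  exact div_le_div_of_nonneg_left (sq_nonneg _) (add_qf_symInv_pos hν hB y)
    (by linarith [qf_symInv_anti hA hB h y])

/-! ### Nondegeneracy of the laws in `𝒰`, and a supersolution -/

theorem finrank_lt_of_ne_top {H : Submodule ℝ (E d)} (hH : H ≠ ⊤) : Module.finrank ℝ H < d := by
  simpa using Submodule.finrank_lt hH

/-- A law in `𝒰` is not concentrated on a hyperplane. -/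
theorem not_ae_dotProduct_eq_zero {a : ℝ} (ha : 0 < a) {Q : Law d} (hQ : Q ∈ U d a) {v : E d}
    (hv : v ≠ 0) : ¬ ∀ᵐ y ∂(Q : Measure (E d)), v.ofLp ⬝ᵥ y.ofLp = 0 := by
  intro h
  let H : Submodule ℝ (E d) := LinearMap.ker (innerSL ℝ v).toLinearMap
  have hmem : ∀ y, y ∈ H ↔ v.ofLp ⬝ᵥ y.ofLp = 0 := fun y => by
    simp [H, PiLp.inner_apply, dotProduct, mul_comm]
  have hH : H ≠ ⊤ := fun h0 => by
    have : v ∈ H := by rw [h0]; trivial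
    rw [hmem, dotProduct_self_eq_norm_sq] at this
    exact hv (by simpa using this)
  have h1 := hQ H (finrank_lt_of_ne_top hH)
  have h2 : (Q : Measure (E d)).real (H : Set (E d)) = 1 := by
    have : ∀ᵐ y ∂(Q : Measure (E d)), y ∈ (H : Set (E d)) := by
      filter_upwards [h] with y hy
      exact (hmem y).2 hy
    rw [measureReal_def, (prob_compl_eq_zero_iff H.closed_of_finiteDimensional.measurableSet).1 this]
    simp
  have h3 : (Module.finrank ℝ H : ℝ) < d := by exact_mod_cast finrank_lt_of_ne_top hH
  have h4 : 0 < ((d : ℝ) - Module.finrank ℝ H) / a := div_pos (by linarith) ha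
  linarith

theorem scatterMap_mem_PD {ν : ℝ} (hν : 0 < ν) {Q : Law d} (hQ : Q ∈ U d (ν + d)) {A : Sym d}
    (hA : A ∈ PD d) : scatterMap ν Q A ∈ PD d := by
  refine mem_PD_of_qf_pos fun v hv => ?_
  rw [qf_scatterMap hν Q hA]
  refine mul_pos (by positivity) ?_
  have hnn : ∀ y : E d, 0 ≤ (v.ofLp ⬝ᵥ y.ofLp) ^ 2 / (ν + qf (symInv A) y) := fun y =>
    div_nonneg (sq_nonneg _) (add_qf_symInv_pos hν hA y).le
  refine lt_of_le_of_ne (integral_nonneg hnn) fun h => ?_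
  have h1 := (integral_eq_zero_iff_of_nonneg hnn (integrable_sq_div hν Q hA v)).1 h.symm
  refine not_ae_dotProduct_eq_zero (by positivity) hQ hv ?_
  filter_upwards [h1] with y hy
  have := (add_qf_symInv_pos hν hA y).ne'
  simpa [this] using hy

/-- With `M = SS'`, the trace pairing is the sum of the values of the form at the columns of `S`. -/
theorem symPair_mono {M : Sym d} (hM : M ∈ PD d) {A B : Sym d} (h : ∀ x, qf A x ≤ qf B x) :
    symPair M A ≤ symPair M B := by
  obtain ⟨S, -, -, -, hS, -⟩ := exists_simultaneous_diag hM hM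
  have key : ∀ C : Sym d, symPair M C = ∑ k, qf C (WithLp.toLp 2 fun i => S i k) := fun C => by
    simp only [symPair, hS, qf_eq_sum, Matrix.mul_apply, Matrix.transpose_apply, Finset.sum_mul]
    rw [Finset.sum_comm' (t' := Finset.univ) (s' := fun _ => Finset.univ) (by simp)]
    conv_rhs => rw [Finset.sum_comm]
    rw [Finset.sum_comm]
    refine Finset.sum_congr rfl fun i _ => ?_
    rw [Finset.sum_comm]
    refine Finset.sum_congr rfl fun j _ => Finset.sum_congr rfl fun k _ => by ring
  rw [key, key]
  exact Finset.sum_le_sum fun k _ => h _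

/-- The multiple `t I` of the identity matrix. -/
def symScalar (d : ℕ) (t : ℝ) : Sym d := ⟨Matrix.scalar (Fin d) t, by
  change Matrix.transpose _ = _
  simp⟩

theorem qf_symScalar (t : ℝ) (x : E d) : qf (symScalar d t) x = t * ‖x‖ ^ 2 := by
  rw [← dotProduct_self_eq_norm_sq]
  simp [qf, symScalar]

theorem symScalar_mem_PD {t : ℝ} (ht : 0 < t) : symScalar d t ∈ PD d :=
  mem_PD_of_qf_pos fun x hx => by
    rw [qf_symScalar]
    positivity

theorem symInv_symScalar {t : ℝ} (ht : 0 < t) : symInv (symScalar d t) = symScalar d t⁻¹ := by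
  refine Subtype.ext (Matrix.inv_eq_right_inv ?_)
  change Matrix.scalar (Fin d) t * Matrix.scalar (Fin d) t⁻¹ = 1
  rw [← map_mul, mul_inv_cancel₀ ht.ne', map_one]

/-- At `tI` the form is at most `t‖x‖²` times `(ν+d) ∫ ‖y‖²/(tν + ‖y‖²) dQ`, and this last factor
tends to `0` as `t → ∞` by dominated convergence. -/
theorem exists_supersolution {ν : ℝ} (hν : 0 < ν) (Q : Law d) :
    ∃ t : ℝ, 0 < t ∧ ∀ x, qf (scatterMap ν Q (symScalar d t)) x ≤ qf (symScalar d t) x := by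
  have hlim : Filter.Tendsto (fun n : ℕ => (ν + d) *
      ∫ y, ‖y‖ ^ 2 / ((n + 1 : ℝ) * ν + ‖y‖ ^ 2) ∂(Q : Measure (E d))) Filter.atTop
      (nhds ((ν + d) * ∫ _, (0 : ℝ) ∂(Q : Measure (E d)))) := by
    refine Filter.Tendsto.const_mul _ (tendsto_integral_of_dominated_convergence (fun _ => 1)
      (fun n => ?_) (integrable_const _) (fun n => Filter.Eventually.of_forall fun y => ?_)
      (Filter.Eventually.of_forall fun y => ?_))
    · refine Continuous.aestronglyMeasurable ?_
      exact Continuous.div (by fun_prop) (by fun_prop) fun y => by positivity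
    · rw [Real.norm_of_nonneg (by positivity), div_le_one (by positivity)]
      have : 0 ≤ ((n : ℝ) + 1) * ν := by positivity
      linarith
    · refine Filter.Tendsto.const_div_atTop ?_ _
      refine Filter.tendsto_atTop_add_const_right _ _ ?_
      exact (Filter.tendsto_atTop_add_const_right _ _ tendsto_natCast_atTop_atTop).atTop_mul_const hν
  rw [integral_zero, mul_zero] at hlim
  obtain ⟨n, hn⟩ := (hlim.eventually_lt_const one_pos).exists
  have ht : 0 < (n + 1 : ℝ) := by positivity
  refine ⟨n + 1, ht, fun x => ?_⟩
  have hPD := symScalar_mem_PD (d := d) ht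
  have e : ∀ y : E d, ‖y‖ ^ 2 / (ν + qf (symInv (symScalar d (n + 1))) y) =
      (n + 1) * (‖y‖ ^ 2 / ((n + 1 : ℝ) * ν + ‖y‖ ^ 2)) := fun y => by
    rw [symInv_symScalar ht, qf_symScalar]
    field_simp
  have hInt : Integrable (fun y : E d => ‖y‖ ^ 2 / (ν + qf (symInv (symScalar d (n + 1))) y))
      (Q : Measure (E d)) := by
    simpa [qf_symScalar] using integrable_qf_div hν Q hPD (symScalar d 1)
  rw [qf_scatterMap hν Q hPD, qf_symScalar]
  calc (ν + d) * ∫ y, (x.ofLp ⬝ᵥ y.ofLp) ^ 2 / (ν + qf (symInv (symScalar d (n + 1))) y)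
        ∂(Q : Measure (E d))
      ≤ (ν + d) * ∫ y, ‖x‖ ^ 2 * (‖y‖ ^ 2 / (ν + qf (symInv (symScalar d (n + 1))) y))
        ∂(Q : Measure (E d)) := by
        refine mul_le_mul_of_nonneg_left (integral_mono (integrable_sq_div hν Q hPD x)
          (hInt.const_mul _) fun y => ?_) (by positivity)
        have := sq_dotProduct_le (symScalar_mem_PD (d := d) one_pos) x y
        rw [symInv_symScalar one_pos, qf_symScalar, qf_symScalar, inv_one, one_mul, one_mul] at this
        rw [← mul_div_assoc]
        exact div_le_div_of_nonneg_right this (add_qf_symInv_pos hν hPD y).le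
    _ = (n + 1) * ‖x‖ ^ 2 * ((ν + d) *
        ∫ y, ‖y‖ ^ 2 / ((n + 1 : ℝ) * ν + ‖y‖ ^ 2) ∂(Q : Measure (E d))) := by
        rw [integral_const_mul]
        simp only [e]
        rw [integral_const_mul]
        ring
    _ ≤ (n + 1) * ‖x‖ ^ 2 * 1 := by
        gcongr
    _ = _ := by ring

/-! ### Existence of the scatter matrix -/

/-- A decreasing sequence of positive definite matrices converges. -/
theorem exists_tendsto_qf {A : ℕ → Sym d} (hA : ∀ n, A n ∈ PD d)
    (hanti : ∀ n x, qf (A (n + 1)) x ≤ qf (A n) x) :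
    ∃ L : Sym d, (∀ x, Filter.Tendsto (fun n => qf (A n) x) Filter.atTop (nhds (qf L x))) ∧
      ∀ n x, qf L x ≤ qf (A n) x := by
  have hmono : ∀ x, Antitone fun n => qf (A n) x := fun x => antitone_nat_of_succ_le fun n =>
    hanti n x
  have hlim : ∀ x, ∃ l, Filter.Tendsto (fun n => qf (A n) x) Filter.atTop (nhds l) := fun x =>
    ⟨_, tendsto_atTop_ciInf (hmono x) ⟨0, by rintro _ ⟨n, rfl⟩; exact qf_nonneg (hA n) x⟩⟩
  choose f hf using hlim
  -- The pointwise limits `f` are not yet known to form a quadratic form; polarization turns them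
  -- into limits of entries, from which the form is rebuilt.
  let L : Sym d := ⟨Matrix.of fun i j =>
      (f (EuclideanSpace.single i 1 + EuclideanSpace.single j 1) -
        f (EuclideanSpace.single i 1) - f (EuclideanSpace.single j 1)) / 2, by
    change Matrix.transpose _ = _
    ext i j
    simp only [Matrix.transpose_apply, Matrix.of_apply]
    rw [add_comm (EuclideanSpace.single j (1 : ℝ)) (EuclideanSpace.single i (1 : ℝ))]
    ring⟩
  have hent : ∀ i j, Filter.Tendsto (fun n => (A n : Matrix (Fin d) (Fin d) ℝ) i j) Filter.atTop
      (nhds ((L : Matrix (Fin d) (Fin d) ℝ) i j)) := fun i j => by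
    simp only [fun n => (A n).apply_eq_polarization i j]
    exact (((hf _).sub (hf _)).sub (hf _)).div_const 2
  have hq : ∀ x, Filter.Tendsto (fun n => qf (A n) x) Filter.atTop (nhds (qf L x)) := fun x => by
    simp only [qf_eq_sum]
    exact tendsto_finsetSum _ fun i _ => tendsto_finsetSum _ fun j _ => (hent i j).mul_const _
  exact ⟨L, hq, fun n x => (hmono x).le_of_tendsto (hq x) n⟩

/-- On the range of the limit the inverse forms converge. -/
theorem tendsto_qf_symInv_of_range {A : ℕ → Sym d} {L : Sym d} (hA : ∀ n, A n ∈ PD d)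
    (hlim : ∀ x, Filter.Tendsto (fun n => qf (A n) x) Filter.atTop (nhds (qf L x)))
    (hle : ∀ n x, qf L x ≤ qf (A n) x) (hL : ∀ x, 0 ≤ qf L x)
    {x y : E d} (hy : y.ofLp = (L : Matrix (Fin d) (Fin d) ℝ) *ᵥ x.ofLp) :
    Filter.Tendsto (fun n => qf (symInv (A n)) y) Filter.atTop (nhds (qf L x)) := by
  have hxy : x.ofLp ⬝ᵥ y.ofLp = qf L x := by rw [hy, qf]
  have h1 : Filter.Tendsto (fun n => 2 * (x.ofLp ⬝ᵥ y.ofLp) - qf (A n) x) Filter.atTop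
      (nhds (qf L x)) := by
    have := (tendsto_const_nhds (x := 2 * (x.ofLp ⬝ᵥ y.ofLp))).sub (hlim x)
    rw [hxy] at this ⊢
    convert this using 2
    ring
  refine tendsto_of_tendsto_of_tendsto_of_le_of_le h1 tendsto_const_nhds
    (fun n => qf_symInv_ge (hA n) x y) fun n => ?_
  set w : E d := WithLp.toLp 2 ((A n : Matrix (Fin d) (Fin d) ℝ)⁻¹ *ᵥ y.ofLp) with hw
  have e1 : (A n : Matrix (Fin d) (Fin d) ℝ) *ᵥ w.ofLp = y.ofLp := by
    rw [hw, Matrix.mulVec_mulVec, Matrix.mul_nonsing_inv _ (isUnit_det_of_mem_PD (hA n)),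
      Matrix.one_mulVec]
  have e2 : qf (A n) w = w.ofLp ⬝ᵥ y.ofLp := by rw [qf, e1]
  have e3 : qf (symInv (A n)) y = w.ofLp ⬝ᵥ y.ofLp := by
    rw [qf, coe_symInv, dotProduct_comm]
  -- Expanding `0 ≤ (x-w)'L(x-w)` with `Lx = y` and using `w'Lw ≤ w'(A n)w = w'y` gives `w'y ≤
  -- x'Lx`, the upper half of the squeeze.
  have h2 := hL (WithLp.toLp 2 (x.ofLp - w.ofLp))
  have e4 : w.ofLp ⬝ᵥ ((L : Matrix (Fin d) (Fin d) ℝ) *ᵥ x.ofLp) = w.ofLp ⬝ᵥ y.ofLp := by rw [hy]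
  have e5 : x.ofLp ⬝ᵥ ((L : Matrix (Fin d) (Fin d) ℝ) *ᵥ w.ofLp) = w.ofLp ⬝ᵥ y.ofLp := by
    rw [Sym.dotProduct_mulVec_comm, e4]
  have e6 : qf L (WithLp.toLp 2 (x.ofLp - w.ofLp)) = qf L x - 2 * (w.ofLp ⬝ᵥ y.ofLp) + qf L w := by
    simp only [qf, Matrix.mulVec_sub, sub_dotProduct, dotProduct_sub, e4, e5]
    ring
  have := hle n w
  change qf (symInv (A n)) y ≤ qf L x
  linarith

/-- Off the range of the limit the inverse forms tend to infinity. -/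
theorem tendsto_qf_symInv_atTop {A : ℕ → Sym d} {L : Sym d} (hA : ∀ n, A n ∈ PD d)
    (hlim : ∀ x, Filter.Tendsto (fun n => qf (A n) x) Filter.atTop (nhds (qf L x)))
    {x y : E d} (hx : qf L x = 0) (hxy : x.ofLp ⬝ᵥ y.ofLp ≠ 0) :
    Filter.Tendsto (fun n => qf (symInv (A n)) y) Filter.atTop Filter.atTop := by
  refine Filter.tendsto_atTop.2 fun b => ?_
  -- With this scaling the variational bound at `s • x` reads `2(|b| + 1) - o(1)`, which eventually
  -- exceeds `b`.
  set s := (|b| + 1) / (x.ofLp ⬝ᵥ y.ofLp)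
  have h1 : Filter.Tendsto (fun n => qf (A n) (s • x)) Filter.atTop (nhds 0) := by
    have := hlim (s • x)
    rwa [qf_vec_smul, hx, mul_zero] at this
  filter_upwards [h1.eventually_lt_const one_pos] with n hn
  have h2 := qf_symInv_ge (hA n) (s • x) y
  have h3 : (s • x).ofLp ⬝ᵥ y.ofLp = |b| + 1 := by
    simp only [WithLp.ofLp_smul, smul_dotProduct, smul_eq_mul, s]
    field_simp
  rw [h3] at h2
  have := le_abs_self b
  have := abs_nonneg b
  linarith

/-- Monotone iteration from the supersolution. The limit solves the equation as soon as it is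
nonsingular; a singular limit is excluded by computing the limits of the trace identities on its
range and off it. -/
theorem exists_fixedPoint {ν : ℝ} (hν : 0 < ν) {Q : Law d} (hQ : Q ∈ U d (ν + d)) :
    ∃ A ∈ PD d, scatterMap ν Q A = A := by
  obtain ⟨t, ht, hsup⟩ := exists_supersolution hν Q
  set A : ℕ → Sym d := fun n => (scatterMap ν Q)^[n] (symScalar d t) with hAdef
  have hsucc : ∀ n, A (n + 1) = scatterMap ν Q (A n) := fun n =>
    Function.iterate_succ_apply' _ _ _
  have hA : ∀ n, A n ∈ PD d := fun n => by
    induction n with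
    | zero => exact symScalar_mem_PD ht
    | succ n ih => rw [hsucc]; exact scatterMap_mem_PD hν hQ ih
  have hanti : ∀ n x, qf (A (n + 1)) x ≤ qf (A n) x := fun n => by
    induction n with
    | zero => intro x; rw [hsucc]; exact hsup x
    | succ n ih =>
      intro x
      rw [hsucc (n + 1)]
      refine (qf_scatterMap_mono hν Q (hA _) (hA _) ih x).trans_eq ?_
      rw [hsucc n]
  obtain ⟨L, hlim, hle⟩ := exists_tendsto_qf hA hanti
  have hL : ∀ x, 0 ≤ qf L x := fun x => ge_of_tendsto' (hlim x) fun n => qf_nonneg (hA n) x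
  have hA0 : ∀ n x, qf (A n) x ≤ qf (A 0) x := fun n x =>
    antitone_nat_of_succ_le (f := fun n => qf (A n) x) (fun n => hanti n x) (Nat.zero_le n)
  have hmeas : ∀ (n : ℕ) (f : E d → ℝ), Continuous f →
      AEStronglyMeasurable (fun y => f y / (ν + qf (symInv (A n)) y)) (Q : Measure (E d)) :=
    fun n f hf => (Continuous.div hf (continuous_const.add (continuous_qf _))
      fun y => (add_qf_symInv_pos hν (hA n) y).ne').aestronglyMeasurable
  -- passage to the limit in the iteration
  have hDCT : ∀ (x : E d) (g : E d → ℝ),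
      (∀ y, Filter.Tendsto (fun n => (x.ofLp ⬝ᵥ y.ofLp) ^ 2 / (ν + qf (symInv (A n)) y))
        Filter.atTop (nhds (g y))) → qf L x = (ν + d) * ∫ y, g y ∂(Q : Measure (E d)) := by
    intro x g hg
    have h1 : Filter.Tendsto (fun n => (ν + d) * ∫ y, (x.ofLp ⬝ᵥ y.ofLp) ^ 2 /
        (ν + qf (symInv (A n)) y) ∂(Q : Measure (E d))) Filter.atTop
        (nhds ((ν + d) * ∫ y, g y ∂(Q : Measure (E d)))) := by
      refine Filter.Tendsto.const_mul _ (tendsto_integral_of_dominated_convergence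
        (fun _ => qf (A 0) x) (fun n => hmeas n _ (by fun_prop)) (integrable_const _)
        (fun n => Filter.Eventually.of_forall fun y => ?_) (Filter.Eventually.of_forall hg))
      have hp := add_qf_symInv_pos hν (hA n) y
      rw [Real.norm_of_nonneg (div_nonneg (sq_nonneg _) hp.le), div_le_iff₀ hp]
      have h2 := sq_dotProduct_le (hA n) x y
      have h3 := mul_le_mul_of_nonneg_right (hA0 n x) (qf_nonneg (symInv_mem_PD (hA n)) y)
      have h4 := mul_nonneg (qf_nonneg (hA 0) x) hν.le
      linarith
    refine tendsto_nhds_unique ((Filter.tendsto_add_atTop_iff_nat 1).2 (hlim x)) ?_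
    refine h1.congr fun n => ?_
    rw [hsucc, qf_scatterMap hν Q (hA n)]
  suffices hLPD : L ∈ PD d by
    refine ⟨L, hLPD, Sym.ext_qf fun x => ?_⟩
    rw [qf_scatterMap hν Q hLPD]
    refine (hDCT x _ fun y => ?_).symm
    have h1 : Filter.Tendsto (fun n => qf (symInv (A n)) y) Filter.atTop
        (nhds (qf (symInv L) y)) := by
      set x : E d := WithLp.toLp 2 ((L : Matrix (Fin d) (Fin d) ℝ)⁻¹ *ᵥ y.ofLp) with hx
      have e1 : y.ofLp = (L : Matrix (Fin d) (Fin d) ℝ) *ᵥ x.ofLp := by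
        rw [hx, Matrix.mulVec_mulVec, Matrix.mul_nonsing_inv _ (isUnit_det_of_mem_PD hLPD),
          Matrix.one_mulVec]
      have e2 := tendsto_qf_symInv_of_range hA hlim hle hL e1
      rwa [← qf_symInv_mulVec hLPD, ← e1] at e2
    exact Filter.Tendsto.div tendsto_const_nhds (tendsto_const_nhds.add h1)
      (add_qf_symInv_pos hν hLPD y).ne'
  -- spectral decomposition of the limit
  have hPSD : (L : Matrix (Fin d) (Fin d) ℝ).PosSemidef := by
    refine Matrix.PosSemidef.of_dotProduct_mulVec_nonneg L.2 fun x => ?_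
    simpa [qf] using hL (WithLp.toLp 2 x)
  set e := hPSD.1.eigenvectorBasis
  set l := hPSD.1.eigenvalues
  have hl0 : ∀ i, 0 ≤ l i := hPSD.eigenvalues_nonneg
  have hev : ∀ i, (L : Matrix (Fin d) (Fin d) ℝ) *ᵥ (e i).ofLp = l i • (e i).ofLp := fun i =>
    hPSD.1.mulVec_eigenvectorBasis i
  have hnorm : ∀ i, (e i).ofLp ⬝ᵥ (e i).ofLp = 1 := fun i => by
    rw [dotProduct_self_eq_norm_sq, e.orthonormal.1 i]
    norm_num
  have hqe : ∀ i, qf L (e i) = l i := fun i => by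
    rw [qf, hev, dotProduct_smul, hnorm, smul_eq_mul, mul_one]
  have hexp : ∀ y : E d, y = ∑ i, ((e i).ofLp ⬝ᵥ y.ofLp) • e i := fun y => by
    conv_lhs => rw [← e.sum_repr' y]
    simp [PiLp.inner_apply, dotProduct, mul_comm]
  let p : Finset (Fin d) := Finset.univ.filter fun i => 0 < l i
  have hp0 : ∀ i, i ∉ p → l i = 0 := fun i hi => by
    simp only [p, Finset.mem_filter, Finset.mem_univ, true_and, not_lt] at hi
    exact le_antisymm hi (hl0 i)
  -- The range of `L`, spanned by the eigenvectors with positive eigenvalue.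
  let H : Submodule ℝ (E d) := Submodule.span ℝ (range fun i : p => e i)
  have hfr : Module.finrank ℝ H = p.card := by
    have hli : LinearIndependent ℝ fun i : p => e i :=
      e.orthonormal.linearIndependent.comp _ Subtype.val_injective
    rw [finrank_span_eq_card hli, Fintype.card_coe]
  have hHperp : ∀ y ∈ H, ∀ i, i ∉ p → (e i).ofLp ⬝ᵥ y.ofLp = 0 := by
    intro y hy i hi
    refine Submodule.span_induction ?_ ?_ ?_ ?_ hy
    · rintro _ ⟨j, rfl⟩
      have hij : i ≠ j := fun h => hi (h ▸ j.2)
      have := e.orthonormal.2 hij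
      simpa [PiLp.inner_apply, dotProduct, mul_comm] using this
    · simp
    · intro a b _ _ ha hb
      simp [dotProduct_add, ha, hb]
    · intro c a _ ha
      simp [dotProduct_smul, ha]
  -- The form of the pseudo-inverse of `L`: the inverse forms of the iterates tend to `S` on `H` and
  -- to infinity off `H`.
  let S : E d → ℝ := fun y => ∑ i ∈ p, ((e i).ofLp ⬝ᵥ y.ofLp) ^ 2 / l i
  have hS0 : ∀ y, 0 ≤ S y := fun y => Finset.sum_nonneg fun i _ =>
    div_nonneg (sq_nonneg _) (hl0 i)
  have hin : ∀ y ∈ H, Filter.Tendsto (fun n => qf (symInv (A n)) y) Filter.atTop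
      (nhds (S y)) := by
    intro y hy
    set x : E d := ∑ i ∈ p, (((e i).ofLp ⬝ᵥ y.ofLp) / l i) • e i with hx
    have e1 : y.ofLp = (L : Matrix (Fin d) (Fin d) ℝ) *ᵥ x.ofLp := by
      have h1 : y = ∑ i ∈ p, ((e i).ofLp ⬝ᵥ y.ofLp) • e i := by
        conv_lhs => rw [hexp y]
        refine (Finset.sum_subset (Finset.subset_univ _) fun i _ hi => ?_).symm
        rw [hHperp y hy i hi, zero_smul]
      conv_lhs => rw [h1]
      rw [hx, WithLp.ofLp_sum, WithLp.ofLp_sum, Matrix.mulVec_sum]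
      refine Finset.sum_congr rfl fun i hi => ?_
      have hi' : l i ≠ 0 := (Finset.mem_filter.1 hi).2.ne'
      rw [WithLp.ofLp_smul, WithLp.ofLp_smul, Matrix.mulVec_smul, hev, smul_smul,
        div_mul_cancel₀ _ hi']
    have e2 : qf L x = S y := by
      rw [qf, ← e1, hx, WithLp.ofLp_sum, sum_dotProduct]
      refine Finset.sum_congr rfl fun i _ => ?_
      rw [WithLp.ofLp_smul, smul_dotProduct, smul_eq_mul]
      ring
    rw [← e2]
    exact tendsto_qf_symInv_of_range hA hlim hle hL e1
  have hout : ∀ y ∉ H, Filter.Tendsto (fun n => qf (symInv (A n)) y) Filter.atTop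
      Filter.atTop := by
    intro y hy
    obtain ⟨i, hi, hne⟩ : ∃ i, i ∉ p ∧ (e i).ofLp ⬝ᵥ y.ofLp ≠ 0 := by
      by_contra! hc
      refine hy ?_
      rw [hexp y]
      refine Submodule.sum_mem _ fun i _ => ?_
      by_cases hi : i ∈ p
      · exact Submodule.smul_mem _ _ (Submodule.subset_span ⟨⟨i, hi⟩, rfl⟩)
      · rw [hc i hi, zero_smul]
        exact Submodule.zero_mem _
    exact tendsto_qf_symInv_atTop hA hlim ((hqe i).trans (hp0 i hi)) hne
  have hHm : MeasurableSet (H : Set (E d)) := H.closed_of_finiteDimensional.measurableSet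
  have hsp : ∀ y, 0 < ν + S y := fun y => by have := hS0 y; positivity
  have hcontS : Continuous S := by
    refine continuous_finsetSum _ fun i _ => Continuous.div_const (by fun_prop) _
  -- the two limiting trace identities
  have hInt : ∀ i ∈ p, Integrable ((H : Set (E d)).indicator
      fun y => ((e i).ofLp ⬝ᵥ y.ofLp) ^ 2 / l i / (ν + S y)) (Q : Measure (E d)) := by
    intro i hi
    refine Integrable.indicator (Integrable.of_bound (C := 1) ?_
      (Filter.Eventually.of_forall fun y => ?_)) hHm
    · exact (Continuous.div (by fun_prop) (by fun_prop) fun y => (hsp y).ne').aestronglyMeasurable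
    · have h1 : 0 ≤ ((e i).ofLp ⬝ᵥ y.ofLp) ^ 2 / l i := div_nonneg (sq_nonneg _) (hl0 i)
      rw [Real.norm_of_nonneg (div_nonneg h1 (hsp y).le), div_le_one (hsp y)]
      have : ((e i).ofLp ⬝ᵥ y.ofLp) ^ 2 / l i ≤ S y :=
        Finset.single_le_sum (f := fun i => ((e i).ofLp ⬝ᵥ y.ofLp) ^ 2 / l i)
          (fun i _ => div_nonneg (sq_nonneg _) (hl0 i)) hi
      linarith
  -- The limiting equation tested at an eigenvector; the part of the integral off `H` disappears
  -- because the denominators blow up there.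
  have hone : ∀ i ∈ p, (ν + d) * ∫ y, (H : Set (E d)).indicator
      (fun y => ((e i).ofLp ⬝ᵥ y.ofLp) ^ 2 / l i / (ν + S y)) y ∂(Q : Measure (E d)) = 1 := by
    intro i hi
    have hi' : l i ≠ 0 := (Finset.mem_filter.1 hi).2.ne'
    have h1 := hDCT (e i) (fun y => l i * (H : Set (E d)).indicator
      (fun y => ((e i).ofLp ⬝ᵥ y.ofLp) ^ 2 / l i / (ν + S y)) y) fun y => ?_
    · rw [integral_const_mul, hqe] at h1
      refine mul_left_cancel₀ hi' ?_
      linarith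
    · by_cases hy : y ∈ H
      · rw [indicator_of_mem (show y ∈ (H : Set (E d)) from hy), ← mul_div_assoc,
          mul_div_cancel₀ _ hi']
        exact Filter.Tendsto.div tendsto_const_nhds (tendsto_const_nhds.add (hin y hy)) (hsp y).ne'
      · rw [indicator_of_notMem (show y ∉ (H : Set (E d)) from hy), mul_zero]
        exact Filter.Tendsto.const_div_atTop
          (Filter.tendsto_atTop_add_const_left _ _ (hout y hy)) _
  have hcard : (p.card : ℝ) = (ν + d) * ∫ y, (H : Set (E d)).indicator
      (fun y => S y / (ν + S y)) y ∂(Q : Measure (E d)) := by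
    have h1 : ∀ y, (H : Set (E d)).indicator (fun y => S y / (ν + S y)) y = ∑ i ∈ p,
        (H : Set (E d)).indicator (fun y => ((e i).ofLp ⬝ᵥ y.ofLp) ^ 2 / l i / (ν + S y)) y := by
      intro y
      by_cases hy : y ∈ (H : Set (E d))
      · simp only [indicator_of_mem hy, ← Finset.sum_div, S]
      · simp only [indicator_of_notMem hy, Finset.sum_const_zero]
    rw [integral_congr_ae (Filter.Eventually.of_forall h1), integral_finsetSum _ hInt,
      Finset.mul_sum, Finset.sum_congr rfl hone]
    simp
  -- This is the limit of `tr((A n)⁻¹ A (n+1)) ≤ tr((A n)⁻¹ A n) = d`. Off `H` the integrand tends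
  -- to `1`, which is how the mass of the complement of `H` enters.
  have htr : (ν + d) * ∫ y, ((H : Set (E d)).indicator (fun y => S y / (ν + S y)) y +
      (H : Set (E d))ᶜ.indicator (fun _ => (1 : ℝ)) y) ∂(Q : Measure (E d)) ≤ d := by
    refine le_of_tendsto' (f := fun n => (ν + d) *
      ∫ y, qf (symInv (A n)) y / (ν + qf (symInv (A n)) y) ∂(Q : Measure (E d)))
      (x := Filter.atTop) ?_ fun n => ?_
    · refine Filter.Tendsto.const_mul _ (tendsto_integral_of_dominated_convergence
        (fun _ => 1) (fun n => hmeas n _ (continuous_qf _)) (integrable_const _)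
        (fun n => Filter.Eventually.of_forall fun y => ?_)
        (Filter.Eventually.of_forall fun y => ?_))
      · have hp := add_qf_symInv_pos hν (hA n) y
        have h0 := qf_nonneg (symInv_mem_PD (hA n)) y
        rw [Real.norm_of_nonneg (div_nonneg h0 hp.le), div_le_one hp]
        linarith
      · by_cases hy : y ∈ (H : Set (E d))
        · rw [indicator_of_mem hy, indicator_of_notMem (by simpa using hy), add_zero]
          exact Filter.Tendsto.div (hin y hy) (tendsto_const_nhds.add (hin y hy)) (hsp y).ne'
        · rw [indicator_of_notMem hy, indicator_of_mem (by simpa using hy), zero_add]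
          have h1 : ∀ n, qf (symInv (A n)) y / (ν + qf (symInv (A n)) y) =
              1 - ν / (ν + qf (symInv (A n)) y) := fun n => by
            have := (add_qf_symInv_pos hν (hA n) y).ne'
            field_simp
            ring
          simp only [h1]
          have h2 : Filter.Tendsto (fun n => ν / (ν + qf (symInv (A n)) y)) Filter.atTop
              (nhds 0) := Filter.Tendsto.const_div_atTop
            (Filter.tendsto_atTop_add_const_left _ _ (hout y hy)) _
          simpa using tendsto_const_nhds.sub h2
    · rw [← symPair_scatterMap hν Q (hA n), ← hsucc, ← symPair_symInv_self (hA n)]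
      exact symPair_mono (symInv_mem_PD (hA n)) (hanti n)
  have hInt' : Integrable ((H : Set (E d)).indicator fun y => S y / (ν + S y))
      (Q : Measure (E d)) := by
    refine Integrable.indicator (Integrable.of_bound (C := 1) ?_
      (Filter.Eventually.of_forall fun y => ?_)) hHm
    · exact (Continuous.div hcontS (by fun_prop) fun y => (hsp y).ne').aestronglyMeasurable
    · rw [Real.norm_of_nonneg (div_nonneg (hS0 y) (hsp y).le), div_le_one (hsp y)]
      linarith
  rw [integral_add hInt' ((integrable_const _).indicator hHm.compl), mul_add, ← hcard,
    integral_indicator_const _ hHm.compl, smul_eq_mul, mul_one, measureReal_compl hHm] at htr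
  -- Subtracting `hcard` leaves `(ν+d)(1 - Q(H)) ≤ d - dim H`, contrary to the condition defining
  -- `𝒰` unless `H` is the whole space.
  have hall : p.card = d := by
    by_contra hne
    have hlt : Module.finrank ℝ H < d := by
      rw [hfr]
      refine lt_of_le_of_ne ?_ hne
      simpa using Finset.card_le_univ p
    have h1 := hQ H hlt
    rw [hfr, lt_sub_iff_add_lt, ← lt_sub_iff_add_lt', div_lt_iff₀ (by positivity)] at h1
    simp only [probReal_univ] at htr
    linarith
  have hpos : ∀ i, 0 < l i := fun i => by
    have : p = Finset.univ := Finset.eq_univ_of_card p (by simpa using hall)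
    have hi : i ∈ p := this ▸ Finset.mem_univ i
    exact (Finset.mem_filter.1 hi).2
  exact hPSD.1.posDef_iff_eigenvalues_pos.2 hpos

/-! ### Fixed points and the scatter criterion -/

/-- Coordinates in which `A` is the identity and `B` is diagonal. -/
theorem exists_coordinates {A B : Sym d} (hA : A ∈ PD d) (hB : B ∈ PD d) :
    ∃ (v : Fin d → E d) (l : Fin d → ℝ), (∀ i, 0 < l i) ∧ (∀ i, qf A (v i) = 1) ∧
      (∀ y : E d, qf (symInv A) y = ∑ i, ((v i).ofLp ⬝ᵥ y.ofLp) ^ 2) ∧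
      (∀ y : E d, qf (symInv B) y = ∑ i, ((v i).ofLp ⬝ᵥ y.ofLp) ^ 2 / l i) ∧
      Real.log (B : Matrix (Fin d) (Fin d) ℝ).det - Real.log (A : Matrix (Fin d) (Fin d) ℝ).det =
        ∑ i, Real.log (l i) ∧
      symPair (symInv A) B = ∑ i, l i := by
  obtain ⟨S, l, hS, hl, hAS, hBS⟩ := exists_simultaneous_diag hA hB
  have hiS : S⁻¹ * S = 1 := Matrix.nonsing_inv_mul _ hS
  have hSi : S * S⁻¹ = 1 := Matrix.mul_nonsing_inv _ hS
  have hti : Sᵀ * (S⁻¹)ᵀ = 1 := by rw [← Matrix.transpose_mul, hiS, Matrix.transpose_one]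
  have hAinv : (A : Matrix (Fin d) (Fin d) ℝ)⁻¹ = (S⁻¹)ᵀ * S⁻¹ := by
    refine Matrix.inv_eq_right_inv ?_
    rw [hAS, Matrix.mul_assoc, ← Matrix.mul_assoc Sᵀ, hti, Matrix.one_mul, hSi]
  have hdd : Matrix.diagonal l * Matrix.diagonal (fun i => (l i)⁻¹) =
      (1 : Matrix (Fin d) (Fin d) ℝ) := by
    rw [Matrix.diagonal_mul_diagonal, ← Matrix.diagonal_one]
    congr 1
    funext i
    exact mul_inv_cancel₀ (hl i).ne'
  have hBinv : (B : Matrix (Fin d) (Fin d) ℝ)⁻¹ =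
      (S⁻¹)ᵀ * (Matrix.diagonal (fun i => (l i)⁻¹) * S⁻¹) := by
    refine Matrix.inv_eq_right_inv ?_
    rw [hBS, Matrix.mul_assoc, ← Matrix.mul_assoc Sᵀ, hti, Matrix.one_mul, Matrix.mul_assoc,
      ← Matrix.mul_assoc (Matrix.diagonal l), hdd, Matrix.one_mul, hSi]
  have hz : ∀ (y : E d) (i : Fin d), (S⁻¹ *ᵥ y.ofLp) i = (fun j => S⁻¹ i j) ⬝ᵥ y.ofLp :=
    fun y i => rfl
  have hquad : ∀ (D : Matrix (Fin d) (Fin d) ℝ) (y : E d),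
      y.ofLp ⬝ᵥ (((S⁻¹)ᵀ * (D * S⁻¹)) *ᵥ y.ofLp) =
        (S⁻¹ *ᵥ y.ofLp) ⬝ᵥ (D *ᵥ (S⁻¹ *ᵥ y.ofLp)) := fun D y => by
    rw [← Matrix.mulVec_mulVec, ← Matrix.mulVec_mulVec, Matrix.dotProduct_mulVec,
      Matrix.vecMul_transpose]
  -- The vectors are the rows of `S⁻¹`, so that the numbers `(v i)'y` are the coordinates of `S⁻¹y`.
  refine ⟨fun i => WithLp.toLp 2 fun j => S⁻¹ i j, l, hl, fun i => ?_, fun y => ?_, fun y => ?_,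
    ?_, ?_⟩
  · have h1 : (fun j => S⁻¹ i j) = (S⁻¹)ᵀ *ᵥ Pi.single i 1 := by
      ext j
      simp
    rw [qf, hAS]
    change (fun j => S⁻¹ i j) ⬝ᵥ ((S * Sᵀ) *ᵥ fun j => S⁻¹ i j) = 1
    rw [h1, Matrix.mulVec_mulVec, Matrix.mul_assoc, hti, Matrix.mul_one, Matrix.dotProduct_mulVec,
      ← Matrix.mulVec_transpose, Matrix.mulVec_mulVec, hti]
    simp
  · have h1 := hquad 1 y
    rw [Matrix.one_mul, Matrix.one_mulVec] at h1
    rw [qf, coe_symInv, hAinv, h1]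
    simp only [dotProduct, hz, sq]
  · rw [qf, coe_symInv, hBinv, hquad]
    simp only [dotProduct, hz, Matrix.mulVec_diagonal]
    refine Finset.sum_congr rfl fun i _ => ?_
    rw [div_eq_mul_inv]
    ring
  · have hdetA : (A : Matrix (Fin d) (Fin d) ℝ).det = S.det * S.det := by
      rw [hAS, Matrix.det_mul, Matrix.det_transpose]
    have hdetB : (B : Matrix (Fin d) (Fin d) ℝ).det = S.det * S.det * ∏ i, l i := by
      rw [hBS, Matrix.det_mul, Matrix.det_mul, Matrix.det_transpose, Matrix.det_diagonal]
      ring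
    rw [hdetA, hdetB, Real.log_mul (mul_ne_zero hS.ne_zero hS.ne_zero)
      (Finset.prod_ne_zero_iff.2 fun i _ => (hl i).ne'), Real.log_prod fun i _ => (hl i).ne']
    ring
  · rw [symPair_eq_trace, coe_symInv, hAinv, hBS, Matrix.mul_assoc, Matrix.mul_assoc,
      ← Matrix.mul_assoc S⁻¹, hiS, Matrix.one_mul, Matrix.trace_mul_comm, Matrix.mul_assoc, hti,
      Matrix.mul_one, Matrix.trace_diagonal]

/-- The scatter equation forces the law into `𝒰`. -/
theorem mem_U_of_fixedPoint {ν : ℝ} (hν : 0 < ν) {Q : Law d} {A : Sym d} (hA : A ∈ PD d)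
    (hfix : scatterMap ν Q A = A) : Q ∈ U d (ν + d) := by
  intro H hH
  obtain ⟨S, -, hS, -, hAS, -⟩ := exists_simultaneous_diag hA hA
  have hiS : S⁻¹ * S = 1 := Matrix.nonsing_inv_mul _ hS
  have hSi : S * S⁻¹ = 1 := Matrix.mul_nonsing_inv _ hS
  have hti : Sᵀ * (S⁻¹)ᵀ = 1 := by rw [← Matrix.transpose_mul, hiS, Matrix.transpose_one]
  have hAinv : (A : Matrix (Fin d) (Fin d) ℝ)⁻¹ = (S⁻¹)ᵀ * S⁻¹ := by
    refine Matrix.inv_eq_right_inv ?_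
    rw [hAS, Matrix.mul_assoc, ← Matrix.mul_assoc Sᵀ, hti, Matrix.one_mul, hSi]
  -- In the coordinates `S⁻¹y` the matrix `A` becomes the identity. An orthonormal basis of the
  -- complement of the image of `H`, pulled back, gives vectors `v i` that annihilate `H` and
  -- satisfy `v'Av = 1`.
  let T : E d →ₗ[ℝ] E d := Matrix.toEuclideanLin S⁻¹
  have hT : ∀ y : E d, (T y).ofLp = S⁻¹ *ᵥ y.ofLp := fun y => rfl
  have hTq : ∀ y : E d, ‖T y‖ ^ 2 = qf (symInv A) y := fun y => by
    rw [← dotProduct_self_eq_norm_sq, hT, qf, coe_symInv, hAinv, ← Matrix.mulVec_mulVec,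
      Matrix.dotProduct_mulVec y.ofLp, Matrix.vecMul_transpose]
  let K : Submodule ℝ (E d) := H.map T
  let w := stdOrthonormalBasis ℝ Kᗮ
  let m := Module.finrank ℝ Kᗮ
  have hm : (d : ℝ) - Module.finrank ℝ H ≤ m := by
    have h1 : Module.finrank ℝ K + m = Module.finrank ℝ (E d) :=
      Submodule.finrank_add_finrank_orthogonal K
    have h2 : Module.finrank ℝ K ≤ Module.finrank ℝ H := Submodule.finrank_map_le T H
    rw [finrank_euclideanSpace, Fintype.card_fin] at h1
    have h3 : d ≤ Module.finrank ℝ H + m := by omega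
    have : (d : ℝ) ≤ Module.finrank ℝ H + m := by exact_mod_cast h3
    linarith
  let v : Fin m → E d := fun i => WithLp.toLp 2 ((S⁻¹)ᵀ *ᵥ (w i : E d).ofLp)
  have hvy : ∀ i (y : E d), (v i).ofLp ⬝ᵥ y.ofLp = inner ℝ (w i : E d) (T y) := fun i y => by
    have : (v i).ofLp ⬝ᵥ y.ofLp = (w i : E d).ofLp ⬝ᵥ (S⁻¹ *ᵥ y.ofLp) := by
      rw [Matrix.dotProduct_mulVec, ← Matrix.mulVec_transpose]
    rw [this, ← hT, inner_eq_dotProduct]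
  have hv1 : ∀ i, qf A (v i) = 1 := fun i => by
    have h1 : (w i : E d).ofLp ⬝ᵥ (w i : E d).ofLp = 1 := by
      rw [dotProduct_self_eq_norm_sq, Submodule.norm_coe, w.orthonormal.1 i]
      norm_num
    rw [qf, hAS]
    change ((S⁻¹)ᵀ *ᵥ (w i : E d).ofLp) ⬝ᵥ ((S * Sᵀ) *ᵥ ((S⁻¹)ᵀ *ᵥ (w i : E d).ofLp)) = 1
    rw [Matrix.mulVec_mulVec, Matrix.mul_assoc, hti, Matrix.mul_one, Matrix.dotProduct_mulVec,
      ← Matrix.mulVec_transpose, Matrix.mulVec_mulVec, hti, Matrix.one_mulVec, h1]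
  have hbessel : ∀ y, ∑ i, ((v i).ofLp ⬝ᵥ y.ofLp) ^ 2 ≤ qf (symInv A) y := fun y => by
    have ho : Orthonormal ℝ fun i => (w i : E d) :=
      w.orthonormal.comp_linearIsometry Kᗮ.subtypeₗᵢ
    have := ho.sum_inner_products_le (T y) (s := Finset.univ)
    rw [hTq] at this
    simpa [hvy] using this
  have hvan : ∀ y ∈ H, ∀ i, (v i).ofLp ⬝ᵥ y.ofLp = 0 := fun y hy i => by
    rw [hvy, real_inner_comm]
    exact (w i).2 _ (Submodule.mem_map_of_mem hy)
  -- By the scatter equation each summand integrates to `1/(ν+d)`. As `f` vanishes on `H` and is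
  -- below `1` elsewhere, its integral, at least `(d - dim H)/(ν+d)`, is bounded by the mass off
  -- `H`.
  let f : E d → ℝ := fun y => ∑ i, ((v i).ofLp ⬝ᵥ y.ofLp) ^ 2 / (ν + qf (symInv A) y)
  have hfi : Integrable f (Q : Measure (E d)) :=
    integrable_finsetSum _ fun i _ => integrable_sq_div hν Q hA (v i)
  have hfm : (ν + d) * ∫ y, f y ∂(Q : Measure (E d)) = m := by
    rw [integral_finsetSum _ fun i _ => integrable_sq_div hν Q hA (v i), Finset.mul_sum]
    have : ∀ i, (ν + d) * ∫ y, ((v i).ofLp ⬝ᵥ y.ofLp) ^ 2 / (ν + qf (symInv A) y)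
        ∂(Q : Measure (E d)) = 1 := fun i => by
      rw [← qf_scatterMap hν Q hA, hfix, hv1]
    simp [this]
  have hHm : MeasurableSet (H : Set (E d)) := H.closed_of_finiteDimensional.measurableSet
  let g : E d → ℝ := (H : Set (E d))ᶜ.indicator fun _ => (1 : ℝ)
  have hgi : Integrable g (Q : Measure (E d)) := (integrable_const _).indicator hHm.compl
  have hfz : ∀ y ∈ H, f y = 0 := fun y hy => by simp [f, hvan y hy]
  have hflt : ∀ y, f y < 1 := fun y => by
    have hp := add_qf_symInv_pos hν hA y
    simp only [f, ← Finset.sum_div]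
    rw [div_lt_one hp]
    linarith [hbessel y]
  have hnn : ∀ y, 0 ≤ (g - f) y := fun y => by
    by_cases hy : y ∈ (H : Set (E d))
    · simp [g, hfz y hy, show y ∈ H from hy]
    · have := (hflt y).le
      simpa [g, show y ∉ H from hy] using this
  -- Equality would force `f = 0` almost everywhere, although `(ν+d) ∫ f = m ≥ d - dim H > 0`.
  have hlt : 0 < ∫ y, (g - f) y ∂(Q : Measure (E d)) := by
    refine lt_of_le_of_ne (integral_nonneg hnn) fun h0 => ?_
    have h1 := (integral_eq_zero_iff_of_nonneg hnn (hgi.sub hfi)).1 h0.symm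
    have h2 : ∀ᵐ y ∂(Q : Measure (E d)), f y = 0 := by
      filter_upwards [h1] with y hy
      by_contra hne
      have hyH : y ∉ H := fun h => hne (hfz y h)
      have : (1 : ℝ) - f y = 0 := by simpa [g, hyH] using hy
      have := hflt y
      linarith
    rw [integral_congr_ae h2, integral_zero, mul_zero] at hfm
    have : (Module.finrank ℝ H : ℝ) < d := by exact_mod_cast hH
    linarith
  simp only [Pi.sub_apply] at hlt
  rw [integral_sub hgi hfi, integral_indicator_const _ hHm.compl, smul_eq_mul, mul_one,
    measureReal_compl hHm, probReal_univ] at hlt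
  have ha : 0 < ν + d := by positivity
  have h5 : ((d : ℝ) - Module.finrank ℝ H) / (ν + d) ≤ ∫ y, f y ∂(Q : Measure (E d)) := by
    rw [div_le_iff₀ ha]
    linarith
  linarith

/-! ### The criterion as an integral of bounded logarithms -/

theorem add_qf_symInv_div_le {ν : ℝ} (hν : 0 < ν) {A B : Sym d} (hA : A ∈ PD d) (hB : B ∈ PD d) :
    ∃ K : ℝ, ∀ y : E d, Real.log ((ν + qf (symInv B) y) / (ν + qf (symInv A) y)) ≤ K := by
  obtain ⟨c, hc, h⟩ := exists_pos_mul_sq_le_qf (symInv_mem_PD hA)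
  refine ⟨‖(symInv B : Matrix (Fin d) (Fin d) ℝ)‖ / c, fun y => ?_⟩
  have hpA := add_qf_symInv_pos hν hA y
  have hpB := add_qf_symInv_pos hν hB y
  refine (Real.log_le_sub_one_of_pos (div_pos hpB hpA)).trans ?_
  rw [sub_le_iff_le_add, div_le_iff₀ hpA]
  have h1 := qf_le_norm (symInv B) y
  have h2 : ‖(symInv B : Matrix (Fin d) (Fin d) ℝ)‖ * ‖y‖ ^ 2 ≤
      ‖(symInv B : Matrix (Fin d) (Fin d) ℝ)‖ / c * qf (symInv A) y := by
    rw [div_mul_eq_mul_div, le_div_iff₀ hc, mul_assoc]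
    refine mul_le_mul_of_nonneg_left ?_ (norm_nonneg _)
    linarith [h y]
  have h3 : 0 ≤ ‖(symInv B : Matrix (Fin d) (Fin d) ℝ)‖ / c * ν := by positivity
  have h4 := qf_nonneg (symInv_mem_PD hA) y
  linarith

/-- The forms of two inverses are comparable up to constants, so the logarithm of the ratio is
bounded above; exchanging `A` and `B` bounds it below. -/
theorem integrable_log_div {ν : ℝ} (hν : 0 < ν) (Q : Law d) {A B : Sym d} (hA : A ∈ PD d)
    (hB : B ∈ PD d) :
    Integrable (fun y => Real.log ((ν + qf (symInv B) y) / (ν + qf (symInv A) y)))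
      (Q : Measure (E d)) := by
  obtain ⟨K, hK⟩ := add_qf_symInv_div_le hν hA hB
  obtain ⟨K', hK'⟩ := add_qf_symInv_div_le hν hB hA
  refine Integrable.of_bound (C := max K K') ?_ (Filter.Eventually.of_forall fun y => ?_)
  · refine Continuous.aestronglyMeasurable (Continuous.log (Continuous.div ?_ ?_ ?_) ?_)
    · exact continuous_const.add (continuous_qf _)
    · exact continuous_const.add (continuous_qf _)
    · exact fun y => (add_qf_symInv_pos hν hA y).ne'
    · exact fun y => (div_pos (add_qf_symInv_pos hν hB y) (add_qf_symInv_pos hν hA y)).ne'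
  · rw [Real.norm_eq_abs]
    refine abs_le.2 ⟨?_, (hK y).trans (le_max_left _ _)⟩
    have h1 := (hK' y).trans (le_max_right K K')
    rw [← inv_div, Real.log_inv] at h1
    linarith

theorem rho_sub_rho {ν : ℝ} (hν : 0 < ν) {s t : ℝ} (hs : 0 ≤ s) (ht : 0 ≤ t) :
    rho ν d s - rho ν d t = (ν + d) / 2 * Real.log ((ν + s) / (ν + t)) := by
  have h1 : ν + s ≠ 0 := by positivity
  have h2 : ν + t ≠ 0 := by positivity
  rw [rho, rho, Real.log_div h1 hν.ne', Real.log_div h2 hν.ne', Real.log_div h1 h2]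
  ring

/-- The reference term `y'y` is the form of the inverse of the identity, so the criterion itself is
an instance of comparing two positive definite matrices. -/
theorem rho_integrand_eq {ν : ℝ} (hν : 0 < ν) {A : Sym d} (hA : A ∈ PD d) (y : E d) :
    rho ν d (qf (symInv A) y) - rho ν d (y.ofLp ⬝ᵥ y.ofLp) = (ν + d) / 2 *
      Real.log ((ν + qf (symInv A) y) / (ν + qf (symInv (symScalar d 1)) y)) := by
  have e : y.ofLp ⬝ᵥ y.ofLp = qf (symInv (symScalar d 1)) y := by
    rw [symInv_symScalar one_pos, qf_symScalar, inv_one, one_mul, dotProduct_self_eq_norm_sq]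
  rw [e]
  exact rho_sub_rho hν (qf_nonneg (symInv_mem_PD hA) y)
    (qf_nonneg (symInv_mem_PD (symScalar_mem_PD one_pos)) y)

theorem integrable_rho_sub_rho {ν : ℝ} (hν : 0 < ν) (Q : Law d) {A : Sym d} (hA : A ∈ PD d) :
    Integrable (fun y => rho ν d (qf (symInv A) y) - rho ν d (y.ofLp ⬝ᵥ y.ofLp))
      (Q : Measure (E d)) := by
  simp only [rho_integrand_eq hν hA]
  exact (integrable_log_div hν Q (symScalar_mem_PD one_pos) hA).const_mul _

theorem scatterCrit_sub {ν : ℝ} (hν : 0 < ν) (Q : Law d) {A B : Sym d} (hA : A ∈ PD d)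
    (hB : B ∈ PD d) : scatterCrit ν Q B - scatterCrit ν Q A =
      1 / 2 * (Real.log (B : Matrix (Fin d) (Fin d) ℝ).det -
        Real.log (A : Matrix (Fin d) (Fin d) ℝ).det) +
      (ν + d) / 2 * ∫ y, Real.log ((ν + qf (symInv B) y) / (ν + qf (symInv A) y))
        ∂(Q : Measure (E d)) := by
  have h : (∫ y, (rho ν d (qf (symInv B) y) - rho ν d (y.ofLp ⬝ᵥ y.ofLp)) ∂(Q : Measure (E d))) -
      ∫ y, (rho ν d (qf (symInv A) y) - rho ν d (y.ofLp ⬝ᵥ y.ofLp)) ∂(Q : Measure (E d)) =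
      (ν + d) / 2 * ∫ y, Real.log ((ν + qf (symInv B) y) / (ν + qf (symInv A) y))
        ∂(Q : Measure (E d)) := by
    rw [← integral_sub (integrable_rho_sub_rho hν Q hB) (integrable_rho_sub_rho hν Q hA),
      ← integral_const_mul]
    refine integral_congr_ae (Filter.Eventually.of_forall fun y => ?_)
    simp only [sub_sub_sub_cancel_right]
    exact rho_sub_rho hν (qf_nonneg (symInv_mem_PD hB) y) (qf_nonneg (symInv_mem_PD hA) y)
  rw [← h, scatterCrit, scatterCrit]
  ring

/-- Jensen's inequality for the logarithm, with one node at `1`. -/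
theorem sum_mul_log_le {ι : Type*} [Fintype ι] {w₀ : ℝ} {w x : ι → ℝ} (hw₀ : 0 < w₀)
    (hw : ∀ i, 0 ≤ w i) (hsum : w₀ + ∑ i, w i = 1) (hx : ∀ i, 0 < x i) :
    ∑ i, w i * Real.log (x i) ≤ Real.log (w₀ + ∑ i, w i * x i) ∧
      ((∃ i, w i ≠ 0 ∧ x i ≠ 1) →
        ∑ i, w i * Real.log (x i) < Real.log (w₀ + ∑ i, w i * x i)) := by
  set m := w₀ + ∑ i, w i * x i with hm
  have hmpos : 0 < m := by
    have : 0 ≤ ∑ i, w i * x i := Finset.sum_nonneg fun i _ => mul_nonneg (hw i) (hx i).le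
    positivity
  -- The tangent line of the logarithm at the weighted mean `m`; its weighted average over the nodes
  -- is exactly `log m`.
  have hlog : ∀ t : ℝ, 0 < t → Real.log t ≤ Real.log m + (t / m - 1) := fun t ht => by
    have := Real.log_le_sub_one_of_pos (div_pos ht hmpos)
    rw [Real.log_div ht.ne' hmpos.ne'] at this
    linarith
  have hlog' : ∀ t : ℝ, 0 < t → t ≠ m → Real.log t < Real.log m + (t / m - 1) := fun t ht htm => by
    have := Real.log_lt_sub_one_of_pos (div_pos ht hmpos) fun h => htm ((div_eq_one_iff_eq hmpos.ne').1 h)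
    rw [Real.log_div ht.ne' hmpos.ne'] at this
    linarith
  have hterm : ∀ i, w i * Real.log (x i) ≤ w i * (Real.log m + (x i / m - 1)) := fun i =>
    mul_le_mul_of_nonneg_left (hlog _ (hx i)) (hw i)
  have h0 : 0 ≤ w₀ * (Real.log m + (1 / m - 1)) := by
    have := hlog 1 one_pos
    rw [Real.log_one] at this
    positivity
  have htot : w₀ * (Real.log m + (1 / m - 1)) + ∑ i, w i * (Real.log m + (x i / m - 1)) =
      Real.log m := by
    have e1 : ∑ i, w i * (Real.log m + (x i / m - 1)) =
        (Real.log m - 1) * ∑ i, w i + (∑ i, w i * x i) / m := by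
      rw [Finset.mul_sum, Finset.sum_div, ← Finset.sum_add_distrib]
      exact Finset.sum_congr rfl fun i _ => by ring
    have e2 : ∑ i, w i = 1 - w₀ := by linarith
    have e3 : ∑ i, w i * x i = m - w₀ := by rw [hm]; ring
    rw [e1, e2, e3]
    field_simp
    ring
  have hle : ∑ i, w i * Real.log (x i) ≤ ∑ i, w i * (Real.log m + (x i / m - 1)) :=
    Finset.sum_le_sum fun i _ => hterm i
  refine ⟨by linarith, ?_⟩
  rintro ⟨i, hwi, hxi⟩
  -- A node different from `m` carries positive weight in either case: node `i` if `m = 1`, and the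
  -- node `1` with weight `w₀` otherwise.
  rcases eq_or_ne m 1 with h1 | h1
  · have : ∑ i, w i * Real.log (x i) < ∑ i, w i * (Real.log m + (x i / m - 1)) :=
      Finset.sum_lt_sum (fun i _ => hterm i) ⟨i, Finset.mem_univ i,
        mul_lt_mul_of_pos_left (hlog' _ (hx i) (by rwa [h1])) (lt_of_le_of_ne (hw i) hwi.symm)⟩
    linarith
  · have h2 := hlog' 1 one_pos h1.symm
    rw [Real.log_one] at h2
    have := mul_pos hw₀ h2
    linarith

/-- A solution of the scatter equation is the strict minimum of the criterion. -/
theorem scatterCrit_lt_of_fixedPoint {ν : ℝ} (hν : 0 < ν) {Q : Law d} {A B : Sym d}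
    (hA : A ∈ PD d) (hfix : scatterMap ν Q A = A) (hB : B ∈ PD d) (hne : B ≠ A) :
    scatterCrit ν Q A < scatterCrit ν Q B := by
  obtain ⟨v, l, hl, hv, hqA, hqB, hdet, -⟩ := exists_coordinates hA hB
  obtain ⟨i₀, hi₀⟩ : ∃ i, l i ≠ 1 := by
    by_contra! hc
    refine hne ?_
    rw [← symInv_symInv hA, ← symInv_symInv hB]
    congr 1
    exact Sym.ext_qf fun y => by simp [hqA, hqB, hc]
  have hInt : ∀ i, Integrable (fun y : E d => ((v i).ofLp ⬝ᵥ y.ofLp) ^ 2 /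
      (ν + qf (symInv A) y) * Real.log (l i)⁻¹) (Q : Measure (E d)) := fun i =>
    (integrable_sq_div hν Q hA (v i)).mul_const _
  have hone : ∀ i, (ν + d) * ∫ y, ((v i).ofLp ⬝ᵥ y.ofLp) ^ 2 / (ν + qf (symInv A) y)
      ∂(Q : Measure (E d)) = 1 := fun i => by
    rw [← qf_scatterMap hν Q hA, hfix, hv]
  -- For fixed `y`, the weights are the shares of `ν` and of the squares `((v i)'y)²` in `ν +
  -- y'A⁻¹y`, at the nodes `1` and `1/l i`; the mean is the ratio inside the criterion.
  have hJ := fun y : E d => sum_mul_log_le (w₀ := ν / (ν + qf (symInv A) y))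
    (w := fun i => ((v i).ofLp ⬝ᵥ y.ofLp) ^ 2 / (ν + qf (symInv A) y)) (x := fun i => (l i)⁻¹)
    (div_pos hν (add_qf_symInv_pos hν hA y))
    (fun i => div_nonneg (sq_nonneg _) (add_qf_symInv_pos hν hA y).le)
    (by rw [← Finset.sum_div, ← add_div, ← hqA, div_self (add_qf_symInv_pos hν hA y).ne'])
    (fun i => inv_pos.2 (hl i))
  have hval : ∀ y : E d, ν / (ν + qf (symInv A) y) + ∑ i, ((v i).ofLp ⬝ᵥ y.ofLp) ^ 2 /
      (ν + qf (symInv A) y) * (l i)⁻¹ = (ν + qf (symInv B) y) / (ν + qf (symInv A) y) := fun y => by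
    rw [hqB, add_div, Finset.sum_div]
    congr 1
    exact Finset.sum_congr rfl fun i _ => by ring
  simp only [hval] at hJ
  -- By the scatter equation each weight integrates to `1/(ν+d)`, so after integration the left side
  -- exactly cancels the log-determinant term. Equality would make the weight at `i₀` vanish almost
  -- everywhere, against that same equation.
  have hlt : ∫ y, ∑ i, ((v i).ofLp ⬝ᵥ y.ofLp) ^ 2 / (ν + qf (symInv A) y) * Real.log (l i)⁻¹
      ∂(Q : Measure (E d)) <
      ∫ y, Real.log ((ν + qf (symInv B) y) / (ν + qf (symInv A) y)) ∂(Q : Measure (E d)) := by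
    have hi := integrable_finsetSum Finset.univ fun i _ => hInt i
    have hi' := integrable_log_div hν Q hA hB
    refine lt_of_le_of_ne (integral_mono hi hi' fun y => (hJ y).1) fun h0 => ?_
    have h1 : ∀ᵐ y ∂(Q : Measure (E d)),
        ((v i₀).ofLp ⬝ᵥ y.ofLp) ^ 2 / (ν + qf (symInv A) y) = 0 := by
      filter_upwards [(integral_eq_iff_of_ae_le hi hi'
        (Filter.Eventually.of_forall fun y => (hJ y).1)).1 h0] with y hy
      by_contra hc
      exact ((hJ y).2 ⟨i₀, hc, by simpa using hi₀⟩).ne hy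
    have h2 := hone i₀
    rw [integral_congr_ae h1, integral_zero, mul_zero] at h2
    exact zero_ne_one h2
  rw [integral_finsetSum _ fun i _ => hInt i] at hlt
  simp only [integral_mul_const, Real.log_inv] at hlt
  have ha : 0 < (ν + d) / 2 := by positivity
  have h3 := mul_lt_mul_of_pos_left hlt ha
  have h4 : (ν + d) / 2 * ∑ i, (∫ y, ((v i).ofLp ⬝ᵥ y.ofLp) ^ 2 / (ν + qf (symInv A) y)
      ∂(Q : Measure (E d))) * -Real.log (l i) = -(1 / 2 * ∑ i, Real.log (l i)) := by
    rw [Finset.mul_sum, Finset.mul_sum, ← Finset.sum_neg_distrib]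
    refine Finset.sum_congr rfl fun i _ => ?_
    linear_combination -(1 / 2) * Real.log (l i) * hone i
  have h5 := scatterCrit_sub hν Q hA hB
  rw [hdet] at h5
  linarith

/-! ### Critical points are the solutions of the scatter equation -/

theorem symPair_sub_left (M N A : Sym d) : symPair (M - N) A = symPair M A - symPair N A := by
  simp [symPair_eq_trace, sub_mul]

/-- An upper bound of `scatterCrit ν Q B - scatterCrit ν Q A`, up to a factor `2`, which is exact
to first order. -/
def scatterMajorant (ν : ℝ) (Q : Law d) (A B : Sym d) : ℝ :=
  symPair (symInv A) B - d + symPair (symInv B - symInv A) (scatterMap ν Q A)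

/-- Both parts come from `log t ≤ t - 1`: for the determinant with `t = l i`, for the integral with
`t` the ratio of the two denominators. -/
theorem scatterCrit_sub_le {ν : ℝ} (hν : 0 < ν) (Q : Law d) {A B : Sym d} (hA : A ∈ PD d)
    (hB : B ∈ PD d) :
    scatterCrit ν Q B - scatterCrit ν Q A ≤ 1 / 2 * scatterMajorant ν Q A B := by
  obtain ⟨v, l, hl, -, -, -, hdet, htr⟩ := exists_coordinates hA hB
  have h1 : ∑ i, Real.log (l i) ≤ symPair (symInv A) B - d := by
    rw [htr]
    have : ∑ i, Real.log (l i) ≤ ∑ i, (l i - 1) :=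
      Finset.sum_le_sum fun i _ => Real.log_le_sub_one_of_pos (hl i)
    simpa using this
  have h2 : (ν + d) * ∫ y, Real.log ((ν + qf (symInv B) y) / (ν + qf (symInv A) y))
        ∂(Q : Measure (E d)) ≤ symPair (symInv B - symInv A) (scatterMap ν Q A) := by
    rw [symPair_scatterMap hν Q hA]
    refine mul_le_mul_of_nonneg_left (integral_mono (integrable_log_div hν Q hA hB)
      (integrable_qf_div hν Q hA _) fun y => ?_) (by positivity)
    have hpA := add_qf_symInv_pos hν hA y
    have hpB := add_qf_symInv_pos hν hB y
    refine (Real.log_le_sub_one_of_pos (div_pos hpB hpA)).trans_eq ?_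
    rw [qf_sub]
    field_simp
    ring
  rw [scatterCrit_sub hν Q hA hB, hdet, scatterMajorant]
  linarith

theorem scatterMajorant_self {ν : ℝ} (Q : Law d) {A : Sym d} (hA : A ∈ PD d) :
    scatterMajorant ν Q A A = 0 := by
  rw [scatterMajorant, symPair_symInv_self hA]
  simp [symPair]

/-- The linear form `N ↦ tr (N M)`. -/
def traceMulL (M : Matrix (Fin d) (Fin d) ℝ) : Matrix (Fin d) (Fin d) ℝ →L[ℝ] ℝ :=
  LinearMap.toContinuousLinearMap
    ((Matrix.traceLinearMap (Fin d) ℝ ℝ).comp (LinearMap.mulRight ℝ M))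

theorem traceMulL_apply (M N : Matrix (Fin d) (Fin d) ℝ) : traceMulL M N = Matrix.trace (N * M) :=
  rfl

theorem hasFDerivAt_scatterMajorant {ν : ℝ} (Q : Law d) {A : Sym d} (hA : A ∈ PD d) :
    ∃ f' : Sym d →L[ℝ] ℝ, HasFDerivAt (scatterMajorant ν Q A) f' A ∧
      ∀ D : Sym d, f' D = Matrix.trace ((D : Matrix (Fin d) (Fin d) ℝ) *
          (A : Matrix (Fin d) (Fin d) ℝ)⁻¹) -
        Matrix.trace ((A : Matrix (Fin d) (Fin d) ℝ)⁻¹ * (D : Matrix (Fin d) (Fin d) ℝ) * (A : Matrix (Fin d) (Fin d) ℝ)⁻¹ *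
          (scatterMap ν Q A : Matrix (Fin d) (Fin d) ℝ)) := by
  have h1 : HasFDerivAt (fun B : Sym d => traceMulL (A : Matrix (Fin d) (Fin d) ℝ)⁻¹
      (B : Matrix (Fin d) (Fin d) ℝ)) _ A :=
    ((traceMulL (A : Matrix (Fin d) (Fin d) ℝ)⁻¹).comp (symMat d).subtypeL).hasFDerivAt
  have h2 : HasFDerivAt (fun B : Sym d =>
      traceMulL (scatterMap ν Q A : Matrix (Fin d) (Fin d) ℝ)
        (B : Matrix (Fin d) (Fin d) ℝ)⁻¹) _ A :=
    (traceMulL (scatterMap ν Q A : Matrix (Fin d) (Fin d) ℝ)).hasFDerivAt.comp A (hasFDerivAt_inv hA)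
  have h3 : scatterMajorant ν Q A = fun B : Sym d =>
      traceMulL (A : Matrix (Fin d) (Fin d) ℝ)⁻¹ (B : Matrix (Fin d) (Fin d) ℝ) - d +
      (traceMulL (scatterMap ν Q A : Matrix (Fin d) (Fin d) ℝ) (B : Matrix (Fin d) (Fin d) ℝ)⁻¹ -
        symPair (symInv A) (scatterMap ν Q A)) := by
    funext B
    rw [scatterMajorant, symPair_sub_left, traceMulL_apply, traceMulL_apply, symPair_eq_trace,
      symPair_eq_trace (symInv B), Matrix.trace_mul_comm]
    rfl
  rw [h3]
  refine ⟨_, (h1.sub_const _).add (h2.sub_const _), fun D => ?_⟩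
  simp only [_root_.add_apply, ContinuousLinearMap.comp_apply, traceMulL_apply,
    Submodule.subtypeL_apply, _root_.neg_apply,
    ContinuousLinearMap.mulLeftRight_apply, Matrix.neg_mul, Matrix.trace_neg]
  ring

/-- The increment of the criterion lies between `0`, by minimality, and half the majorant, whose
derivative vanishes at a fixed point. -/
theorem hasFDerivAt_scatterCrit_of_fixedPoint {ν : ℝ} (hν : 0 < ν) {Q : Law d} {A : Sym d}
    (hA : A ∈ PD d) (hfix : scatterMap ν Q A = A) :
    HasFDerivAt (scatterCrit ν Q) (0 : Sym d →L[ℝ] ℝ) A := by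
  obtain ⟨f', hf', hval⟩ := hasFDerivAt_scatterMajorant (ν := ν) Q hA
  have hf0 : f' = 0 := by
    ext1 D
    rw [hval, hfix, Matrix.mul_assoc _ _ (A : Matrix (Fin d) (Fin d) ℝ),
      Matrix.nonsing_inv_mul _ (isUnit_det_of_mem_PD hA), Matrix.mul_one, Matrix.trace_mul_comm,
      sub_self, _root_.zero_apply]
  rw [hf0] at hf'
  rw [hasFDerivAt_iff_isLittleO] at hf' ⊢
  refine Asymptotics.IsBigO.trans_isLittleO (Asymptotics.IsBigO.of_bound (1 / 2) ?_) hf'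
  filter_upwards [isOpen_PD.mem_nhds hA] with B hB
  have h1 := scatterCrit_sub_le hν Q hA hB
  have h2 : 0 ≤ scatterCrit ν Q B - scatterCrit ν Q A := by
    rcases eq_or_ne B A with rfl | hne
    · simp
    · linarith [scatterCrit_lt_of_fixedPoint hν hA hfix hB hne]
  simp only [_root_.zero_apply, sub_zero, scatterMajorant_self Q hA]
  rw [Real.norm_of_nonneg h2, Real.norm_of_nonneg (by linarith)]
  exact h1

/-- The criterion minus half its majorant has a local maximum at `A`, so the majorant is critical at
`A` too, and its derivative encodes the scatter equation. -/
theorem fixedPoint_of_hasFDerivAt {ν : ℝ} (hν : 0 < ν) {Q : Law d} {A : Sym d} (hA : A ∈ PD d)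
    (hcrit : HasFDerivAt (scatterCrit ν Q) (0 : Sym d →L[ℝ] ℝ) A) : scatterMap ν Q A = A := by
  obtain ⟨f', hf', hval⟩ := hasFDerivAt_scatterMajorant (ν := ν) Q hA
  have hmax : IsLocalMax (fun B => scatterCrit ν Q B - 1 / 2 * scatterMajorant ν Q A B) A := by
    filter_upwards [isOpen_PD.mem_nhds hA] with B hB
    have h1 := scatterCrit_sub_le hν Q hA hB
    rw [scatterMajorant_self Q hA]
    linarith
  have h0 := hmax.hasFDerivAt_eq_zero (hcrit.sub (hf'.const_mul (1 / 2)))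
  have hu := isUnit_det_of_mem_PD hA
  refine Sym.ext_qf fun v => ?_
  -- In the direction `Avv'A`, the two trace terms of the derivative become the quadratic forms of
  -- `A` and of `scatterMap ν Q A` at `v`.
  have hs : ((A : Matrix (Fin d) (Fin d) ℝ) * (symOuter v : Matrix (Fin d) (Fin d) ℝ) *
      (A : Matrix (Fin d) (Fin d) ℝ)) ∈ symMat d := by
    have h1 : (A : Matrix (Fin d) (Fin d) ℝ)ᵀ = A := A.2
    have h2 : (symOuter v : Matrix (Fin d) (Fin d) ℝ)ᵀ = symOuter v := (symOuter v).2
    change Matrix.transpose _ = _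
    rw [Matrix.transpose_mul, Matrix.transpose_mul, h1, h2, Matrix.mul_assoc]
  have h1 := congrArg (fun L : Sym d →L[ℝ] ℝ => L ⟨_, hs⟩) h0
  have h2 : f' ⟨_, hs⟩ = 0 := by simpa using h1
  rw [hval, sub_eq_zero, Matrix.mul_assoc, Matrix.mul_nonsing_inv _ hu, Matrix.mul_one] at h2
  rw [← symPair_symOuter, ← symPair_symOuter, symPair_eq_trace, symPair_eq_trace,
    Matrix.trace_mul_comm _ (A : Matrix (Fin d) (Fin d) ℝ), h2]
  congr 2
  change _ = (A : Matrix (Fin d) (Fin d) ℝ)⁻¹ * ((A : Matrix (Fin d) (Fin d) ℝ) *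
    (symOuter v : Matrix (Fin d) (Fin d) ℝ) * (A : Matrix (Fin d) (Fin d) ℝ)) *
    (A : Matrix (Fin d) (Fin d) ℝ)⁻¹
  rw [Matrix.mul_assoc (A : Matrix (Fin d) (Fin d) ℝ), ← Matrix.mul_assoc,
    Matrix.nonsing_inv_mul _ hu, Matrix.one_mul, Matrix.mul_assoc, Matrix.mul_nonsing_inv _ hu,
    Matrix.mul_one]

theorem isTScatter_of_fixedPoint {ν : ℝ} (hν : 0 < ν) {Q : Law d} {A : Sym d} (hA : A ∈ PD d)
    (hfix : scatterMap ν Q A = A) : IsTScatter ν Q A := by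
  refine ⟨hA, hasFDerivAt_scatterCrit_of_fixedPoint hν hA hfix, fun B hB hcrit => ?_,
    fun B hB => ?_⟩
  · by_contra hne
    have h1 := scatterCrit_lt_of_fixedPoint hν hA hfix hB hne
    have h2 := scatterCrit_lt_of_fixedPoint hν hB (fixedPoint_of_hasFDerivAt hν hB hcrit) hA
      (Ne.symm hne)
    exact lt_asymm h1 h2
  · rcases eq_or_ne B A with rfl | hne
    · rfl
    · exact (scatterCrit_lt_of_fixedPoint hν hA hfix hB hne).le

theorem tScatter_eq_of_fixedPoint {ν : ℝ} (hν : 0 < ν) {Q : Law d} {A : Sym d} (hA : A ∈ PD d)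
    (hfix : scatterMap ν Q A = A) : tScatter ν Q = A := by
  have h := isTScatter_of_fixedPoint hν hA hfix
  have hex : ∃ A, IsTScatter ν Q A := ⟨A, h⟩
  rw [tScatter, dif_pos hex]
  exact h.2.2.1 _ hex.choose_spec.1 hex.choose_spec.2.1

theorem tScatter_spec {ν : ℝ} (hν : 0 < ν) {Q : Law d} (hQ : Q ∈ U d (ν + d)) :
    tScatter ν Q ∈ PD d ∧ scatterMap ν Q (tScatter ν Q) = tScatter ν Q := by
  obtain ⟨A, hA, hfix⟩ := exists_fixedPoint hν hQ
  rw [tScatter_eq_of_fixedPoint hν hA hfix]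
  exact ⟨hA, hfix⟩

/-! ### Smooth dependence of the rational functions on the matrix -/

theorem Y.ext_toFun {δ : ℝ} {j r : ℕ} {f g : Y δ j r d} (h : ∀ x, f.toFun x = g.toFun x) : f = g :=
  Subtype.ext (funext h)

theorem Y.toFun_add {δ : ℝ} {j r : ℕ} (f g : Y δ j r d) (x : E d) :
    (f + g).toFun x = f.toFun x + g.toFun x := rfl

theorem Y.toFun_neg {δ : ℝ} {j r : ℕ} (f : Y δ j r d) (x : E d) :
    (-f).toFun x = -f.toFun x := rfl

theorem Y.toFun_sub {δ : ℝ} {j r : ℕ} (f g : Y δ j r d) (x : E d) :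
    (f - g).toFun x = f.toFun x - g.toFun x := rfl

theorem Y.toFun_smul {δ : ℝ} {j r : ℕ} (c : ℝ) (f : Y δ j r d) (x : E d) :
    (c • f).toFun x = c * f.toFun x := rfl

/-- Evaluation at a point, as a linear form on `Y`. -/
def Y.applyₗ (δ : ℝ) (j r : ℕ) (x : E d) : Y δ j r d →ₗ[ℝ] ℝ where
  toFun f := f.toFun x
  map_add' f g := Y.toFun_add f g x
  map_smul' c f := Y.toFun_smul c f x

theorem Y.toFun_sum {δ : ℝ} {j r : ℕ} {ι : Type*} (s : Finset ι) (f : ι → Y δ j r d) (x : E d) :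
    (∑ i ∈ s, f i).toFun x = ∑ i ∈ s, (f i).toFun x :=
  map_sum (Y.applyₗ δ j r x) f s

/-- The element of `Y` with the underlying function `f`. -/
def Y.mk {δ : ℝ} {j r : ℕ} (f : E d → ℝ) (hf : f ∈ Yfun δ j r d) : Y δ j r d := ⟨f, hf⟩

open Classical in
/-- The element of `Y` with a given underlying function (and `0` if there is none). -/
def Y.ofFun (δ : ℝ) (j r : ℕ) (f : E d → ℝ) : Y δ j r d :=
  if h : f ∈ Yfun δ j r d then Y.mk f h else 0

theorem isRep_of_mem_G0 {δ : ℝ} {j r : ℕ} {f : E d → ℝ} (hf : f ∈ G0 δ j r d) :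
    IsRep δ j r d f (Pi.single 0 1) (fun _ => f) := by
  refine ⟨?_, fun _ _ => hf, fun x => ?_⟩
  · exact summable_of_ne_finset_zero (s := {0}) fun s hs => by
      simp [Pi.single_eq_of_ne (Finset.notMem_singleton.1 hs)]
  · have := hasSum_single (f := fun s => (Pi.single 0 1 : ℕ → ℝ) s * f x) 0 fun s hs => by
      simp [Pi.single_eq_of_ne hs]
    simpa using this

theorem Y.toFun_ofFun {δ : ℝ} {j r : ℕ} {f : E d → ℝ} (hf : f ∈ G0 δ j r d) (x : E d) :
    (Y.ofFun δ j r f).toFun x = f x := by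
  rw [Y.ofFun, dif_pos (show f ∈ Yfun δ j r d from ⟨_, _, isRep_of_mem_G0 hf⟩)]
  rfl

theorem Y.norm_ofFun_le {δ : ℝ} {j r : ℕ} {f : E d → ℝ} (hf : f ∈ G0 δ j r d) :
    ‖Y.ofFun δ j r f‖ ≤ 1 := by
  have h : (Y.ofFun δ j r f).toFun = f := funext (Y.toFun_ofFun hf)
  have h1 : ‖Y.ofFun δ j r f‖ = starNorm δ j r d (Y.ofFun δ j r f).toFun := rfl
  rw [h1, h]
  refine (starNorm_le (isRep_of_mem_G0 hf)).trans_eq ?_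
  rw [tsum_eq_single 0 fun s hs => by simp [Pi.single_eq_of_ne hs]]
  simp

/-- `y ↦ y^n / ((1 + y'Cy)^a (1 + y'Dy)^b)`. -/
def ratFun (n : Fin d → ℕ) (a b : ℕ) (C D : Sym d) (y : E d) : ℝ :=
  (∏ i, y i ^ n i) / ((1 + qf C y) ^ a * (1 + qf D y) ^ b)

theorem ratFun_mem_G0 {δ : ℝ} {r : ℕ} {n : Fin d → ℕ} {a b : ℕ} {C D : Sym d} (hC : C ∈ W δ d)
    (hD : D ∈ W δ d) (hn : ∑ i, n i = 2 * (a + b)) (h1 : 1 ≤ a + b) (hr : a + b ≤ r) :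
    ratFun n a b C D ∈ G0 δ 2 r d := by
  refine ⟨a + b, h1, hr, n, Fin.append (fun _ => C) (fun _ => D), hn, fun s => ?_, ?_, fun x => ?_⟩
  · refine Fin.addCases (fun i => ?_) (fun i => ?_) s
    · rwa [Fin.append_left]
    · rwa [Fin.append_right]
  · have : range (Fin.append (fun _ : Fin a => C) (fun _ : Fin b => D)) ⊆ {C, D} := by
      rintro _ ⟨s, rfl⟩
      refine Fin.addCases (fun i => ?_) (fun i => ?_) s
      · rw [Fin.append_left]; exact Or.inl rfl
      · rw [Fin.append_right]; exact Or.inr rfl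
    exact (ncard_le_ncard this (toFinite _)).trans ((ncard_insert_le _ _).trans (by simp))
  · simp [ratFun, Fin.prod_univ_add]

/-- Raise the exponents of the variables `k` and `l` by one. -/
def bump (n : Fin d → ℕ) (k l : Fin d) : Fin d → ℕ := n + Pi.single k 1 + Pi.single l 1

theorem sum_bump (n : Fin d → ℕ) (k l : Fin d) : ∑ i, bump n k l i = ∑ i, n i + 2 := by
  simp [bump, Finset.sum_add_distrib]

theorem prod_bump (n : Fin d → ℕ) (k l : Fin d) (y : E d) :
    ∏ i, y i ^ bump n k l i = (∏ i, y i ^ n i) * (y k * y l) := by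
  have h : ∀ k : Fin d, ∏ i, y i ^ (Pi.single k 1 : Fin d → ℕ) i = y k := fun k => by
    rw [Finset.prod_eq_single k (fun i _ hi => by simp [Pi.single_eq_of_ne hi]) (by simp)]
    simp
  simp only [bump, Pi.add_apply, pow_add, Finset.prod_mul_distrib, h, mul_assoc]

/-- `ratFun` as an element of `Y`. -/
def ratY (δ : ℝ) (r : ℕ) (n : Fin d → ℕ) (a b : ℕ) (C D : Sym d) : Y δ 2 r d :=
  Y.ofFun δ 2 r (ratFun n a b C D)

/-- With `u = 1/(1 + y'Cy)` and `w = 1/(1 + y'Dy)` one has `u - w = y'(D-C)y · uw`, and `u^m - w^m`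
is a geometric sum times `u - w`. Expanding `y'(D-C)y` into entries raises the degree of the
monomial by two and that of the denominator by one factor, so the terms stay in `𝒢`; since only `C`
and `D` occur, two different matrices suffice. -/
theorem ratY_sub {δ : ℝ} {r : ℕ} {n : Fin d → ℕ} {a m : ℕ} {C D : Sym d} (hC : C ∈ W δ d)
    (hD : D ∈ W δ d) (hn : ∑ i, n i = 2 * (a + m)) (h1 : 1 ≤ a + m) (hr : a + m + 1 ≤ r) :
    ratY δ r n a m C D - ratY δ r n (a + m) 0 C C =
      -∑ t ∈ Finset.range m, ∑ k, ∑ l, ((D - C : Sym d) : Matrix (Fin d) (Fin d) ℝ) k l •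
        ratY δ r (bump n k l) (a + t + 1) (m - t) C D := by
  refine Y.ext_toFun fun y => ?_
  rw [Y.toFun_sub, Y.toFun_neg, Y.toFun_sum]
  simp only [Y.toFun_sum, Y.toFun_smul, ratY]
  rw [Y.toFun_ofFun (ratFun_mem_G0 hC hD hn h1 (by omega)),
    Y.toFun_ofFun (ratFun_mem_G0 hC hC (by simpa using hn) (by omega) (by omega))]
  have hterm : ∀ t ∈ Finset.range m, ∑ k, ∑ l, ((D - C : Sym d) : Matrix (Fin d) (Fin d) ℝ) k l *
      (Y.ofFun δ 2 r (ratFun (bump n k l) (a + t + 1) (m - t) C D)).toFun y =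
      qf (D - C) y * ((∏ i, y i ^ n i) / ((1 + qf C y) ^ (a + t + 1) * (1 + qf D y) ^ (m - t))) := by
    intro t ht
    have ht' := Finset.mem_range.1 ht
    rw [qf_eq_sum, Finset.sum_mul]
    refine Finset.sum_congr rfl fun k _ => ?_
    rw [Finset.sum_mul]
    refine Finset.sum_congr rfl fun l _ => ?_
    rw [Y.toFun_ofFun (ratFun_mem_G0 hC hD (by rw [sum_bump, hn]; omega) (by omega) (by omega)),
      ratFun, prod_bump]
    ring
  rw [Finset.sum_congr rfl hterm, ← Finset.mul_sum, qf_sub]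
  have hpC : 1 + qf C y ≠ 0 := by have := qf_nonneg hC.1 y; positivity
  have hpD : 1 + qf D y ≠ 0 := by have := qf_nonneg hD.1 y; positivity
  set P := ∏ i, y i ^ n i with hP
  have hx : ∀ (i j : ℕ), P / ((1 + qf C y) ^ i * (1 + qf D y) ^ j) =
      P * ((1 + qf C y)⁻¹ ^ i * (1 + qf D y)⁻¹ ^ j) := fun i j => by
    rw [div_eq_mul_inv, mul_inv, inv_pow, inv_pow]
  have hx' : ∀ i : ℕ, P / ((1 + qf C y) ^ i * (1 + qf C y) ^ 0) = P * (1 + qf C y)⁻¹ ^ i :=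
    fun i => by rw [pow_zero, mul_one, div_eq_mul_inv, inv_pow]
  simp only [ratFun, ← hP, hx, hx']
  set u := (1 + qf C y)⁻¹ with hu
  set w := (1 + qf D y)⁻¹ with hw
  have hwu : (qf D y - qf C y) * (w * u) = u - w := by
    rw [hu, hw]
    field_simp
    ring
  have hgeom := (Commute.all u w).mul_geom_sum₂ m
  have hsum : ∑ t ∈ Finset.range m, P * (u ^ (a + t + 1) * w ^ (m - t)) =
      P * u ^ a * (w * u) * ∑ t ∈ Finset.range m, u ^ t * w ^ (m - 1 - t) := by
    rw [Finset.mul_sum]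
    refine Finset.sum_congr rfl fun t ht => ?_
    have : m - t = m - 1 - t + 1 := by have := Finset.mem_range.1 ht; omega
    rw [this]
    ring
  rw [hsum]
  calc P * (u ^ a * w ^ m) - P * u ^ (a + m) = -(P * u ^ a * (u ^ m - w ^ m)) := by ring
    _ = -(P * u ^ a * (((qf D y - qf C y) * (w * u)) *
        ∑ t ∈ Finset.range m, u ^ t * w ^ (m - 1 - t))) := by rw [hwu, hgeom]
    _ = _ := by ring

/-- A constant with `∑ |A k l| ≤ c ‖A‖`. -/
def entryBound (d : ℕ) : ℝ := ∑ k, ∑ l, ‖entryL (d := d) k l‖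

theorem entryBound_nonneg (d : ℕ) : 0 ≤ entryBound d :=
  Finset.sum_nonneg fun _ _ => Finset.sum_nonneg fun k _ =>
    ContinuousLinearMap.opNorm_nonneg (entryL _ k)

theorem norm_sum_entry_smul_le {Z : Type*} [NormedAddCommGroup Z] [NormedSpace ℝ Z] (A : Sym d)
    (f : Fin d → Fin d → Z) {K : ℝ} (hf : ∀ k l, ‖f k l‖ ≤ K) :
    ‖∑ k, ∑ l, (A : Matrix (Fin d) (Fin d) ℝ) k l • f k l‖ ≤ entryBound d * ‖A‖ * K := by
  rw [entryBound, Finset.sum_mul, Finset.sum_mul]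
  refine (norm_sum_le _ _).trans (Finset.sum_le_sum fun k _ => ?_)
  rw [Finset.sum_mul, Finset.sum_mul]
  refine (norm_sum_le _ _).trans (Finset.sum_le_sum fun l _ => ?_)
  rw [norm_smul]
  exact mul_le_mul ((entryL k l).le_opNorm A) (hf k l) (norm_nonneg _) (by positivity)

/-- Every function in the telescoped sum belongs to `𝒢`, hence has norm at most `1`; only the
entries of `D - C` matter. -/
theorem norm_ratY_sub_le {δ : ℝ} {r : ℕ} {n : Fin d → ℕ} {a m : ℕ} {C D : Sym d} (hC : C ∈ W δ d)
    (hD : D ∈ W δ d) (hn : ∑ i, n i = 2 * (a + m)) (h1 : 1 ≤ a + m) (hr : a + m + 1 ≤ r) :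
    ‖ratY δ r n a m C D - ratY δ r n (a + m) 0 C C‖ ≤ m * (entryBound d * ‖D - C‖) := by
  rw [ratY_sub hC hD hn h1 hr, norm_neg]
  refine (norm_sum_le_of_le (f := fun t => ∑ k, ∑ l,
    ((D - C : Sym d) : Matrix (Fin d) (Fin d) ℝ) k l •
      ratY δ r (bump n k l) (a + t + 1) (m - t) C D) (Finset.range m)
    (n := fun _ => entryBound d * ‖D - C‖ * 1) fun t ht => ?_).trans_eq (by simp)
  have ht' := Finset.mem_range.1 ht
  exact norm_sum_entry_smul_le _ _ fun k l => Y.norm_ofFun_le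
    (ratFun_mem_G0 hC hD (by rw [sum_bump, hn]; omega) (by omega) (by omega))

/-- The map `C ↦ y^n / (1 + y'Cy)^v` into `Y`. -/
def powY (δ : ℝ) (r : ℕ) (n : Fin d → ℕ) (v : ℕ) (C : Sym d) : Y δ 2 r d := ratY δ r n v 0 C C

theorem powY_eq {δ : ℝ} {r : ℕ} (n : Fin d → ℕ) (v : ℕ) (C D : Sym d) :
    powY δ r n v D = ratY δ r n 0 v C D := by
  rw [powY, ratY, ratY]
  congr 1
  funext y
  simp [ratFun]

/-- The derivative of `powY`. -/
def powY' (δ : ℝ) (r : ℕ) (n : Fin d → ℕ) (v : ℕ) (C : Sym d) : Sym d →L[ℝ] Y δ 2 r d :=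
  -(v : ℝ) • ∑ k, ∑ l, (entryL k l).smulRight (powY δ r (bump n k l) (v + 1) C)

theorem powY'_apply (δ : ℝ) (r : ℕ) (n : Fin d → ℕ) (v : ℕ) (C D : Sym d) :
    powY' δ r n v C D = -(v : ℝ) • ∑ k, ∑ l, (D : Matrix (Fin d) (Fin d) ℝ) k l •
      powY δ r (bump n k l) (v + 1) C := by
  simp [powY']

/-- Telescoping twice makes the remainder quadratic in `D - C`. The second use produces `v + 2`
factors in the denominator, whence `v + 2 ≤ r`. -/
theorem hasFDerivAt_powY {δ : ℝ} {r : ℕ} {n : Fin d → ℕ} {v : ℕ} {C : Sym d} (hC : C ∈ W δ d)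
    (hn : ∑ i, n i = 2 * v) (hv : 1 ≤ v) (hr : v + 2 ≤ r) :
    HasFDerivAt (powY δ r n v) (powY' δ r n v C) C := by
  have hbound : ∀ D ∈ W δ d, ‖powY δ r n v D - powY δ r n v C - powY' δ r n v C (D - C)‖ ≤
      v * (entryBound d * (v * entryBound d)) * ‖D - C‖ ^ 2 := by
    intro D hD
    have e1 : powY δ r n v D - powY δ r n v C =
        -∑ t ∈ Finset.range v, ∑ k, ∑ l, ((D - C : Sym d) : Matrix (Fin d) (Fin d) ℝ) k l •
          ratY δ r (bump n k l) (0 + t + 1) (v - t) C D := by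
      have := ratY_sub (a := 0) (m := v) hC hD (by simpa using hn) (by omega)
        (show 0 + v + 1 ≤ r by omega)
      rw [← powY_eq, Nat.zero_add] at this
      exact this
    have e2 : powY' δ r n v C (D - C) =
        -∑ t ∈ Finset.range v, ∑ k, ∑ l, ((D - C : Sym d) : Matrix (Fin d) (Fin d) ℝ) k l •
          powY δ r (bump n k l) (v + 1) C := by
      rw [powY'_apply, Finset.sum_const, Finset.card_range, neg_smul, Nat.cast_smul_eq_nsmul]
    -- The derivative is the first telescoped sum with every `D` in a denominator replaced by `C`;
    -- the differences are of the kind bounded by `norm_ratY_sub_le`.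
    have e3 : powY δ r n v D - powY δ r n v C - powY' δ r n v C (D - C) =
        -∑ t ∈ Finset.range v, ∑ k, ∑ l, ((D - C : Sym d) : Matrix (Fin d) (Fin d) ℝ) k l •
          (ratY δ r (bump n k l) (0 + t + 1) (v - t) C D - powY δ r (bump n k l) (v + 1) C) := by
      rw [e1, e2]
      simp only [smul_sub, Finset.sum_sub_distrib]
      abel
    rw [e3, norm_neg]
    refine (norm_sum_le_of_le (f := fun t => ∑ k, ∑ l,
      ((D - C : Sym d) : Matrix (Fin d) (Fin d) ℝ) k l •
        (ratY δ r (bump n k l) (0 + t + 1) (v - t) C D - powY δ r (bump n k l) (v + 1) C))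
      (Finset.range v)
      (n := fun _ => entryBound d * ‖D - C‖ * (v * (entryBound d * ‖D - C‖)))
      fun t ht => ?_).trans_eq (by simp; ring)
    have ht' := Finset.mem_range.1 ht
    refine norm_sum_entry_smul_le _ _ fun k l => ?_
    have e4 : v + 1 = 0 + t + 1 + (v - t) := by omega
    rw [powY, e4]
    refine (norm_ratY_sub_le hC hD (by rw [sum_bump, hn]; omega) (by omega) (by omega)).trans ?_
    have : ((v - t : ℕ) : ℝ) ≤ v := by exact_mod_cast Nat.sub_le v t
    exact mul_le_mul_of_nonneg_right this (mul_nonneg (entryBound_nonneg d) (norm_nonneg _))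
  have hO : (fun D => powY δ r n v D - powY δ r n v C - powY' δ r n v C (D - C)) =O[nhds C]
      fun D => ‖D - C‖ ^ 2 := by
    refine Asymptotics.IsBigO.of_bound (v * (entryBound d * (v * entryBound d))) ?_
    filter_upwards [(isOpen_W δ).mem_nhds hC] with D hD
    simpa using hbound D hD
  rw [hasFDerivAt_iff_isLittleO]
  refine hO.trans_isLittleO ?_
  exact Asymptotics.isLittleO_pow_sub_sub C one_lt_two

/-- The derivative is a combination of functions `powY` with `v + 1` in place of `v`, so the
induction trades an order of differentiability for a factor; the final `+ 1` pays for continuity. -/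
theorem contDiffOn_powY {δ : ℝ} {r : ℕ} (m : ℕ) : ∀ {n : Fin d → ℕ} {v : ℕ},
    ∑ i, n i = 2 * v → 1 ≤ v → v + m + 1 ≤ r → ContDiffOn ℝ m (powY δ r n v) (W δ d) := by
  induction m with
  | zero =>
    intro n v hn hv hr
    refine contDiffOn_zero.2 fun C hC => ContinuousAt.continuousWithinAt ?_
    rw [ContinuousAt, tendsto_iff_norm_sub_tendsto_zero]
    have hlim : Filter.Tendsto (fun D : Sym d => v * (entryBound d * ‖D - C‖)) (nhds C)
        (nhds 0) := by
      have : Continuous fun D : Sym d => v * (entryBound d * ‖D - C‖) := by fun_prop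
      simpa using this.tendsto C
    refine squeeze_zero' (Filter.Eventually.of_forall fun _ => norm_nonneg _) ?_ hlim
    filter_upwards [(isOpen_W δ).mem_nhds hC] with D hD
    have := norm_ratY_sub_le (a := 0) (m := v) hC hD (by simpa using hn) (by omega)
      (show 0 + v + 1 ≤ r by omega)
    rwa [← powY_eq, Nat.zero_add] at this
  | succ m ih =>
    intro n v hn hv hr
    rw [show ((m + 1 : ℕ) : WithTop ℕ∞) = (m : WithTop ℕ∞) + 1 by push_cast; rfl,
      contDiffOn_succ_iff_hasFDerivWithinAt_of_uniqueDiffOn (isOpen_W δ).uniqueDiffOn]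
    refine ⟨by simp, powY' δ r n v, ?_, fun C hC =>
      (hasFDerivAt_powY hC hn hv (by omega)).hasFDerivWithinAt⟩
    unfold powY'
    refine ContDiffOn.const_smul _ (ContDiffOn.sum fun k _ => ContDiffOn.sum fun l _ => ?_)
    have h := ih (n := bump n k l) (v := v + 1) (by rw [sum_bump, hn]; ring) (by omega) (by omega)
    exact contDiffOn_const.smulRight h

/-! ### Smoothness of `F` -/

/-- The constant function `1` in `ℝ ⊕ Y`. -/
def RY.one (δ : ℝ) (j r d : ℕ) : RY δ j r d := WithLp.toLp 1 (1, 0)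

/-- The inclusion of `Y` into `ℝ ⊕ Y`. -/
def RY.inr (δ : ℝ) (j r d : ℕ) : Y δ j r d →L[ℝ] RY δ j r d :=
  ((WithLp.prodContinuousLinearEquiv 1 ℝ ℝ (Y δ j r d)).symm :
    ℝ × Y δ j r d →L[ℝ] RY δ j r d).comp (ContinuousLinearMap.inr ℝ ℝ (Y δ j r d))

theorem RY.inr_apply {δ : ℝ} {j r : ℕ} (f : Y δ j r d) :
    RY.inr δ j r d f = WithLp.toLp 1 (0, f) := rfl

theorem phi_apply (δ : ℝ) (r : ℕ) (ν : ℝ) (Q : Law d) (p : RY (scale δ ν) 2 r d) :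
    phi δ r ν Q p = p.fst + ∫ x, p.snd.toFun x ∂(Q : Measure (E d)) := rfl

theorem phi_one (δ : ℝ) (r : ℕ) (ν : ℝ) (Q : Law d) :
    phi δ r ν Q (RY.one (scale δ ν) 2 r d) = 1 := by
  rw [phi_apply]
  have : ∀ x, (RY.one (scale δ ν) 2 r d).snd.toFun x = 0 := fun x => rfl
  simp only [this, integral_zero, add_zero]
  rfl

theorem phi_inr (δ : ℝ) (r : ℕ) (ν : ℝ) (Q : Law d) (f : Y (scale δ ν) 2 r d) :
    phi δ r ν Q (RY.inr (scale δ ν) 2 r d f) = ∫ x, f.toFun x ∂(Q : Measure (E d)) := by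
  rw [phi_apply, RY.inr_apply]
  exact zero_add _

theorem symInv_mem_W {δ : ℝ} {A : Sym d} (hA : A ∈ W δ d) : symInv A ∈ W δ d := by
  refine ⟨symInv_mem_PD hA.1, ?_⟩
  rw [← coe_symInv (symInv A), symInv_symInv hA.1, max_comm]
  exact hA.2

/-- An explicit representative removes the choice in `dualApply`. Factoring `ν` out of the
denominator gives the matrix `A⁻¹/ν`, which lies in `𝒲` for the rescaled parameter. -/
theorem F_apply {ν δ : ℝ} (hν : 0 < ν) {r : ℕ} (hr : 1 ≤ r) (φ : X δ r ν d) {A : Sym d}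
    (hA : A ∈ W δ d) (i j : Fin d) : (F ν δ r φ A : Matrix (Fin d) (Fin d) ℝ) i j =
      φ ((-(1 / 2 : ℝ) * (A : Matrix (Fin d) (Fin d) ℝ) i j) • RY.one (scale δ ν) 2 r d +
        ((ν + d) / (2 * ν)) • RY.inr (scale δ ν) 2 r d
          (powY (scale δ ν) r (bump 0 i j) 1 (ν⁻¹ • symInv A))) := by
  refine dualApply_eq φ _ fun y => ?_
  have hC := smul_symInv_mem_W hν hA
  have h1 : ((-(1 / 2 : ℝ) * (A : Matrix (Fin d) (Fin d) ℝ) i j) • RY.one (scale δ ν) 2 r d +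
        ((ν + d) / (2 * ν)) • RY.inr (scale δ ν) 2 r d
          (powY (scale δ ν) r (bump 0 i j) 1 (ν⁻¹ • symInv A))).fst =
      -(1 / 2 : ℝ) * (A : Matrix (Fin d) (Fin d) ℝ) i j := by
    simp [RY.one, RY.inr_apply]
  have h2 : ((-(1 / 2 : ℝ) * (A : Matrix (Fin d) (Fin d) ℝ) i j) • RY.one (scale δ ν) 2 r d +
        ((ν + d) / (2 * ν)) • RY.inr (scale δ ν) 2 r d
          (powY (scale δ ν) r (bump 0 i j) 1 (ν⁻¹ • symInv A))).snd =
      ((ν + d) / (2 * ν)) • powY (scale δ ν) r (bump 0 i j) 1 (ν⁻¹ • symInv A) := by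
    simp [RY.one, RY.inr_apply]
  rw [h1, h2, Y.toFun_smul, powY, ratY,
    Y.toFun_ofFun (ratFun_mem_G0 hC hC (by simp [sum_bump]) (by omega) (by omega)), ratFun,
    prod_bump, qf_smul]
  have h3 := qf_nonneg (symInv_mem_PD hA.1) y
  simp only [G, Matrix.add_apply, Matrix.smul_apply, Matrix.vecMulVec_apply, smul_eq_mul,
    Pi.zero_apply, pow_zero, Finset.prod_const_one, one_mul, pow_one, mul_one]
  congr 1
  have h4 : ν + qf (symInv A) y ≠ 0 := by positivity
  have h5 : 1 + ν⁻¹ * qf (symInv A) y ≠ 0 := by positivity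
  field_simp

/-- Evaluation is bilinear and bounded in the functional and its argument, so only the dependence of
the argument on `A` has to be smooth. -/
theorem contDiffOn_F {ν δ : ℝ} (hν : 0 < ν) (k : ℕ) :
    ContDiffOn ℝ k (fun p : X δ (k + 2) ν d × Sym d => F ν δ (k + 2) p.1 p.2)
      (univ ×ˢ W δ d) := by
  intro p hp
  refine contDiffWithinAt_sym fun i j => ?_
  have hpow : ContDiffOn ℝ k (fun p : X δ (k + 2) ν d × Sym d =>
      powY (scale δ ν) (k + 2) (bump 0 i j) 1 (ν⁻¹ • symInv p.2)) (univ ×ˢ W δ d) := by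
    refine (contDiffOn_powY (δ := scale δ ν) (r := k + 2) k (n := bump (0 : Fin d → ℕ) i j) (v := 1)
      (by simp [sum_bump]) le_rfl (by omega)).comp ?_ fun q hq => smul_symInv_mem_W hν hq.2
    intro q hq
    exact (((contDiffAt_symInv hq.2.1).comp q contDiffAt_snd).const_smul ν⁻¹).contDiffWithinAt
  have hent : ContDiffOn ℝ k (fun p : X δ (k + 2) ν d × Sym d =>
      (p.2 : Matrix (Fin d) (Fin d) ℝ) i j) (univ ×ˢ W δ d) :=
    ((entryL i j).contDiff.comp contDiff_snd).contDiffOn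
  have hmain : ContDiffOn ℝ k (fun p : X δ (k + 2) ν d × Sym d =>
      p.1 ((-(1 / 2 : ℝ) * (p.2 : Matrix (Fin d) (Fin d) ℝ) i j) •
        RY.one (scale δ ν) 2 (k + 2) d +
        ((ν + d) / (2 * ν)) • RY.inr (scale δ ν) 2 (k + 2) d
          (powY (scale δ ν) (k + 2) (bump 0 i j) 1 (ν⁻¹ • symInv p.2)))) (univ ×ˢ W δ d) := by
    refine contDiff_fst.contDiffOn.clm_apply (ContDiffOn.add ?_ ?_)
    · exact (contDiffOn_const.mul hent).smul contDiffOn_const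
    · exact ((RY.inr (scale δ ν) 2 (k + 2) d).contDiff.comp_contDiffOn hpow).const_smul _
  exact (hmain p hp).congr (fun q hq => F_apply hν (by omega) q.1 hq.2 i j)
    (F_apply hν (by omega) p.1 hp.2 i j)

theorem F_phi {ν δ : ℝ} (hν : 0 < ν) {r : ℕ} (hr : 1 ≤ r) (Q : Law d) {A : Sym d}
    (hA : A ∈ W δ d) : F ν δ r (phi δ r ν Q) A = (1 / 2 : ℝ) • (scatterMap ν Q A - A) := by
  refine Subtype.ext ?_
  ext i j
  have hC := smul_symInv_mem_W hν hA
  rw [F_apply hν hr _ hA, map_add, map_smul, map_smul, phi_one, phi_inr]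
  change _ = (1 / 2 : ℝ) * ((scatterMap ν Q A : Matrix (Fin d) (Fin d) ℝ) i j -
    (A : Matrix (Fin d) (Fin d) ℝ) i j)
  have h : ∀ y : E d, (powY (scale δ ν) r (bump 0 i j) 1 (ν⁻¹ • symInv A)).toFun y =
      ν * (y i * y j / (ν + qf (symInv A) y)) := fun y => by
    rw [powY, ratY, Y.toFun_ofFun (ratFun_mem_G0 hC hC (by simp [sum_bump]) (by omega) (by omega)),
      ratFun, prod_bump, qf_smul]
    have h3 := qf_nonneg (symInv_mem_PD hA.1) y
    simp only [Pi.zero_apply, pow_zero, Finset.prod_const_one, one_mul, pow_one, mul_one]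
    have h4 : ν + qf (symInv A) y ≠ 0 := by positivity
    have h5 : 1 + ν⁻¹ * qf (symInv A) y ≠ 0 := by positivity
    field_simp
  simp only [h, integral_const_mul, scatterMap_apply, smul_eq_mul]
  field_simp
  ring

/-! ### The derivative of the scatter equation and the implicit function -/

/-- The symmetric matrix `DAD`. -/
def symConj (D A : Sym d) : Sym d :=
  ⟨(D : Matrix (Fin d) (Fin d) ℝ) * (A : Matrix (Fin d) (Fin d) ℝ) * (D : Matrix (Fin d) (Fin d) ℝ),
    by
      have h1 : (A : Matrix (Fin d) (Fin d) ℝ)ᵀ = A := A.2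
      have h2 : (D : Matrix (Fin d) (Fin d) ℝ)ᵀ = D := D.2
      change Matrix.transpose _ = _
      rw [Matrix.transpose_mul, Matrix.transpose_mul, h1, h2, Matrix.mul_assoc]⟩

theorem qf_symConj (D A : Sym d) (y : E d) :
    qf (symConj D A) y = qf A (WithLp.toLp 2 ((D : Matrix (Fin d) (Fin d) ℝ) *ᵥ y.ofLp)) := by
  change y.ofLp ⬝ᵥ (((D : Matrix (Fin d) (Fin d) ℝ) * (A : Matrix (Fin d) (Fin d) ℝ) *
    (D : Matrix (Fin d) (Fin d) ℝ)) *ᵥ y.ofLp) = _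
  rw [← Matrix.mulVec_mulVec, ← Matrix.mulVec_mulVec, Sym.dotProduct_mulVec_comm, dotProduct_comm]
  rfl

theorem symPair_symConj (D A : Sym d) : symPair D (symConj A D) = symPair (symConj D A) A := by
  rw [symPair_eq_trace, symPair_eq_trace]
  change Matrix.trace ((D : Matrix (Fin d) (Fin d) ℝ) * ((A : Matrix (Fin d) (Fin d) ℝ) *
    (D : Matrix (Fin d) (Fin d) ℝ) * (A : Matrix (Fin d) (Fin d) ℝ))) =
    Matrix.trace ((D : Matrix (Fin d) (Fin d) ℝ) * (A : Matrix (Fin d) (Fin d) ℝ) *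
    (D : Matrix (Fin d) (Fin d) ℝ) * (A : Matrix (Fin d) (Fin d) ℝ))
  simp only [Matrix.mul_assoc]

theorem integrable_mul_qf_div_sq {ν : ℝ} (hν : 0 < ν) (Q : Law d) {A : Sym d} (hA : A ∈ PD d)
    (M N : Sym d) : Integrable (fun y => qf M y * qf N y / (ν + qf (symInv A) y) ^ 2)
      (Q : Measure (E d)) := by
  obtain ⟨c, hc, h⟩ := exists_pos_mul_sq_le_qf (symInv_mem_PD hA)
  have hb : ∀ (M : Sym d) (y : E d), ‖qf M y / (ν + qf (symInv A) y)‖ ≤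
      ‖(M : Matrix (Fin d) (Fin d) ℝ)‖ / c := fun M y => by
    have hp := add_qf_symInv_pos hν hA y
    rw [Real.norm_eq_abs, abs_div, abs_of_pos hp, div_le_div_iff₀ hp hc]
    have h1 := mul_le_mul_of_nonneg_right (abs_qf_le M y) hc.le
    have h2 := mul_le_mul_of_nonneg_left (h y) (norm_nonneg (M : Matrix (Fin d) (Fin d) ℝ))
    have h3 := mul_nonneg (norm_nonneg (M : Matrix (Fin d) (Fin d) ℝ)) hν.le
    linarith
  have e : ∀ y, qf M y * qf N y / (ν + qf (symInv A) y) ^ 2 =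
      qf M y / (ν + qf (symInv A) y) * (qf N y / (ν + qf (symInv A) y)) := fun y => by
    rw [div_mul_div_comm, sq]
  simp only [e]
  exact (integrable_qf_div hν Q hA N).bdd_mul (c := ‖(M : Matrix (Fin d) (Fin d) ℝ)‖ / c)
    (integrable_qf_div hν Q hA M).aestronglyMeasurable (Filter.Eventually.of_forall (hb M))

theorem contDiffAt_F_symInv {ν δ : ℝ} (hν : 0 < ν) (k : ℕ) (φ : X δ (k + 2) ν d)
    {C : Sym d} (hC : C ∈ W δ d) :
    ContDiffAt ℝ k (fun p : X δ (k + 2) ν d × Sym d => F ν δ (k + 2) p.1 (symInv p.2)) (φ, C) := by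
  have h1 : ContDiffAt ℝ k (fun p : X δ (k + 2) ν d × Sym d => F ν δ (k + 2) p.1 p.2)
      (φ, symInv C) :=
    (contDiffOn_F hν k).contDiffAt
      ((isOpen_univ.prod (isOpen_W δ)).mem_nhds ⟨mem_univ _, symInv_mem_W hC⟩)
  have h2 : ContDiffAt ℝ k (fun p : X δ (k + 2) ν d × Sym d => (p.1, symInv p.2)) (φ, C) :=
    contDiffAt_fst.prodMk ((contDiffAt_symInv hC.1).comp (φ, C) contDiffAt_snd)
  exact ContDiffAt.comp (φ, C) h1 h2

/-- The derivative of `C ↦ F(φ_Q, C⁻¹)`. -/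
theorem fderiv_F_symInv_apply {ν δ : ℝ} (hν : 0 < ν) {r : ℕ} (hr : 3 ≤ r) (Q : Law d) {A : Sym d}
    (hA : A ∈ W δ d) {L : Sym d →L[ℝ] Sym d}
    (hL : HasFDerivAt (fun C : Sym d => F ν δ r (phi δ r ν Q) (symInv C)) L (symInv A))
    (D : Sym d) (i j : Fin d) : (L D : Matrix (Fin d) (Fin d) ℝ) i j =
      1 / 2 * (symConj A D : Matrix (Fin d) (Fin d) ℝ) i j -
      (ν + d) / 2 * ∫ y, y i * y j * qf D y / (ν + qf (symInv A) y) ^ 2 ∂(Q : Measure (E d)) := by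
  have hC := smul_symInv_mem_W hν hA
  have hC0 : symInv A ∈ W δ d := symInv_mem_W hA
  let l : Matrix (Fin d) (Fin d) ℝ →L[ℝ] ℝ :=
    LinearMap.toContinuousLinearMap (Matrix.entryLinearMap ℝ ℝ i j)
  let c : Y (scale δ ν) 2 r d →L[ℝ] ℝ := (phi δ r ν Q).comp (RY.inr (scale δ ν) 2 r d)
  have h1 : HasFDerivAt (fun C : Sym d => l (C : Matrix (Fin d) (Fin d) ℝ)⁻¹) _ (symInv A) :=
    l.hasFDerivAt.comp (symInv A) (hasFDerivAt_inv hC0.1)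
  have h2 : HasFDerivAt (fun C : Sym d => c (powY (scale δ ν) r (bump 0 i j) 1 (ν⁻¹ • C)))
      (c.comp ((powY' (scale δ ν) r (bump 0 i j) 1 (ν⁻¹ • symInv A)).comp
        (ν⁻¹ • ContinuousLinearMap.id ℝ (Sym d)))) (symInv A) := by
    refine c.hasFDerivAt.comp (symInv A) (HasFDerivAt.comp (symInv A)
      (hasFDerivAt_powY hC (by simp [sum_bump]) le_rfl (by omega)) ?_)
    exact (hasFDerivAt_id (symInv A)).const_smul ν⁻¹
  have h3 := (h1.const_mul (-(1 / 2 : ℝ))).add (h2.const_mul ((ν + d) / (2 * ν)))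
  have h4 : HasFDerivAt (fun C : Sym d => (F ν δ r (phi δ r ν Q) (symInv C) :
      Matrix (Fin d) (Fin d) ℝ) i j) ((entryL i j).comp L) (symInv A) :=
    (entryL i j).hasFDerivAt.comp (symInv A) hL
  have h5 : (fun C : Sym d => (F ν δ r (phi δ r ν Q) (symInv C) : Matrix (Fin d) (Fin d) ℝ) i j)
      =ᶠ[nhds (symInv A)] fun C => -(1 / 2 : ℝ) * l (C : Matrix (Fin d) (Fin d) ℝ)⁻¹ +
        (ν + d) / (2 * ν) * c (powY (scale δ ν) r (bump 0 i j) 1 (ν⁻¹ • C)) := by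
    filter_upwards [(isOpen_W δ).mem_nhds hC0] with C hCW
    rw [F_apply hν (by omega) _ (symInv_mem_W hCW), symInv_symInv hCW.1, map_add, map_smul,
      map_smul, phi_one]
    simp only [smul_eq_mul, mul_one]
    rfl
  -- Uniqueness of derivatives identifies the entries of the given `L` with the explicit formula.
  have h6 := (h4.congr_of_eventuallyEq h5.symm).unique h3
  have h7 := congrArg (fun T : Sym d →L[ℝ] ℝ => T D) h6
  have hInt : ∀ k m : Fin d, c (powY (scale δ ν) r (bump (bump 0 i j) k m) 2 (ν⁻¹ • symInv A)) =
      ν ^ 2 * ∫ y, y i * y j * (y k * y m) / (ν + qf (symInv A) y) ^ 2 ∂(Q : Measure (E d)) := by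
    intro k m
    change phi δ r ν Q (RY.inr (scale δ ν) 2 r d _) = _
    rw [phi_inr, ← integral_const_mul]
    refine integral_congr_ae (Filter.Eventually.of_forall fun y => ?_)
    simp only [powY, ratY]
    rw [Y.toFun_ofFun (ratFun_mem_G0 hC hC (by simp [sum_bump]) (by omega) (by omega)), ratFun,
      prod_bump, prod_bump, qf_smul]
    have h3 := qf_nonneg (symInv_mem_PD hA.1) y
    simp only [Pi.zero_apply, pow_zero, Finset.prod_const_one, one_mul, mul_one]
    have h4 : ν + qf (symInv A) y ≠ 0 := by positivity
    have h5 : 1 + ν⁻¹ * qf (symInv A) y ≠ 0 := by positivity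
    field_simp
  have hsum : ∫ y, y i * y j * qf D y / (ν + qf (symInv A) y) ^ 2 ∂(Q : Measure (E d)) =
      ∑ k, ∑ m, (D : Matrix (Fin d) (Fin d) ℝ) k m *
        ∫ y, y i * y j * (y k * y m) / (ν + qf (symInv A) y) ^ 2 ∂(Q : Measure (E d)) := by
    have hi : ∀ k m, Integrable (fun y : E d => (D : Matrix (Fin d) (Fin d) ℝ) k m *
        (y i * y j * (y k * y m) / (ν + qf (symInv A) y) ^ 2)) (Q : Measure (E d)) := fun k m => by
      have := integrable_mul_qf_div_sq hν Q hA.1 (symUnit i j) (symUnit k m)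
      simp only [qf_symUnit] at this
      exact this.const_mul _
    have he : ∀ y : E d, y i * y j * qf D y / (ν + qf (symInv A) y) ^ 2 =
        ∑ k, ∑ m, (D : Matrix (Fin d) (Fin d) ℝ) k m *
          (y i * y j * (y k * y m) / (ν + qf (symInv A) y) ^ 2) := fun y => by
      rw [qf_eq_sum, Finset.mul_sum, Finset.sum_div]
      refine Finset.sum_congr rfl fun k _ => ?_
      rw [Finset.mul_sum, Finset.sum_div]
      exact Finset.sum_congr rfl fun m _ => by ring
    rw [integral_congr_ae (Filter.Eventually.of_forall he),
      integral_finsetSum _ fun k _ => integrable_finsetSum _ fun m _ => hi k m]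
    refine Finset.sum_congr rfl fun k _ => ?_
    rw [integral_finsetSum _ fun m _ => hi k m]
    exact Finset.sum_congr rfl fun m _ => integral_const_mul _ _
  have hAA : (symInv A : Matrix (Fin d) (Fin d) ℝ)⁻¹ = A := by
    rw [← coe_symInv (symInv A), symInv_symInv hA.1]
  -- The factor `-ν` combines the `ν²` of `hInt`, the chain rule factor `ν⁻¹` and the sign in
  -- `powY'`.
  have e2 : c (powY' (scale δ ν) r (bump 0 i j) 1 (ν⁻¹ • symInv A) (ν⁻¹ • D)) =
      -ν * ∫ y, y i * y j * qf D y / (ν + qf (symInv A) y) ^ 2 ∂(Q : Measure (E d)) := by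
    rw [map_smul, map_smul, powY'_apply, map_smul, map_sum, hsum]
    simp only [map_sum, map_smul, hInt, smul_eq_mul, Finset.mul_sum]
    refine Finset.sum_congr rfl fun k _ => Finset.sum_congr rfl fun m _ => ?_
    field_simp
    simp
  have e3 : l (((-(ContinuousLinearMap.mulLeftRight ℝ (Matrix (Fin d) (Fin d) ℝ)
      (symInv A : Matrix (Fin d) (Fin d) ℝ)⁻¹ (symInv A : Matrix (Fin d) (Fin d) ℝ)⁻¹)).comp
        (symMat d).subtypeL) D) = -(symConj A D : Matrix (Fin d) (Fin d) ℝ) i j := by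
    rw [hAA]
    rfl
  have e4 : (L D : Matrix (Fin d) (Fin d) ℝ) i j =
      -(1 / 2 : ℝ) * -(symConj A D : Matrix (Fin d) (Fin d) ℝ) i j + (ν + d) / (2 * ν) *
        (-ν * ∫ y, y i * y j * qf D y / (ν + qf (symInv A) y) ^ 2 ∂(Q : Measure (E d))) := by
    rw [← e3, ← e2]
    exact h7
  rw [e4]
  field_simp
  ring

/-- The quadratic form of the derivative of `C ↦ F(φ_Q, C⁻¹)` at a solution of the scatter equation
is positive definite. -/
theorem symPair_fderiv_pos {ν δ : ℝ} (hν : 0 < ν) {r : ℕ} (hr : 3 ≤ r) {Q : Law d}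
    (hQ : Q ∈ U d (ν + d)) {A : Sym d} (hA : A ∈ W δ d) (hfix : scatterMap ν Q A = A)
    {L : Sym d →L[ℝ] Sym d}
    (hL : HasFDerivAt (fun C : Sym d => F ν δ r (phi δ r ν Q) (symInv C)) L (symInv A))
    {D : Sym d} (hD : D ≠ 0) : 0 < symPair D (L D) := by
  have hPD := hA.1
  let f : E d → ℝ := fun y => qf D y * qf D y / (ν + qf (symInv A) y) ^ 2
  let g : E d → ℝ := fun y => qf (symConj D A) y / (ν + qf (symInv A) y)
  have hfi : Integrable f (Q : Measure (E d)) := integrable_mul_qf_div_sq hν Q hPD D D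
  have hgi : Integrable g (Q : Measure (E d)) := integrable_qf_div hν Q hPD _
  -- The scatter equation rewrites `tr(DADA)` as an integral, so that both parts of the derivative
  -- can be compared pointwise in `y`.
  have hpair : symPair D (L D) = (ν + d) / 2 * (∫ y, g y ∂(Q : Measure (E d)) -
      ∫ y, f y ∂(Q : Measure (E d))) := by
    have h1 : (ν + d) * ∫ y, g y ∂(Q : Measure (E d)) = symPair D (symConj A D) := by
      rw [symPair_symConj, ← symPair_scatterMap hν Q hPD, hfix]
    have hi : ∀ i j, Integrable (fun y : E d => (D : Matrix (Fin d) (Fin d) ℝ) i j *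
        (y i * y j * qf D y / (ν + qf (symInv A) y) ^ 2)) (Q : Measure (E d)) := fun i j => by
      have := integrable_mul_qf_div_sq hν Q hPD (symUnit i j) D
      simp only [qf_symUnit] at this
      exact this.const_mul _
    have h2 : ∫ y, f y ∂(Q : Measure (E d)) = ∑ i, ∑ j, (D : Matrix (Fin d) (Fin d) ℝ) i j *
        ∫ y, y i * y j * qf D y / (ν + qf (symInv A) y) ^ 2 ∂(Q : Measure (E d)) := by
      have he : ∀ y : E d, f y = ∑ i, ∑ j, (D : Matrix (Fin d) (Fin d) ℝ) i j *
          (y i * y j * qf D y / (ν + qf (symInv A) y) ^ 2) := fun y => by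
        simp only [f]
        nth_rw 1 [qf_eq_sum]
        rw [Finset.sum_mul, Finset.sum_div]
        refine Finset.sum_congr rfl fun k _ => ?_
        rw [Finset.sum_mul, Finset.sum_div]
        exact Finset.sum_congr rfl fun m _ => by ring
      rw [integral_congr_ae (Filter.Eventually.of_forall he),
        integral_finsetSum _ fun k _ => integrable_finsetSum _ fun m _ => hi k m]
      refine Finset.sum_congr rfl fun k _ => ?_
      rw [integral_finsetSum _ fun m _ => hi k m]
      exact Finset.sum_congr rfl fun m _ => integral_const_mul _ _
    have h3 : symPair D (L D) = 1 / 2 * symPair D (symConj A D) -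
        (ν + d) / 2 * ∫ y, f y ∂(Q : Measure (E d)) := by
      rw [h2]
      simp only [symPair, Finset.mul_sum, ← Finset.sum_sub_distrib]
      refine Finset.sum_congr rfl fun i _ => Finset.sum_congr rfl fun j _ => ?_
      rw [fderiv_F_symInv_apply hν hr Q hA hL D i j]
      ring
    rw [h3, ← h1]
    ring
  -- Cauchy–Schwarz gives `(y'Dy)² ≤ (Dy)'A(Dy) · y'A⁻¹y`; the surplus `ν (Dy)'A(Dy)` in the
  -- numerator of `g - f` controls equality.
  have hle : ∀ y, f y ≤ g y ∧ (f y = g y → qf (symConj D A) y = 0) := fun y => by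
    have hp := add_qf_symInv_pos hν hPD y
    have hcs := sq_dotProduct_le hPD (WithLp.toLp 2 ((D : Matrix (Fin d) (Fin d) ℝ) *ᵥ y.ofLp)) y
    rw [← qf_symConj, dotProduct_comm] at hcs
    change qf D y ^ 2 ≤ _ at hcs
    have hnn : 0 ≤ qf (symConj D A) y := by
      rw [qf_symConj]
      exact qf_nonneg hPD _
    have hfg : g y - f y = (qf (symConj D A) y * (ν + qf (symInv A) y) - qf D y ^ 2) /
        (ν + qf (symInv A) y) ^ 2 := by
      simp only [f, g]
      field_simp
    have hnum : qf (symConj D A) y * ν ≤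
        qf (symConj D A) y * (ν + qf (symInv A) y) - qf D y ^ 2 := by linarith
    have hnn' := mul_nonneg hnn hν.le
    refine ⟨?_, fun h => ?_⟩
    · rw [← sub_nonneg, hfg]
      exact div_nonneg (hnn'.trans hnum) (by positivity)
    · rw [h, sub_self, eq_comm, div_eq_zero_iff, or_iff_left (by positivity)] at hfg
      rw [hfg] at hnum
      exact (mul_eq_zero.1 (le_antisymm hnum hnn')).resolve_right hν.ne'
  have hlt : ∫ y, f y ∂(Q : Measure (E d)) < ∫ y, g y ∂(Q : Measure (E d)) := by
    refine lt_of_le_of_ne (integral_mono hfi hgi fun y => (hle y).1) fun h0 => ?_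
    have hae := (integral_eq_iff_of_ae_le hfi hgi
      (Filter.Eventually.of_forall fun y => (hle y).1)).1 h0
    -- Equality of the integrals means `Dy = 0` almost surely; each row of `D` is then orthogonal to
    -- almost every `y`, and vanishes because `Q ∈ 𝒰`.
    refine hD (Subtype.ext ?_)
    ext i j
    have hrow : (WithLp.toLp 2 fun j => (D : Matrix (Fin d) (Fin d) ℝ) i j : E d) = 0 := by
      by_contra hne
      refine not_ae_dotProduct_eq_zero (by positivity) hQ hne ?_
      filter_upwards [hae] with y hy
      have h1 := (hle y).2 hy
      rw [qf_symConj] at h1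
      have h2 : (WithLp.toLp 2 ((D : Matrix (Fin d) (Fin d) ℝ) *ᵥ y.ofLp) : E d) = 0 := by
        by_contra hne
        exact (qf_pos hPD hne).ne' h1
      exact congrArg (fun z : E d => z i) h2
    exact congrArg (fun z : E d => z j) hrow
  rw [hpair]
  exact mul_pos (by positivity) (sub_pos.2 hlt)

/-- Positivity of the trace form makes the derivative injective, hence invertible in finite
dimension. -/
theorem exists_equiv_hasFDerivAt_F {ν δ : ℝ} (hν : 0 < ν) {k : ℕ} (hk : 1 ≤ k) {Q : Law d}
    (hQ : Q ∈ U d (ν + d)) (hA : tScatter ν Q ∈ W δ d) :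
    ∃ L : Sym d ≃L[ℝ] Sym d,
      HasFDerivAt (fun C : Sym d => F ν δ (k + 2) (phi δ (k + 2) ν Q) (symInv C))
        (L : Sym d →L[ℝ] Sym d) (symInv (tScatter ν Q)) := by
  have h1 := contDiffAt_F_symInv hν k (phi δ (k + 2) ν Q) (symInv_mem_W hA)
  have h2 : HasFDerivAt (fun C : Sym d => F ν δ (k + 2) (phi δ (k + 2) ν Q) (symInv C)) _
      (symInv (tScatter ν Q)) :=
    (h1.differentiableAt (by exact_mod_cast (show k ≠ 0 by omega))).hasFDerivAt.comp
      (symInv (tScatter ν Q)) (hasFDerivAt_prodMk_right _ _)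
  set L := (fderiv ℝ (fun p : X δ (k + 2) ν d × Sym d => F ν δ (k + 2) p.1 (symInv p.2))
    (phi δ (k + 2) ν Q, symInv (tScatter ν Q))).comp
      (ContinuousLinearMap.inr ℝ (X δ (k + 2) ν d) (Sym d))
  have hinj : Function.Injective (L : Sym d →ₗ[ℝ] Sym d) := by
    rw [← LinearMap.ker_eq_bot, LinearMap.ker_eq_bot']
    intro D hD
    by_contra hne
    have := symPair_fderiv_pos hν (by omega) hQ hA (tScatter_spec hν hQ).2 h2 hne
    have h0 : L D = 0 := hD
    rw [h0] at this
    simp [symPair] at this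
  refine ⟨(LinearEquiv.ofInjectiveEndo (L : Sym d →ₗ[ℝ] Sym d) hinj).toContinuousLinearEquiv, ?_⟩
  have : ((LinearEquiv.ofInjectiveEndo (L : Sym d →ₗ[ℝ] Sym d) hinj).toContinuousLinearEquiv :
      Sym d →L[ℝ] Sym d) = L := by
    ext1 D
    rfl
  rw [this]
  exact h2

/-- The implicit function is taken in the variable `C = A⁻¹`. No prior continuity of the functional
is needed: the branch of zeros evaluated at any nearby law solves its scatter equation, which gives
both membership in `𝒰` and, by uniqueness, the value. -/
theorem isCk_tScatter {ν δ : ℝ} (hν : 0 < ν) {k : ℕ} (hk : 1 ≤ k) :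
    IsCk k (phi δ (k + 2) ν) {Q : Law d | Q ∈ U d (ν + d) ∧ tScatter ν Q ∈ W δ d}
      (tScatter ν) := by
  rintro Q ⟨hQ, hA⟩
  have hk0 : (k : WithTop ℕ∞) ≠ 0 := by exact_mod_cast (show k ≠ 0 by omega)
  have hfix := (tScatter_spec hν hQ).2
  set A := tScatter ν Q with hAdef
  have cdf := contDiffAt_F_symInv hν k (phi δ (k + 2) ν Q) (symInv_mem_W hA)
  obtain ⟨L, hL⟩ := exists_equiv_hasFDerivAt_F hν hk hQ hA
  have hinv : (fderiv ℝ (fun p : X δ (k + 2) ν d × Sym d => F ν δ (k + 2) p.1 (symInv p.2))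
      (phi δ (k + 2) ν Q, symInv A) ∘L
        ContinuousLinearMap.inr ℝ (X δ (k + 2) ν d) (Sym d)).IsInvertible := by
    refine ⟨L, ?_⟩
    refine hL.unique ?_
    exact (cdf.differentiableAt hk0).hasFDerivAt.comp (symInv A) (hasFDerivAt_prodMk_right _ _)
  set ψ := cdf.implicitFunction hk0 hinv
  have hψ0 : ψ (phi δ (k + 2) ν Q) = symInv A := cdf.implicitFunction_apply_self hk0 hinv
  have hψc : ContDiffAt ℝ k ψ (phi δ (k + 2) ν Q) := cdf.contDiffAt_implicitFunction hk0 hinv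
  have hψe := cdf.eventually_apply_implicitFunction hk0 hinv
  have hzero : F ν δ (k + 2) (phi δ (k + 2) ν Q) (symInv (symInv A)) = 0 := by
    rw [symInv_symInv hA.1, F_phi hν (by omega) Q hA, hfix, sub_self, smul_zero]
  -- The branch must stay in `𝒲`, where zeros of `F` at laws are solutions of the scatter equation.
  have hψW : ∀ᶠ φ in nhds (phi δ (k + 2) ν Q), ψ φ ∈ W δ d := by
    refine hψc.continuousAt.eventually_mem ?_
    rw [hψ0]
    exact (isOpen_W δ).mem_nhds (symInv_mem_W hA)
  have hev := (hψc.eventually (by simp)).and (hψe.and hψW)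
  obtain ⟨O, hO, hOopen, hmem⟩ := eventually_nhds_iff.1 hev
  refine ⟨O, hOopen, hmem, fun φ => symInv (ψ φ), fun φ hφ => ?_, fun Q' hQ' => ?_⟩
  · exact ((contDiffAt_symInv (hO φ hφ).2.2.1).comp φ (hO φ hφ).1).contDiffWithinAt
  · obtain ⟨-, h1, h2⟩ := hO _ hQ'
    have h3 : F ν δ (k + 2) (phi δ (k + 2) ν Q') (symInv (ψ (phi δ (k + 2) ν Q'))) = 0 :=
      h1.trans hzero
    have hW := symInv_mem_W h2
    rw [F_phi hν (by omega) Q' hW, smul_eq_zero_iff_right (by norm_num), sub_eq_zero] at h3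
    have h4 := tScatter_eq_of_fixedPoint hν hW.1 h3
    exact ⟨⟨mem_U_of_fixedPoint hν hW.1 h3, h4 ▸ hW⟩, h4.symm⟩

/-! ### Location and scatter -/

/-- The embedding `v ↦ (v', 0)'`. -/
def zeroSnoc (d : ℕ) : E d →ₗ[ℝ] E (d + 1) where
  toFun v := WithLp.toLp 2 (Fin.snoc (α := fun _ => ℝ) v.ofLp 0)
  map_add' v w := by
    ext i
    refine Fin.lastCases ?_ (fun j => ?_) i <;> simp
  map_smul' c v := by
    ext i
    refine Fin.lastCases ?_ (fun j => ?_) i <;> simp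

@[simp]
theorem zeroSnoc_castSucc (v : E d) (i : Fin d) : zeroSnoc d v i.castSucc = v i := by
  simp [zeroSnoc]

@[simp]
theorem zeroSnoc_last (v : E d) : zeroSnoc d v (Fin.last d) = 0 := by
  simp [zeroSnoc]

@[simp]
theorem T1_castSucc (v : E d) (i : Fin d) : T1 v i.castSucc = v i := by
  simp [T1]

@[simp]
theorem T1_last (v : E d) : T1 v (Fin.last d) = 1 := by
  simp [T1]

theorem zeroSnoc_injective : Function.Injective (zeroSnoc d) := fun v w h => by
  ext i
  have := congrArg (fun z : E (d + 1) => z i.castSucc) h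
  simpa using this

theorem zeroSnoc_sub (y p : E d) : zeroSnoc d (y - p) = T1 y - T1 p := by
  ext i
  refine Fin.lastCases ?_ (fun j => ?_) i <;> simp

/-! ### Lifted laws and the classes `𝒱` and `𝒰` -/

theorem liftLaw_real (P : Law d) {s : Set (E (d + 1))} (hs : MeasurableSet s) :
    (liftLaw P : Measure (E (d + 1))).real s = (P : Measure (E d)).real (T1 ⁻¹' s) := by
  rw [liftLaw, ProbabilityMeasure.toMeasure_map, map_measureReal_apply measurable_T1 hs]

theorem integral_liftLaw (P : Law d) {f : E (d + 1) → ℝ} (hf : Continuous f) :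
    ∫ y, f y ∂(liftLaw P : Measure (E (d + 1))) = ∫ y, f (T1 y) ∂(P : Measure (E d)) := by
  rw [liftLaw, ProbabilityMeasure.toMeasure_map, integral_map measurable_T1.aemeasurable
    hf.aestronglyMeasurable]

/-- A linear subspace meets the hyperplane of last coordinate `1` in an affine subspace whose
dimension is smaller by at least one, or not at all. -/
theorem liftLaw_mem_U {ν : ℝ} (hν : 1 < ν) {P : Law d} (hP : P ∈ V d (ν + d)) :
    liftLaw P ∈ U (d + 1) (ν + d) := by
  intro H hH
  have ha : 0 < ν + d := by positivity
  rw [liftLaw_real P H.closed_of_finiteDimensional.measurableSet]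
  rcases (T1 ⁻¹' (H : Set (E (d + 1)))).eq_empty_or_nonempty with he | ⟨p, hp⟩
  -- Here `ν > 1` is used, as `d + 1 < ν + d`: the bound must be positive even for `H = 0`.
  · rw [he, measureReal_empty, sub_pos, div_lt_one ha]
    push_cast
    have : (0 : ℝ) ≤ Module.finrank ℝ H := Nat.cast_nonneg _
    linarith
  · let K : Submodule ℝ (E d) := H.comap (zeroSnoc d)
    let J : AffineSubspace ℝ (E d) := AffineSubspace.mk' p K
    have hJ : (J : Set (E d)) = T1 ⁻¹' (H : Set (E (d + 1))) := by
      ext y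
      have h1 : y ∈ J ↔ zeroSnoc d (y - p) ∈ H := AffineSubspace.mem_mk'
      rw [SetLike.mem_coe, h1, zeroSnoc_sub, Submodule.sub_mem_iff_left H hp]
      rfl
    have hK : Module.finrank ℝ K < Module.finrank ℝ H := by
      have h1 : Module.finrank ℝ (K.map (zeroSnoc d)) = Module.finrank ℝ K :=
        (Submodule.equivMapOfInjective _ zeroSnoc_injective K).finrank_eq.symm
      rw [← h1]
      refine Submodule.finrank_lt_finrank_of_lt (lt_of_le_of_ne (Submodule.map_comap_le _ _) ?_)
      intro h
      have h2 : T1 p ∈ K.map (zeroSnoc d) := h ▸ hp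
      obtain ⟨v, -, hv⟩ := h2
      have := congrArg (fun z : E (d + 1) => z (Fin.last d)) hv
      simp at this
    have hdir : J.direction = K := AffineSubspace.direction_mk' _ _
    have h1 := hP J ⟨p, by rw [hJ]; exact hp⟩ (by rw [hdir]; omega)
    rw [hJ, hdir] at h1
    refine h1.trans_le ?_
    have h2 : (Module.finrank ℝ K : ℝ) + 1 ≤ Module.finrank ℝ H := by exact_mod_cast hK
    have h3 : ((d + 1 : ℕ) - Module.finrank ℝ H : ℝ) / (ν + d) ≤
        (d - Module.finrank ℝ K : ℝ) / (ν + d) := by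
      refine div_le_div_of_nonneg_right ?_ ha.le
      push_cast
      linarith
    linarith

/-- The lift of `J` lies in the linear span of one lifted point and the directions of `J`, of
dimension at most one more. -/
theorem mem_V_of_liftLaw_mem_U {ν : ℝ} (hν : 1 < ν) {P : Law d}
    (hP : liftLaw P ∈ U (d + 1) (ν + d)) : P ∈ V d (ν + d) := by
  rintro J ⟨p, hp⟩ hJ
  have ha : 0 < ν + d := by positivity
  let H : Submodule ℝ (E (d + 1)) := J.direction.map (zeroSnoc d) ⊔ Submodule.span ℝ {T1 p}
  have hfr : Module.finrank ℝ H ≤ Module.finrank ℝ J.direction + 1 := by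
    refine (Submodule.finrank_add_le_finrank_add_finrank _ _).trans ?_
    exact add_le_add (Submodule.finrank_map_le _ _) ((finrank_span_le_card _).trans (by simp))
  have hsub : (J : Set (E d)) ⊆ T1 ⁻¹' (H : Set (E (d + 1))) := by
    intro y hy
    have h1 : zeroSnoc d (y - p) ∈ H := Submodule.mem_sup_left
      (Submodule.mem_map_of_mem (AffineSubspace.vsub_mem_direction hy hp))
    have h2 : T1 p ∈ H := Submodule.mem_sup_right (Submodule.mem_span_singleton_self _)
    have h3 := H.add_mem h1 h2
    rw [zeroSnoc_sub, sub_add_cancel] at h3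
    exact h3
  have h1 := hP H (by omega)
  rw [liftLaw_real P H.closed_of_finiteDimensional.measurableSet] at h1
  refine ((measureReal_mono hsub).trans_lt h1).trans_le ?_
  have h2 : (Module.finrank ℝ H : ℝ) ≤ Module.finrank ℝ J.direction + 1 := by exact_mod_cast hfr
  have h3 : (d - Module.finrank ℝ J.direction : ℝ) / (ν + d) ≤
      ((d + 1 : ℕ) - Module.finrank ℝ H : ℝ) / (ν + d) := by
    refine div_le_div_of_nonneg_right ?_ ha.le
    push_cast
    linarith
  linarith

/-- The matrix with blocks `C`, `0`, `0`, `0`. -/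
def padSym (C : Sym d) : Sym (d + 1) :=
  ⟨Matrix.of fun i j => Fin.lastCases (motive := fun _ => ℝ) 0 (fun i' =>
      Fin.lastCases (motive := fun _ => ℝ) 0
        (fun j' => (C : Matrix (Fin d) (Fin d) ℝ) i' j') j) i, by
    change Matrix.transpose _ = _
    ext i j
    refine Fin.lastCases ?_ (fun i' => ?_) i <;> refine Fin.lastCases ?_ (fun j' => ?_) j <;>
      simp [C.apply_comm]⟩

/-- The matrix with blocks `Σ + μμ'`, `μ`, `μ'`, `1`. -/
def joinSym (θ : E d × Sym d) : Sym (d + 1) := padSym θ.2 + symOuter (T1 θ.1)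

theorem joinSym_castSucc_castSucc (θ : E d × Sym d) (i j : Fin d) :
    (joinSym θ : Matrix (Fin (d + 1)) (Fin (d + 1)) ℝ) i.castSucc j.castSucc =
      (θ.2 : Matrix (Fin d) (Fin d) ℝ) i j + θ.1 i * θ.1 j := by
  simp [joinSym, padSym, symOuter, Matrix.vecMulVec_apply]

theorem joinSym_castSucc_last (θ : E d × Sym d) (i : Fin d) :
    (joinSym θ : Matrix (Fin (d + 1)) (Fin (d + 1)) ℝ) i.castSucc (Fin.last d) = θ.1 i := by
  simp [joinSym, padSym, symOuter, Matrix.vecMulVec_apply]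

theorem joinSym_last_castSucc (θ : E d × Sym d) (i : Fin d) :
    (joinSym θ : Matrix (Fin (d + 1)) (Fin (d + 1)) ℝ) (Fin.last d) i.castSucc = θ.1 i := by
  simp [joinSym, padSym, symOuter, Matrix.vecMulVec_apply]

theorem joinSym_last_last (θ : E d × Sym d) :
    (joinSym θ : Matrix (Fin (d + 1)) (Fin (d + 1)) ℝ) (Fin.last d) (Fin.last d) = 1 := by
  simp [joinSym, padSym, symOuter, Matrix.vecMulVec_apply]

/-- The inverse of `joinSym`. -/
def splitSym (A : Sym (d + 1)) : E d × Sym d :=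
  (WithLp.toLp 2 fun i => (A : Matrix (Fin (d + 1)) (Fin (d + 1)) ℝ) i.castSucc (Fin.last d),
    ⟨Matrix.of fun i j => (A : Matrix (Fin (d + 1)) (Fin (d + 1)) ℝ) i.castSucc j.castSucc -
      (A : Matrix (Fin (d + 1)) (Fin (d + 1)) ℝ) i.castSucc (Fin.last d) *
        (A : Matrix (Fin (d + 1)) (Fin (d + 1)) ℝ) j.castSucc (Fin.last d), by
      change Matrix.transpose _ = _
      ext i j
      simp only [Matrix.transpose_apply, Matrix.of_apply]
      rw [A.apply_comm j.castSucc i.castSucc]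
      ring⟩)

theorem splitSym_snd_apply (A : Sym (d + 1)) (i j : Fin d) :
    ((splitSym A).2 : Matrix (Fin d) (Fin d) ℝ) i j =
      (A : Matrix (Fin (d + 1)) (Fin (d + 1)) ℝ) i.castSucc j.castSucc -
      (A : Matrix (Fin (d + 1)) (Fin (d + 1)) ℝ) i.castSucc (Fin.last d) *
        (A : Matrix (Fin (d + 1)) (Fin (d + 1)) ℝ) j.castSucc (Fin.last d) := rfl

theorem splitSym_joinSym (θ : E d × Sym d) : splitSym (joinSym θ) = θ := by
  refine Prod.ext ?_ (Subtype.ext ?_)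
  · ext i
    exact joinSym_castSucc_last θ i
  · ext i j
    rw [splitSym_snd_apply, joinSym_castSucc_castSucc, joinSym_castSucc_last, joinSym_castSucc_last]
    ring

theorem joinSym_splitSym {A : Sym (d + 1)}
    (hA : (A : Matrix (Fin (d + 1)) (Fin (d + 1)) ℝ) (Fin.last d) (Fin.last d) = 1) :
    joinSym (splitSym A) = A := by
  refine Subtype.ext ?_
  ext i j
  refine Fin.lastCases ?_ (fun i' => ?_) i <;> refine Fin.lastCases ?_ (fun j' => ?_) j
  · rw [joinSym_last_last, hA]
  · rw [joinSym_last_castSucc, A.apply_comm]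
    rfl
  · rw [joinSym_castSucc_last]
    rfl
  · rw [joinSym_castSucc_castSucc, splitSym_snd_apply]
    exact sub_add_cancel _ _

theorem contDiff_splitSym {n : WithTop ℕ∞} : ContDiff ℝ n (splitSym (d := d)) := by
  refine ContDiff.prodMk ?_ ?_
  · exact contDiff_euclidean.2 fun i => (entryL i.castSucc (Fin.last d)).contDiff
  · refine contDiff_iff_contDiffAt.2 fun A => contDiffWithinAt_sym fun i j => ?_
    exact ((entryL i.castSucc j.castSucc).contDiff.sub
      ((entryL i.castSucc (Fin.last d)).contDiff.mul
        (entryL j.castSucc (Fin.last d)).contDiff)).contDiffAt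

/-- The first `d` coordinates. -/
def initVec (x : E (d + 1)) : E d := WithLp.toLp 2 fun i => x i.castSucc

theorem qf_joinSym (θ : E d × Sym d) (x : E (d + 1)) :
    qf (joinSym θ) x = qf θ.2 (initVec x) + ((T1 θ.1).ofLp ⬝ᵥ x.ofLp) ^ 2 := by
  rw [joinSym, qf_add, qf_symOuter]
  congr 1
  simp [qf_eq_sum, Fin.sum_univ_castSucc, padSym, initVec]

theorem joinSym_mem_PD {θ : E d × Sym d} (hθ : θ.2 ∈ PD d) : joinSym θ ∈ PD (d + 1) := by
  refine mem_PD_of_qf_pos fun x hx => ?_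
  rw [qf_joinSym]
  by_cases h : initVec x = 0
  · have h1 : ∀ i : Fin d, x i.castSucc = 0 := fun i => congrArg (fun z : E d => z i) h
    have h2 : x (Fin.last d) ≠ 0 := fun h2 => hx (by
      ext i
      refine Fin.lastCases h2 h1 i)
    have h3 : (T1 θ.1).ofLp ⬝ᵥ x.ofLp = x (Fin.last d) := by
      simp [dotProduct, Fin.sum_univ_castSucc, h1]
    rw [h3, h]
    have : qf θ.2 (0 : E d) = 0 := by simp [qf]
    rw [this]
    positivity
  · have := qf_pos hθ h
    positivity

theorem splitSym_mem_PD {A : Sym (d + 1)} (hA : A ∈ PD (d + 1))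
    (h1 : (A : Matrix (Fin (d + 1)) (Fin (d + 1)) ℝ) (Fin.last d) (Fin.last d) = 1) :
    (splitSym A).2 ∈ PD d := by
  refine mem_PD_of_qf_pos fun x hx => ?_
  set μ := (splitSym A).1
  -- The last coordinate is chosen to annihilate the square `((μ',1)z)²` in `qf_joinSym`.
  let z : E (d + 1) := WithLp.toLp 2 (Fin.snoc (α := fun _ => ℝ) x.ofLp (-(μ.ofLp ⬝ᵥ x.ofLp)))
  have hz : initVec z = x := by
    ext i
    simp [initVec, z]
  have hz0 : z ≠ 0 := fun h => hx (by rw [← hz, h]; rfl)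
  have h2 : (T1 μ).ofLp ⬝ᵥ z.ofLp = 0 := by
    simp only [dotProduct, Fin.sum_univ_castSucc, T1_castSucc, T1_last]
    simp [z, dotProduct]
  have h3 := qf_pos hA hz0
  rw [← joinSym_splitSym h1, qf_joinSym, hz, h2] at h3
  simpa using h3

/-! ### The two criteria under the block correspondence -/

theorem qf_symInv_of_mulVec_eq {A : Sym d} (hA : A ∈ PD d) {x y : E d}
    (h : (A : Matrix (Fin d) (Fin d) ℝ) *ᵥ x.ofLp = y.ofLp) :
    qf (symInv A) y = x.ofLp ⬝ᵥ y.ofLp := by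
  have h1 := qf_symInv_mulVec hA x
  rw [h] at h1
  rw [← h]
  exact h1

theorem qf_symInv_joinSym {θ : E d × Sym d} (hθ : θ.2 ∈ PD d) (y : E d) :
    qf (symInv (joinSym θ)) (T1 y) = 1 + qf (symInv θ.2) (y - θ.1) := by
  set w : E d := WithLp.toLp 2 ((θ.2 : Matrix (Fin d) (Fin d) ℝ)⁻¹ *ᵥ (y - θ.1).ofLp) with hw
  have e1 : (θ.2 : Matrix (Fin d) (Fin d) ℝ) *ᵥ w.ofLp = (y - θ.1).ofLp := by
    rw [hw, Matrix.mulVec_mulVec, Matrix.mul_nonsing_inv _ (isUnit_det_of_mem_PD hθ),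
      Matrix.one_mulVec]
  -- The solution of `joinSym θ x = (y',1)'`: its last coordinate makes `(μ',1)x = 1`, and `Σw = y -
  -- μ` does the rest.
  let x : E (d + 1) := WithLp.toLp 2 (Fin.snoc (α := fun _ => ℝ) w.ofLp
    (1 - θ.1.ofLp ⬝ᵥ w.ofLp))
  have hx1 : ∀ i : Fin d, x i.castSucc = w i := fun i => by simp [x]
  have hx2 : x (Fin.last d) = 1 - θ.1.ofLp ⬝ᵥ w.ofLp := by simp [x]
  have hA : (joinSym θ : Matrix (Fin (d + 1)) (Fin (d + 1)) ℝ) *ᵥ x.ofLp = (T1 y).ofLp := by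
    funext i
    refine Fin.lastCases ?_ (fun i' => ?_) i
    · simp only [Matrix.mulVec, dotProduct, Fin.sum_univ_castSucc, joinSym_last_castSucc,
        joinSym_last_last, hx1, hx2, T1_last]
      ring
    · have h1 : ∑ j, (θ.2 : Matrix (Fin d) (Fin d) ℝ) i' j * w j = y i' - θ.1 i' :=
        congrFun e1 i'
      simp only [Matrix.mulVec, dotProduct, Fin.sum_univ_castSucc, joinSym_castSucc_castSucc,
        joinSym_castSucc_last, hx1, hx2, T1_castSucc, add_mul, Finset.sum_add_distrib, h1]
      simp only [mul_assoc, ← Finset.mul_sum]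
      ring
  rw [qf_symInv_of_mulVec_eq (joinSym_mem_PD hθ) hA, qf_symInv_of_mulVec_eq hθ e1]
  simp only [dotProduct, Fin.sum_univ_castSucc, hx1, hx2, T1_castSucc, T1_last, PiLp.sub_apply,
    mul_sub, Finset.sum_sub_distrib]
  rw [Finset.sum_congr rfl fun i _ => mul_comm (w i) (θ.1 i)]
  ring

/-- The Schur complement of the corner entry `1` is `Σ + μμ' - μμ' = Σ`. -/
theorem det_joinSym (θ : E d × Sym d) :
    (joinSym θ : Matrix (Fin (d + 1)) (Fin (d + 1)) ℝ).det =
      (θ.2 : Matrix (Fin d) (Fin d) ℝ).det := by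
  have h : (joinSym θ : Matrix (Fin (d + 1)) (Fin (d + 1)) ℝ).submatrix finSumFinEquiv
      finSumFinEquiv = Matrix.fromBlocks
        ((θ.2 : Matrix (Fin d) (Fin d) ℝ) + Matrix.vecMulVec θ.1.ofLp θ.1.ofLp)
        (Matrix.replicateCol (Fin 1) θ.1.ofLp) (Matrix.replicateRow (Fin 1) θ.1.ofLp) 1 := by
    ext i j
    rcases i with i | i <;> rcases j with j | j
    · exact joinSym_castSucc_castSucc θ i j
    · obtain rfl : j = 0 := Subsingleton.elim _ _
      exact joinSym_castSucc_last θ i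
    · obtain rfl : i = 0 := Subsingleton.elim _ _
      exact joinSym_last_castSucc θ j
    · obtain rfl : j = 0 := Subsingleton.elim _ _
      obtain rfl : i = 0 := Subsingleton.elim _ _
      exact joinSym_last_last θ
  rw [← Matrix.det_submatrix_equiv_self finSumFinEquiv, h, Matrix.det_fromBlocks_one₂₂]
  congr 1
  ext i j
  simp [Matrix.mul_apply, Matrix.vecMulVec_apply]

theorem continuous_rho_sub_rho {ν : ℝ} (hν : 0 < ν) {A : Sym d} (hA : A ∈ PD d) :
    Continuous fun y => rho ν d (qf (symInv A) y) - rho ν d (y.ofLp ⬝ᵥ y.ofLp) := by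
  have h1 := continuous_qf (symInv A)
  refine Continuous.sub ?_ ?_
  · refine continuous_const.mul (Continuous.log (by fun_prop) fun y => ?_)
    exact (div_pos (add_qf_symInv_pos hν hA y) hν).ne'
  · refine continuous_const.mul (Continuous.log (by fun_prop) fun y => ?_)
    have : 0 ≤ y.ofLp ⬝ᵥ y.ofLp := by
      rw [dotProduct_self_eq_norm_sq]
      positivity
    positivity

/-- The location-scatter criterion is the scatter criterion of the lifted law. -/
theorem scatterCrit_joinSym {ν : ℝ} (hν : 1 < ν) (P : Law d) {θ : E d × Sym d}
    (hθ : θ.2 ∈ PD d) :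
    scatterCrit (ν - 1) (liftLaw P) (joinSym θ) = locScatCrit ν P θ := by
  have hν' : 0 < ν - 1 := by linarith
  have hPD := joinSym_mem_PD hθ
  have hc := continuous_rho_sub_rho hν' hPD
  -- The shift of parameters is consistent: `(ν-1) + (1+s) = ν + s` and `(ν-1) + (d+1) = ν + d`.
  have he : ∀ y : E d, rho (ν - 1) (d + 1) (qf (symInv (joinSym θ)) (T1 y)) -
      rho (ν - 1) (d + 1) ((T1 y).ofLp ⬝ᵥ (T1 y).ofLp) =
      rho ν d (qf (symInv θ.2) (y - θ.1)) - rho ν d (y.ofLp ⬝ᵥ y.ofLp) := fun y => by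
    have hq := qf_nonneg (symInv_mem_PD hθ) (y - θ.1)
    have hn : 0 ≤ y.ofLp ⬝ᵥ y.ofLp := by
      rw [dotProduct_self_eq_norm_sq]
      positivity
    have hT : (T1 y).ofLp ⬝ᵥ (T1 y).ofLp = 1 + y.ofLp ⬝ᵥ y.ofLp := by
      simp only [dotProduct, Fin.sum_univ_castSucc, T1_castSucc, T1_last]
      ring
    rw [qf_symInv_joinSym hθ, hT, rho_sub_rho hν' (by positivity) (by positivity),
      rho_sub_rho (by linarith) hq hn]
    push_cast
    congr 2 <;> ring
  have hInt : Integrable (fun y : E d => rho ν d (qf (symInv θ.2) (y - θ.1)) -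
      rho ν d (y.ofLp ⬝ᵥ y.ofLp)) (P : Measure (E d)) := by
    have h1 := integrable_rho_sub_rho hν' (liftLaw P) hPD
    rw [liftLaw, ProbabilityMeasure.toMeasure_map, integrable_map_measure
      hc.aestronglyMeasurable measurable_T1.aemeasurable] at h1
    exact h1.congr (Filter.Eventually.of_forall he)
  rw [scatterCrit, locScatCrit, integral_liftLaw P hc, det_joinSym]
  simp only [he, add_sub_assoc]
  rw [integral_add (integrable_const _) hInt]
  simp

/-- The last diagonal entry of the scatter matrix of a lifted law is `1`. -/
theorem last_entry_of_fixedPoint {ν : ℝ} (hν : 1 < ν) {P : Law d} {A : Sym (d + 1)}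
    (hA : A ∈ PD (d + 1)) (hfix : scatterMap (ν - 1) (liftLaw P) A = A) :
    (A : Matrix (Fin (d + 1)) (Fin (d + 1)) ℝ) (Fin.last d) (Fin.last d) = 1 := by
  have hν' : 0 < ν - 1 := by linarith
  have hae : ∀ᵐ y ∂(liftLaw P : Measure (E (d + 1))), y (Fin.last d) = 1 := by
    rw [liftLaw, ProbabilityMeasure.toMeasure_map, ae_map_iff measurable_T1.aemeasurable]
    · exact Filter.Eventually.of_forall T1_last
    · exact measurableSet_eq_fun (by fun_prop) measurable_const
  have hInt := integrable_mul_div hν' (liftLaw P) hA (Fin.last d) (Fin.last d)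
  have hInt' := integrable_qf_div hν' (liftLaw P) hA (symInv A)
  -- Since the last coordinate is almost surely `1`, the two integrands add up to `1`. The trace
  -- identity evaluates the second integral as `(d+1)/(ν+d)`, which determines the first.
  have h1 : (ν - 1) * ∫ y, y (Fin.last d) * y (Fin.last d) / (ν - 1 + qf (symInv A) y)
        ∂(liftLaw P : Measure (E (d + 1))) +
      ∫ y, qf (symInv A) y / (ν - 1 + qf (symInv A) y)
        ∂(liftLaw P : Measure (E (d + 1))) = 1 := by
    rw [← integral_const_mul, ← integral_add (hInt.const_mul _) hInt']
    refine Eq.trans (b := ∫ _, (1 : ℝ) ∂(liftLaw P : Measure (E (d + 1))))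
      (integral_congr_ae ?_) (by simp)
    filter_upwards [hae] with y hy
    have := (add_qf_symInv_pos hν' hA y).ne'
    rw [hy]
    field_simp
  have h2 := symPair_scatterMap hν' (liftLaw P) hA (symInv A)
  rw [hfix, symPair_symInv_self hA] at h2
  have h3 := scatterMap_apply (ν - 1) (liftLaw P) A (Fin.last d) (Fin.last d)
  rw [hfix] at h3
  rw [h3]
  push_cast at h2 ⊢
  refine mul_left_cancel₀ hν'.ne' ?_
  linear_combination (ν - 1 + (d + 1)) * h1 + h2

theorem IsTLocScat.unique {ν : ℝ} {P : Law d} {θ η : E d × Sym d} (hθ : IsTLocScat ν P θ)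
    (hη : IsTLocScat ν P η) : θ = η := by
  by_contra hne
  exact lt_asymm (hθ.2 η hη.1 (Ne.symm hne)) (hη.2 θ hθ.1 hne)

/-- The block correspondence embeds the location-scatter problem into a scatter problem, and the
strict minimum over all of `𝒫_{d+1}` lies in the image because its last entry is `1`. -/
theorem isTLocScat_splitSym {ν : ℝ} (hν : 1 < ν) {P : Law d} (hP : P ∈ V d (ν + d)) :
    IsTLocScat ν P (splitSym (tScatter (ν - 1) (liftLaw P))) := by
  have hν' : 0 < ν - 1 := by linarith
  have ha : ν - 1 + ((d + 1 : ℕ) : ℝ) = ν + d := by push_cast; ring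
  obtain ⟨hA, hfix⟩ := tScatter_spec hν' (ha ▸ liftLaw_mem_U hν hP :
    liftLaw P ∈ U (d + 1) (ν - 1 + ((d + 1 : ℕ) : ℝ)))
  set A := tScatter (ν - 1) (liftLaw P)
  have h1 := last_entry_of_fixedPoint hν hA hfix
  have hS := splitSym_mem_PD hA h1
  refine ⟨hS, fun η hη hne => ?_⟩
  rw [← scatterCrit_joinSym hν P hS, ← scatterCrit_joinSym hν P hη, joinSym_splitSym h1]
  refine scatterCrit_lt_of_fixedPoint hν' hA hfix (joinSym_mem_PD hη) fun h => hne ?_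
  rw [← splitSym_joinSym η, h]

theorem tLocScat_eq {ν : ℝ} (hν : 1 < ν) {P : Law d} (hP : P ∈ V d (ν + d)) :
    tLocScat ν P = splitSym (tScatter (ν - 1) (liftLaw P)) := by
  have h := isTLocScat_splitSym hν hP
  have hex : ∃ θ, IsTLocScat ν P θ := ⟨_, h⟩
  rw [tLocScat, dif_pos hex]
  exact hex.choose_spec.unique h

/-- The functional is the lifted scatter functional followed by the polynomial map `splitSym`;
membership in `𝒱` is recovered from that of the lifted law in `𝒰`. -/
theorem isCk_tLocScat {ν δ : ℝ} (hν : 1 < ν) {k : ℕ} (hk : 1 ≤ k) :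
    IsCk k (fun P : Law d => phi δ (k + 2) (ν - 1) (liftLaw P))
      {P | P ∈ V d (ν + d) ∧ tScatter (ν - 1) (liftLaw P) ∈ W δ (d + 1)} (tLocScat ν) := by
  have hν' : 0 < ν - 1 := by linarith
  have ha : ν - 1 + ((d + 1 : ℕ) : ℝ) = ν + d := by push_cast; ring
  rintro P ⟨hP, hW⟩
  have hC := isCk_tScatter (d := d + 1) (δ := δ) hν' hk
  rw [ha] at hC
  obtain ⟨O, hO, hmem, S, hS, hval⟩ := hC (liftLaw P) ⟨liftLaw_mem_U hν hP, hW⟩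
  refine ⟨O, hO, hmem, fun φ => splitSym (S φ), contDiff_splitSym.comp_contDiffOn hS,
    fun P' hP' => ?_⟩
  obtain ⟨⟨h1, h2⟩, h3⟩ := hval _ hP'
  have hV := mem_V_of_liftLaw_mem_U hν h1
  exact ⟨⟨hV, h2⟩, by rw [tLocScat_eq hν hV, ← h3]⟩

end TFunctional

end

theorem theorem7p1 (d k : ℕ) (hd : 1 ≤ d) (hk : 1 ≤ k) (ν : ℝ) (hν : 0 < ν) :
    (∀ Q ∈ U d (ν + d), ∃ δ : ℝ, 0 < δ ∧ δ < 1 ∧ tScatter ν Q ∈ W δ d ∧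
      -- (a)
      ContDiffOn ℝ k (fun p : X δ (k + 2) ν d × Sym d => F ν δ (k + 2) p.1 p.2)
        (univ ×ˢ W δ d) ∧
      -- (b)
      (∀ Q' ∈ U d (ν + d), tScatter ν Q' ∈ W δ d →
        ∃ L : Sym d ≃L[ℝ] Sym d,
          HasFDerivAt (fun C : Sym d => F ν δ (k + 2) (phi δ (k + 2) ν Q') (symInv C))
            (L : Sym d →L[ℝ] Sym d) (symInv (tScatter ν Q'))) ∧
      -- (c)
      IsCk k (phi δ (k + 2) ν) {Q' | Q' ∈ U d (ν + d) ∧ tScatter ν Q' ∈ W δ d} (tScatter ν)) ∧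
    -- (d)
    (1 < ν → ∀ P ∈ V d (ν + d), ∃ δ : ℝ, 0 < δ ∧ δ < 1 ∧
      tScatter (ν - 1) (liftLaw P) ∈ W δ (d + 1) ∧
      IsTLocScat ν P (tLocScat ν P) ∧
      IsCk k (fun P' : Law d => phi δ (k + 2) (ν - 1) (liftLaw P'))
        {P' | P' ∈ V d (ν + d) ∧ tScatter (ν - 1) (liftLaw P') ∈ W δ (d + 1)} (tLocScat ν)) := by
  refine ⟨fun Q hQ => ?_, fun hν1 P hP => ?_⟩
  -- Any `δ` in `(0,1)` whose `𝒲` contains the scatter matrix will do; the remaining assertions do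
  -- not restrict `δ`.
  · obtain ⟨δ, h0, h1, hW⟩ := exists_mem_W (tScatter_spec hν hQ).1
    exact ⟨δ, h0, h1, hW, contDiffOn_F hν k,
      fun Q' hQ' hW' => exists_equiv_hasFDerivAt_F hν hk hQ' hW', isCk_tScatter hν hk⟩
  · have hU := liftLaw_mem_U hν1 hP
    rw [show ν + (d : ℝ) = ν - 1 + ((d + 1 : ℕ) : ℝ) by push_cast; ring] at hU
    obtain ⟨δ, h0, h1, hW⟩ := exists_mem_W (tScatter_spec (sub_pos.2 hν1) hU).1
    refine ⟨δ, h0, h1, hW, ?_, isCk_tLocScat hν1 hk⟩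
    rw [tLocScat_eq hν1 hP]
    exact isTLocScat_splitSym hν1 hP
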